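/- Let $K$ be an algebraically closed field of characteristic $p>2$, let $n\ge 1$, and let $V=V_{\bar 0}\oplus V_{\bar 1}$ be the superspace of dimension $1|2n$ over $K$ with a nondegenerate even supersymmetric bilinear form $\phi$ (symmetric on $V_{\bar 0}$, skew-symmetric on $V_{\bar 1}$, $V_{\bar 0}\perp V_{\bar 1}$). Let $\mathfrak g=\mathfrak{osp}(1|2n)=\mathfrak g_{\bar 0}\oplus\mathfrak g_{\bar 1}$, where $\mathfrak g_{i}=\{f\in\mathfrak{gl}(V)_i : \phi(f(x),y)=-(-1)^{i|x|}\phi(x,f(y))\}$; it is a restricted Lie superalgebra with $x^{[p]}=x^p$ (the $p$-th power in $\mathrm{End}(V)$) for $x\in\mathfrak g_{\bar 0}\cong\mathfrak{sp}(2n)$. For $\chi\in\mathfrak g_{\bar 0}^*$ and a restricted subalgebra $\mathfrak s\subseteq\mathfrak g$ let $U_\chi(\mathfrak s)$ be the quotient of the universal enveloping superalgebra $U(\mathfrak s)$ by the ideal generated by the elements $x^p-x^{[p]}-\chi(x)^p$, $x\in\mathfrak s_{\bar 0}$. Fix a triangular decomposition $\mathfrak g=\mathfrak n^-\oplus\mathfrak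 h\oplus\mathfrak n^+$: for a symplectic basis $e_1,\dots,e_n,f_1,\dots,f_n$ of $V_{\bar 1}$ and a nonzero $v\in V_{\bar 0}$, the subalgebras $\mathfrak h$, $\mathfrak n^+$, $\mathfrak n^-$ consist of the elements of $\mathfrak g$ whose matrices in the ordered basis $e_1,\dots,e_n,v,f_n,\dots,f_1$ are diagonal, strictly upper triangular, and strictly lower triangular, respectively. Put $\mathfrak b=\mathfrak h\oplus\mathfrak n^+$. Let $\chi\in\mathfrak g_{\bar 0}^*$ satisfy $\chi(\mathfrak n^+_{\bar 0})=0$. For $\lambda\in\mathfrak h^*$ with $\lambda(h)^p-\lambda(h^{[p]})=\chi(h)^p$ for all $h\in\mathfrak h$, let $K_\lambda$ be the one-dimensional $U_\chi(\mathfrak b)$-module on which $h\in\mathfrak h$ acts by $\lambda(h)$ and $\mathfrak n^+$ acts by $0$. The baby Verma module is $Z_\chi(\lambda)=U_\chi(\mathfrak g)\otimes_{U_\chi(\mathfrak b)}K_\lambda$, with its natural $\mathbb Z_2$-grading. Suppose that $\chi$ is regular nilpotent, that is, $\chi(y)=\mathrm{str}(Xy)$ for all $y\in\mathfrak g_{\bar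 0}$, where $X\in\mathfrak g_{\bar 0}$ is a regular nilpotent element (nilpotent, with centralizer in $\mathfrak g_{\bar 0}$ of dimension $n=\operatorname{rank}\mathfrak g_{\bar 0}$). Then every baby Verma module $Z_\chi(\lambda)$ is simple as a $U_\chi(\mathfrak g)$-supermodule: it is nonzero, and its only $\mathbb Z_2$-graded submodules are $0$ and $Z_\chi(\lambda)$. -/

import Mathlib

open scoped TensorProduct

namespace SuperLie

/-! ### Matrix Lie superalgebras

`ι` is the index set of a homogeneous basis of a superspace `V`, and `π : ι → ZMod 2` gives the
parities of the basis vectors; `Matrix ι ι K` is then `gl(V)`. -/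

/-- Homogeneous vectors of parity `j` in the superspace `V = K^ι`. -/
def vecPart (K : Type*) [Field K] {ι : Type*} (π : ι → ZMod 2) (j : ZMod 2) :
    Submodule K (ι → K) where
  carrier := {x | ∀ a, x a ≠ 0 → π a = j}
  zero_mem' := by intro a h; simp at h
  add_mem' := by
    intro x y hx hy a h
    by_cases h1 : x a = 0
    · exact hy a (by simpa [h1] using h)
    · exact hx a h1
  smul_mem' := by
    intro c x hx a h
    exact hx a (by intro h0; simp [h0] at h)

/-- Homogeneous elements of parity `i` in `gl(V)`. -/
def glPart (K : Type*) [Field K] {ι : Type*} (π : ι → ZMod 2) (i : ZMod 2) :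
    Submodule K (Matrix ι ι K) where
  carrier := {M | ∀ a b, M a b ≠ 0 → π a = i + π b}
  zero_mem' := by intro a b h; simp at h
  add_mem' := by
    intro x y hx hy a b h
    by_cases h1 : x a b = 0
    · exact hy a b (by simpa [h1] using h)
    · exact hx a b h1
  smul_mem' := by
    intro c x hx a b h
    exact hx a b (by intro h0; simp [h0] at h)

/-- The sign `(-1)^{ij}`. -/
def superSign (K : Type*) [Field K] (i j : ZMod 2) : K := if i = 1 ∧ j = 1 then -1 else 1

/-- The superbracket `[x, y] = xy - (-1)^{ij} yx` of elements of parities `i` and `j`. -/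
def superBracket {K : Type*} [Field K] {ι : Type*} [Fintype ι] (i j : ZMod 2)
    (x y : Matrix ι ι K) : Matrix ι ι K :=
  x * y - superSign K i j • (y * x)

/-- A restricted Lie subsuperalgebra of `gl(V)`: a graded subspace closed under the superbracket
whose even part is closed under the `p`-th power map `x ↦ x ^ p`. -/
structure RestrictedLie (K : Type*) [Field K] {ι : Type*} [Fintype ι] [DecidableEq ι]
    (π : ι → ZMod 2) (p : ℕ) where
  part : ZMod 2 → Submodule K (Matrix ι ι K)
  part_le : ∀ i, part i ≤ glPart K π i
  bracket_mem : ∀ i j x y, x ∈ part i → y ∈ part j → superBracket i j x y ∈ part (i + j)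
  pow_mem : ∀ x ∈ part 0, x ^ p ∈ part 0

section Enveloping

variable {K : Type*} [Field K] {ι : Type*} [Fintype ι] [DecidableEq ι] {π : ι → ZMod 2} {p : ℕ}

/-- The underlying space `g = g_0 + g_1`. -/
def RestrictedLie.carrier (S : RestrictedLie K π p) : Submodule K (Matrix ι ι K) :=
  S.part 0 ⊔ S.part 1

theorem RestrictedLie.part_le_carrier (S : RestrictedLie K π p) (i : ZMod 2) :
    S.part i ≤ S.carrier := by
  fin_cases i
  · exact le_sup_left
  · exact le_sup_right

/-- Inclusion of a homogeneous component. -/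
def RestrictedLie.incl (S : RestrictedLie K π p) (i : ZMod 2) : S.part i →ₗ[K] S.carrier :=
  Submodule.inclusion (S.part_le_carrier i)

/-- The bracket `g_i × g_j → g_{i+j}`. -/
def RestrictedLie.bracket (S : RestrictedLie K π p) (i j : ZMod 2)
    (x : S.part i) (y : S.part j) : S.part (i + j) :=
  ⟨superBracket i j x.1 y.1, S.bracket_mem i j x.1 y.1 x.2 y.2⟩

/-- The `p`-th power map `x ↦ x^{[p]}` on `g_0`. -/
def RestrictedLie.pmap (S : RestrictedLie K π p) (x : S.part 0) : S.part 0 :=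
  ⟨x.1 ^ p, S.pow_mem x.1 x.2⟩

/-- Defining relations of `U(g)` inside the tensor algebra of `g`:
`x y = (-1)^{ij} y x + [x, y]` for `x` in `g_i` and `y` in `g_j`. -/
inductive EnvRel (S : RestrictedLie K π p) :
    TensorAlgebra K S.carrier → TensorAlgebra K S.carrier → Prop
  | comm (i j : ZMod 2) (x : S.part i) (y : S.part j) :
      EnvRel S
        (TensorAlgebra.ι K (S.incl i x) * TensorAlgebra.ι K (S.incl j y))
        (superSign K i j • (TensorAlgebra.ι K (S.incl j y) * TensorAlgebra.ι K (S.incl i x))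
          + TensorAlgebra.ι K (S.incl (i + j) (S.bracket i j x y)))

/-- The universal enveloping superalgebra `U(g)`. -/
def Env (S : RestrictedLie K π p) : Type _ := RingQuot (EnvRel S)

instance (S : RestrictedLie K π p) : Ring (Env S) := inferInstanceAs (Ring (RingQuot (EnvRel S)))

instance (S : RestrictedLie K π p) : Algebra K (Env S) :=
  inferInstanceAs (Algebra K (RingQuot (EnvRel S)))

/-- The canonical map `g → U(g)`. -/
def Env.gen (S : RestrictedLie K π p) : S.carrier →ₗ[K] Env S :=
  (RingQuot.mkAlgHom K (EnvRel S)).toLinearMap ∘ₗ TensorAlgebra.ι K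

/-- The relations `x^p - x^{[p]} = χ(x)^p`, for `x` in `g_0`, cutting out `U_χ(g)`. -/
inductive RedRel (S : RestrictedLie K π p) (χ : S.part 0 →ₗ[K] K) : Env S → Env S → Prop
  | pow (x : S.part 0) :
      RedRel S χ
        (Env.gen S (S.incl 0 x) ^ p - Env.gen S (S.incl 0 (S.pmap x)))
        (algebraMap K (Env S) (χ x ^ p))

/-- The reduced enveloping superalgebra `U_χ(g)` with `p`-character `χ`. -/
def RedEnv (S : RestrictedLie K π p) (χ : S.part 0 →ₗ[K] K) : Type _ := RingQuot (RedRel S χ)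

instance (S : RestrictedLie K π p) (χ : S.part 0 →ₗ[K] K) : Ring (RedEnv S χ) :=
  inferInstanceAs (Ring (RingQuot (RedRel S χ)))

instance (S : RestrictedLie K π p) (χ : S.part 0 →ₗ[K] K) : Algebra K (RedEnv S χ) :=
  inferInstanceAs (Algebra K (RingQuot (RedRel S χ)))

/-- The canonical map `g → U_χ(g)`. -/
def RedEnv.gen (S : RestrictedLie K π p) (χ : S.part 0 →ₗ[K] K) : S.carrier →ₗ[K] RedEnv S χ :=
  (RingQuot.mkAlgHom K (RedRel S χ)).toLinearMap ∘ₗ Env.gen S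

/-- The homogeneous component of parity `i` of `U_χ(g)`: the span of the products
`x_1 ⋯ x_k` of homogeneous elements of `g` with parities adding up to `i`. -/
def RedEnv.part (S : RestrictedLie K π p) (χ : S.part 0 →ₗ[K] K) (i : ZMod 2) :
    Submodule K (RedEnv S χ) :=
  Submodule.span K {u | ∃ L : List (Σ j : ZMod 2, S.part j),
    (L.map fun x => x.1).sum = i ∧
      u = (L.map fun x => RedEnv.gen S χ (S.incl x.1 x.2)).prod}

theorem RedEnv.gen_comm (S : RestrictedLie K π p) (χ : S.part 0 →ₗ[K] K) (i j : ZMod 2)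
    (x : S.part i) (y : S.part j) :
    RedEnv.gen S χ (S.incl i x) * RedEnv.gen S χ (S.incl j y) =
      superSign K i j • (RedEnv.gen S χ (S.incl j y) * RedEnv.gen S χ (S.incl i x))
        + RedEnv.gen S χ (S.incl (i + j) (S.bracket i j x y)) := by
  have h := congrArg (RingQuot.mkAlgHom K (RedRel S χ))
    (RingQuot.mkAlgHom_rel K (EnvRel.comm (S := S) i j x y))
  rw [map_mul, map_add, map_smul, map_mul] at h
  erw [map_mul, map_add, map_smul, map_mul] at h
  exact h

theorem RedEnv.gen_pow (S : RestrictedLie K π p) (χ : S.part 0 →ₗ[K] K) (x : S.part 0) :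
    RedEnv.gen S χ (S.incl 0 x) ^ p - RedEnv.gen S χ (S.incl 0 (S.pmap x)) =
      algebraMap K (RedEnv S χ) (χ x ^ p) := by
  have h := RingQuot.mkAlgHom_rel K (RedRel.pow (S := S) (χ := χ) x)
  rw [map_sub, map_pow, AlgHom.commutes] at h
  exact h

/-- Universal property of `U(g)`. -/
def Env.lift (S : RestrictedLie K π p) {A : Type*} [Ring A] [Algebra K A]
    (f : S.carrier →ₗ[K] A)
    (hf : ∀ i j x y, f (S.incl i x) * f (S.incl j y) =
      superSign K i j • (f (S.incl j y) * f (S.incl i x))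
        + f (S.incl (i + j) (S.bracket i j x y))) :
    Env S →ₐ[K] A :=
  RingQuot.liftAlgHom K ⟨TensorAlgebra.lift K f, by
    rintro _ _ ⟨i, j, x, y⟩
    simpa using hf i j x y⟩

theorem Env.lift_gen (S : RestrictedLie K π p) {A : Type*} [Ring A] [Algebra K A]
    (f : S.carrier →ₗ[K] A)
    (hf : ∀ i j x y, f (S.incl i x) * f (S.incl j y) =
      superSign K i j • (f (S.incl j y) * f (S.incl i x))
        + f (S.incl (i + j) (S.bracket i j x y))) (x : S.carrier) :
    Env.lift S f hf (Env.gen S x) = f x := by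
  have h := RingQuot.liftAlgHom_mkAlgHom_apply K (TensorAlgebra.lift K f)
    (s := EnvRel S) (by
      rintro _ _ ⟨i, j, x, y⟩
      simpa using hf i j x y) (TensorAlgebra.ι K x)
  rw [TensorAlgebra.lift_ι_apply] at h
  exact h

/-- Universal property of `U_χ(g)`. -/
def RedEnv.lift (S : RestrictedLie K π p) (χ : S.part 0 →ₗ[K] K)
    {A : Type*} [Ring A] [Algebra K A] (f : S.carrier →ₗ[K] A)
    (hf : ∀ i j x y, f (S.incl i x) * f (S.incl j y) =
      superSign K i j • (f (S.incl j y) * f (S.incl i x))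
        + f (S.incl (i + j) (S.bracket i j x y)))
    (hp : ∀ x, f (S.incl 0 x) ^ p - f (S.incl 0 (S.pmap x)) = algebraMap K A (χ x ^ p)) :
    RedEnv S χ →ₐ[K] A :=
  RingQuot.liftAlgHom K ⟨Env.lift S f hf, by
    rintro _ _ ⟨x⟩
    rw [map_sub, map_pow, Env.lift_gen, Env.lift_gen, AlgHom.commutes]
    exact hp x⟩

/-- The homomorphism `U_χ(s) → U_χ(t)` for an inclusion `s ⊆ t`, where `χ` on `s` is the
restriction of `χ` on `t`. -/
def RedEnv.map (S T : RestrictedLie K π p) (hST : ∀ i, S.part i ≤ T.part i)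
    (χ : T.part 0 →ₗ[K] K) :
    RedEnv S (χ ∘ₗ Submodule.inclusion (hST 0)) →ₐ[K] RedEnv T χ :=
  RedEnv.lift S _
    (RedEnv.gen T χ ∘ₗ Submodule.inclusion (sup_le_sup (hST 0) (hST 1)))
    (fun i j x y => RedEnv.gen_comm T χ i j ⟨x.1, hST i x.2⟩ ⟨y.1, hST j y.2⟩)
    (fun x => RedEnv.gen_pow T χ ⟨x.1, hST 0 x.2⟩)

end Enveloping

section Induced

variable {K : Type*} [Field K] {A B M : Type*} [Ring A] [Algebra K A] [Ring B] [Algebra K B]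
  [AddCommGroup M] [Module K M]

/-- The relations `a b ⊗ m = a ⊗ b m` in `A ⊗_K M`. -/
def balanced (f : B →ₐ[K] A) (ρ : B →ₐ[K] Module.End K M) : Submodule A (A ⊗[K] M) :=
  Submodule.span A {t | ∃ (a : A) (b : B) (m : M), t = (a * f b) ⊗ₜ[K] m - a ⊗ₜ[K] (ρ b m)}

/-- The induced module `A ⊗_B M`, for an algebra homomorphism `f : B → A` and a `B`-module `M`
given by `ρ : B → End_K M`. -/
abbrev Induced (f : B →ₐ[K] A) (ρ : B →ₐ[K] Module.End K M) : Type _ :=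
  (A ⊗[K] M) ⧸ balanced f ρ

/-- For graded `A = A_0 + A_1` and a purely even `M`, the component of parity `i` of `A ⊗_B M`,
spanned by the classes of `a ⊗ m` with `a` in `A_i`. -/
def inducedPart (f : B →ₐ[K] A) (ρ : B →ₐ[K] Module.End K M) (𝒜 : ZMod 2 → Submodule K A)
    (i : ZMod 2) : Submodule K (Induced f ρ) :=
  Submodule.span K {z | ∃ a ∈ 𝒜 i, ∃ m : M, z = (balanced f ρ).mkQ (a ⊗ₜ[K] m)}

end Induced

section Simple

variable {K A Z : Type*} [Field K] [Ring A] [AddCommGroup Z] [Module K Z] [Module A Z]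

/-- Submodules in the super sense: `N = (N ∩ Z_0) + (N ∩ Z_1)`. -/
def IsGradedSubmodule (𝒵 : ZMod 2 → Submodule K Z) (N : Submodule A Z) : Prop :=
  ∀ z ∈ N, ∃ z₀ ∈ 𝒵 0, ∃ z₁ ∈ 𝒵 1, z₀ ∈ N ∧ z₁ ∈ N ∧ z = z₀ + z₁

variable (A) in
/-- Simplicity in the super sense: `Z ≠ 0`, and `0` and `Z` are the only graded submodules. -/
def IsSimpleSuper (𝒵 : ZMod 2 → Submodule K Z) : Prop :=
  Nontrivial Z ∧ ∀ N : Submodule A Z, IsGradedSubmodule 𝒵 N → N = ⊥ ∨ N = ⊤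

end Simple

/-! ### The Lie superalgebra `osp(1|2n)` -/

/-- The basis `v; e_0, …, e_{n-1}; f_0, …, f_{n-1}` of the superspace of dimension `1|2n`. -/
abbrev Idx (n : ℕ) : Type := Unit ⊕ (Fin n ⊕ Fin n)

/-- `v` is even; the `e_i` and `f_i` are odd. -/
def parity (n : ℕ) : Idx n → ZMod 2 := Sum.elim (fun _ => 0) (fun _ => 1)

section OSp

variable (K : Type*) [Field K] (n : ℕ)

/-- Gram matrix of the form: `1` on the even part, the standard symplectic form on the odd part. -/
def gram : Matrix (Idx n) (Idx n) K := Matrix.fromBlocks 1 0 0 (Matrix.J (Fin n) K)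

variable {K n}

/-- The nondegenerate even supersymmetric form `φ` on the superspace of dimension `1|2n`. -/
def form (x y : Idx n → K) : K := x ⬝ᵥ (gram K n).mulVec y

variable (K n)

/-- `osp(1|2n)_i`: the `f` in `gl(1|2n)_i` with `φ(f x, y) = -(-1)^{i|x|} φ(x, f y)`. -/
def ospPart (i : ZMod 2) : Submodule K (Matrix (Idx n) (Idx n) K) where
  carrier := {f | f ∈ glPart K (parity n) i ∧
    ∀ (j : ZMod 2) (x y : Idx n → K), x ∈ vecPart K (parity n) j →
      form (f.mulVec x) y = -(superSign K i j * form x (f.mulVec y))}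
  zero_mem' := ⟨zero_mem _, by intros; simp [form]⟩
  add_mem' := by
    rintro f g ⟨hf, hf'⟩ ⟨hg, hg'⟩
    refine ⟨add_mem hf hg, fun j x y hx => ?_⟩
    have h1 := hf' j x y hx
    have h2 := hg' j x y hx
    simp only [form, Matrix.add_mulVec, add_dotProduct, Matrix.mulVec_add, dotProduct_add] at *
    rw [h1, h2]; ring
  smul_mem' := by
    rintro c f ⟨hf, hf'⟩
    refine ⟨Submodule.smul_mem _ _ hf, fun j x y hx => ?_⟩
    have h1 := hf' j x y hx
    simp only [form, Matrix.smul_mulVec, smul_dotProduct, Matrix.mulVec_smul, dotProduct_smul,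
      smul_eq_mul] at *
    rw [h1]; ring

variable {K n}

theorem glPart_mul {ι : Type*} [Fintype ι] {π : ι → ZMod 2} {i j : ZMod 2}
    {x y : Matrix ι ι K} (hx : x ∈ glPart K π i) (hy : y ∈ glPart K π j) :
    x * y ∈ glPart K π (i + j) := by
  intro a b h
  rw [Matrix.mul_apply] at h
  obtain ⟨c, -, hc⟩ := Finset.exists_ne_zero_of_sum_ne_zero h
  rw [hx a c (left_ne_zero_of_mul hc), hy c b (right_ne_zero_of_mul hc), add_assoc]

theorem mulVec_vecPart {ι : Type*} [Fintype ι] {π : ι → ZMod 2} {i j : ZMod 2}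
    {f : Matrix ι ι K} {x : ι → K} (hf : f ∈ glPart K π i) (hx : x ∈ vecPart K π j) :
    f.mulVec x ∈ vecPart K π (i + j) := by
  intro a h
  obtain ⟨c, -, hc⟩ := Finset.exists_ne_zero_of_sum_ne_zero h
  rw [hf a c (left_ne_zero_of_mul hc), hx c (right_ne_zero_of_mul hc)]

theorem superSign_add_mul (i j k : ZMod 2) :
    superSign K j k * superSign K i (j + k) =
      superSign K i j * (superSign K i k * superSign K j k) := by
  have h01 : (0 : ZMod 2) ≠ 1 := by decide
  have h11 : (1 + 1 : ZMod 2) = 0 := by decide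
  have h : ∀ i : ZMod 2, i = 0 ∨ i = 1 := by decide
  rcases h i with rfl | rfl <;> rcases h j with rfl | rfl <;> rcases h k with rfl | rfl <;>
    simp [superSign, h01, h11]

theorem superSign_mul_self (i j : ZMod 2) : superSign K i j * superSign K i j = 1 := by
  unfold superSign; split_ifs <;> simp

theorem superSign_comm (i j : ZMod 2) : superSign K i j = superSign K j i := by
  unfold superSign; simp [and_comm]

theorem superSign_add_left (i j k : ZMod 2) :
    superSign K (i + j) k = superSign K i k * superSign K j k := by
  have h01 : (0 : ZMod 2) ≠ 1 := by decide
  have h11 : (1 + 1 : ZMod 2) = 0 := by decide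
  have h : ∀ i : ZMod 2, i = 0 ∨ i = 1 := by decide
  rcases h i with rfl | rfl <;> rcases h j with rfl | rfl <;> rcases h k with rfl | rfl <;>
    simp [superSign, h01, h11]

theorem superBracket_mem_glPart {ι : Type*} [Fintype ι] {π : ι → ZMod 2} {i j : ZMod 2}
    {x y : Matrix ι ι K} (hx : x ∈ glPart K π i) (hy : y ∈ glPart K π j) :
    superBracket i j x y ∈ glPart K π (i + j) :=
  sub_mem (glPart_mul hx hy)
    (Submodule.smul_mem _ _ (by rw [add_comm i j]; exact glPart_mul hy hx))

theorem superBracket_mem_ospPart (i j : ZMod 2) (f g : Matrix (Idx n) (Idx n) K)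
    (hf : f ∈ ospPart K n i) (hg : g ∈ ospPart K n j) :
    superBracket i j f g ∈ ospPart K n (i + j) := by
  refine ⟨superBracket_mem_glPart hf.1 hg.1, fun k x y hx => ?_⟩
  have a1 := hf.2 _ (g.mulVec x) y (mulVec_vecPart hg.1 hx)
  have a2 := hg.2 k x (f.mulVec y) hx
  have b1 := hg.2 _ (f.mulVec x) y (mulVec_vecPart hf.1 hx)
  have b2 := hf.2 k x (g.mulVec y) hx
  have s1 := superSign_add_mul (K := K) i j k
  have s2 := superSign_add_mul (K := K) j i k
  have s3 := superSign_mul_self (K := K) i j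
  have s4 := superSign_comm (K := K) i j
  have s5 := superSign_add_left (K := K) i j k
  simp only [superBracket, form, Matrix.sub_mulVec, Matrix.smul_mulVec, sub_dotProduct,
    smul_dotProduct, Matrix.mulVec_sub, Matrix.mulVec_smul, dotProduct_sub, dotProduct_smul,
    smul_eq_mul, ← Matrix.mulVec_mulVec] at *
  rw [a1, a2, b1, b2, s5]
  rw [← s4] at s2
  linear_combination (x ⬝ᵥ (gram K n).mulVec (g.mulVec (f.mulVec y))) * s1
    - superSign K i j * (x ⬝ᵥ (gram K n).mulVec (f.mulVec (g.mulVec y))) * s2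
    - (superSign K i k * superSign K j k) *
      (x ⬝ᵥ (gram K n).mulVec (f.mulVec (g.mulVec y))) * s3

theorem pow_mem_glPart_zero {ι : Type*} [Fintype ι] [DecidableEq ι] {π : ι → ZMod 2}
    {f : Matrix ι ι K} (hf : f ∈ glPart K π 0) (m : ℕ) : f ^ m ∈ glPart K π 0 := by
  induction m with
  | zero =>
    intro a b h
    rw [zero_add]
    by_contra hab
    have hne : a ≠ b := fun h' => hab (by rw [h'])
    exact h (by simp [hne])
  | succ m ih => rw [pow_succ]; simpa using glPart_mul ih hf

theorem pow_mem_ospPart (p : ℕ) [Fact p.Prime] [CharP K p] (f : Matrix (Idx n) (Idx n) K)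
    (hf : f ∈ ospPart K n 0) : f ^ p ∈ ospPart K n 0 := by
  have key : ∀ (m : ℕ) (j : ZMod 2) (x y : Idx n → K), x ∈ vecPart K (parity n) j →
      form ((f ^ m).mulVec x) y = (-1) ^ m * form x ((f ^ m).mulVec y) := by
    intro m
    induction m with
    | zero => intros; simp
    | succ m ih =>
      intro j x y hx
      have h1 := hf.2 j x ((f ^ m).mulVec y) hx
      have h2 := ih _ (f.mulVec x) y (mulVec_vecPart hf.1 hx)
      rw [pow_succ f m, ← Matrix.mulVec_mulVec, h2, h1, ← pow_succ f m, pow_succ' f m,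
        ← Matrix.mulVec_mulVec]
      simp [superSign, pow_succ]
  refine ⟨pow_mem_glPart_zero hf.1 p, fun j x y hx => ?_⟩
  rw [key p j x y hx, neg_one_pow_char K p]
  simp [superSign]

variable (K n)

/-- The restricted Lie superalgebra `osp(1|2n)`. -/
def osp (p : ℕ) [Fact p.Prime] [CharP K p] : RestrictedLie K (parity n) p where
  part := ospPart K n
  part_le _ _ h := h.1
  bracket_mem := superBracket_mem_ospPart
  pow_mem := pow_mem_ospPart p

variable {K n}

/-- The supertrace. -/
def supertrace (x : Matrix (Idx n) (Idx n) K) : K := ∑ a, (if parity n a = 0 then 1 else -1) * x a a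

/-- A functional `χ` on `osp(1|2n)_0` is regular nilpotent if it corresponds, under the invariant
form `(x, y) = str(xy)`, to a nilpotent element `X` of `osp(1|2n)_0 = sp(2n)` that is regular,
that is, its centralizer in `sp(2n)` has dimension equal to the rank `n`. -/
def IsRegularNilpotent (χ : ospPart K n 0 →ₗ[K] K) : Prop :=
  ∃ X ∈ ospPart K n 0, IsNilpotent X ∧
    Module.finrank K
      ↥(ospPart K n 0 ⊓ Subalgebra.toSubmodule (Subalgebra.centralizer K {X})) = n ∧
    ∀ y : ospPart K n 0, χ y = supertrace (X * y.1)

/-! ### Triangular decompositions and baby Verma modules -/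

/-- The order of the basis is `e_0 > ⋯ > e_{n-1} > v > f_{n-1} > ⋯ > f_0`. -/
def wt (n : ℕ) : Idx n → ℤ
  | .inl _ => 0
  | .inr (.inl i) => n - i
  | .inr (.inr i) => -(n - i)

theorem wt_injective (n : ℕ) : Function.Injective (wt n) := by
  rintro (a | a | a) (b | b | b) h <;> simp only [wt] at h
  · rfl
  · have := b.2; omega
  · have := b.2; omega
  · have := a.2; omega
  · have : a = b := by ext; omega
    rw [this]
  · have := a.2; have := b.2; omega
  · have := a.2; omega
  · have := a.2; have := b.2; omega
  · have : a = b := by ext; omega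
    rw [this]

variable (K n)

/-- Matrices that are upper triangular for the order of the basis. -/
def upper : Submodule K (Matrix (Idx n) (Idx n) K) where
  carrier := {x | ∀ a b, x a b ≠ 0 → wt n b ≤ wt n a}
  zero_mem' := by intro a b h; simp at h
  add_mem' := by
    intro x y hx hy a b h
    by_cases h1 : x a b = 0
    · exact hy a b (by simpa [h1] using h)
    · exact hx a b h1
  smul_mem' := by
    intro c x hx a b h
    exact hx a b (by intro h0; simp [h0] at h)

/-- Matrices that are strictly upper triangular for the order of the basis. -/
def strictUpper : Submodule K (Matrix (Idx n) (Idx n) K) where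
  carrier := {x | ∀ a b, x a b ≠ 0 → wt n b < wt n a}
  zero_mem' := by intro a b h; simp at h
  add_mem' := by
    intro x y hx hy a b h
    by_cases h1 : x a b = 0
    · exact hy a b (by simpa [h1] using h)
    · exact hx a b h1
  smul_mem' := by
    intro c x hx a b h
    exact hx a b (by intro h0; simp [h0] at h)

/-- Diagonal matrices. -/
def diagonals : Submodule K (Matrix (Idx n) (Idx n) K) :=
  LinearMap.range (Matrix.diagonalLinearMap (Idx n) K K)

variable {K n}

theorem upper_mul {x y : Matrix (Idx n) (Idx n) K} (hx : x ∈ upper K n) (hy : y ∈ upper K n) :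
    x * y ∈ upper K n := by
  intro a b h
  rw [Matrix.mul_apply] at h
  obtain ⟨c, -, hc⟩ := Finset.exists_ne_zero_of_sum_ne_zero h
  exact (hy c b (right_ne_zero_of_mul hc)).trans (hx a c (left_ne_zero_of_mul hc))

theorem upper_one : (1 : Matrix (Idx n) (Idx n) K) ∈ upper K n := by
  intro a b h
  have : a = b := by by_contra hne; exact h (by simp [hne])
  rw [this]

theorem upper_pow {x : Matrix (Idx n) (Idx n) K} (hx : x ∈ upper K n) (m : ℕ) :
    x ^ m ∈ upper K n := by
  induction m with
  | zero => exact upper_one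
  | succ m ih => rw [pow_succ]; exact upper_mul ih hx

theorem diag_mul_of_upper {x y : Matrix (Idx n) (Idx n) K} (hx : x ∈ upper K n)
    (hy : y ∈ upper K n) (a : Idx n) : (x * y) a a = x a a * y a a := by
  rw [Matrix.mul_apply]
  refine Finset.sum_eq_single a (fun c _ hc => ?_) (by simp)
  by_contra h
  exact hc (wt_injective n (le_antisymm (hx a c (left_ne_zero_of_mul h))
    (hy c a (right_ne_zero_of_mul h))))

theorem diag_pow_of_upper {x : Matrix (Idx n) (Idx n) K} (hx : x ∈ upper K n) (m : ℕ)
    (a : Idx n) : (x ^ m) a a = x a a ^ m := by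
  induction m with
  | zero => simp
  | succ m ih => rw [pow_succ, diag_mul_of_upper (upper_pow hx m) hx, ih, pow_succ]

theorem mem_diagonals {x : Matrix (Idx n) (Idx n) K} :
    x ∈ diagonals K n ↔ Matrix.diagonal x.diag = x := by
  constructor
  · rintro ⟨d, rfl⟩; simp
  · intro h; exact ⟨x.diag, h⟩

/-- The even transformation of the superspace that is `1` on `v` and `P` in `Sp(2n)` on the odd
part. -/
def block (P : Matrix.symplecticGroup (Fin n) K) : Matrix (Idx n) (Idx n) K :=
  Matrix.fromBlocks 1 0 0 (P : Matrix (Fin n ⊕ Fin n) (Fin n ⊕ Fin n) K)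

theorem block_mul (P Q : Matrix.symplecticGroup (Fin n) K) :
    block P * block Q = block (P * Q) := by
  simp [block, Matrix.fromBlocks_multiply]

theorem block_one : block (1 : Matrix.symplecticGroup (Fin n) K) = 1 := by
  simp [block]

/-- `x ↦ P⁻¹ x P`: the matrix of the transformation `x` in the symplectic basis formed by the
columns of `P`. -/
def conj (P : Matrix.symplecticGroup (Fin n) K) :
    Matrix (Idx n) (Idx n) K →ₐ[K] Matrix (Idx n) (Idx n) K :=
  AlgHom.ofLinearMap
    (LinearMap.mulRight K (block P) ∘ₗ LinearMap.mulLeft K (block P⁻¹))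
    (by simp [block_mul, block_one])
    (by
      intro x y
      have h : block P * block P⁻¹ = 1 := by rw [block_mul, mul_inv_cancel, block_one]
      simp only [LinearMap.comp_apply, LinearMap.mulLeft_apply, LinearMap.mulRight_apply]
      calc block P⁻¹ * (x * y) * block P = block P⁻¹ * x * 1 * y * block P := by
            simp only [mul_one, mul_assoc]
        _ = _ := by rw [← h]; simp only [mul_assoc])

theorem conj_apply (P : Matrix.symplecticGroup (Fin n) K) (x : Matrix (Idx n) (Idx n) K) :
    conj P x = block P⁻¹ * x * block P := rfl

theorem conj_conj_inv (P : Matrix.symplecticGroup (Fin n) K) (x : Matrix (Idx n) (Idx n) K) :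
    conj P (conj P⁻¹ x) = x := by
  have h : block P⁻¹ * block P = 1 := by rw [block_mul, inv_mul_cancel, block_one]
  simp only [conj_apply, inv_inv]
  calc _ = (block P⁻¹ * block P) * x * (block P⁻¹ * block P) := by simp only [mul_assoc]
    _ = x := by rw [h, one_mul, mul_one]

theorem conj_inv_conj (P : Matrix.symplecticGroup (Fin n) K) (x : Matrix (Idx n) (Idx n) K) :
    conj P⁻¹ (conj P x) = x := by
  simpa using conj_conj_inv P⁻¹ x

theorem block_mem_glPart (P : Matrix.symplecticGroup (Fin n) K) :
    block P ∈ glPart K (parity n) 0 := by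
  rintro (a | a) (b | b) h <;> simp [block] at h <;> simp [parity]

theorem form_block (P : Matrix.symplecticGroup (Fin n) K) (x y : Idx n → K) :
    form ((block P).mulVec x) y = form x ((block P⁻¹).mulVec y) := by
  have h : (block P).transpose * gram K n = gram K n * block P⁻¹ := by
    have h0 : (block P).transpose * gram K n * block P = gram K n := by
      have := SymplecticGroup.mem_iff'.1 P.2
      simp [block, gram, Matrix.fromBlocks_transpose, Matrix.fromBlocks_multiply, this]
    have h1 : block P * block P⁻¹ = 1 := by rw [block_mul, mul_inv_cancel, block_one]
    calc (block P).transpose * gram K n = (block P).transpose * gram K n * (block P * block P⁻¹) := by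
          rw [h1, mul_one]
      _ = (block P).transpose * gram K n * block P * block P⁻¹ := by rw [mul_assoc _ (block P)]
      _ = _ := by rw [h0]
  unfold form
  rw [Matrix.mulVec_mulVec, ← h, ← Matrix.mulVec_mulVec, Matrix.dotProduct_mulVec x,
    Matrix.vecMul_transpose]

theorem conj_mem_ospPart (P : Matrix.symplecticGroup (Fin n) K) {i : ZMod 2}
    {x : Matrix (Idx n) (Idx n) K} (hx : x ∈ ospPart K n i) : conj P x ∈ ospPart K n i := by
  refine ⟨?_, fun j u w hu => ?_⟩
  · have := glPart_mul (glPart_mul (block_mem_glPart P⁻¹) hx.1) (block_mem_glPart P)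
    simpa [conj_apply] using this
  · have hu' := mulVec_vecPart (block_mem_glPart P) hu
    rw [zero_add] at hu'
    simp only [conj_apply, ← Matrix.mulVec_mulVec]
    rw [form_block, inv_inv, hx.2 j _ _ hu', form_block]

theorem diag_eq_zero_of_odd {x : Matrix (Idx n) (Idx n) K} (hx : x ∈ glPart K (parity n) 1)
    (a : Idx n) : x a a = 0 := by
  by_contra h
  have := hx a a h
  simp at this

theorem gram_left {a b c : Idx n} (hc : gram K n c b ≠ 0) (ha : gram K n a b ≠ 0) : c = a := by
  rcases a with a | a | a <;> rcases b with b | b | b <;> rcases c with c | c | c <;>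
    simp_all [gram, Matrix.J, Matrix.one_apply]

theorem gram_right {a b c : Idx n} (hc : gram K n a c ≠ 0) (hb : gram K n a b ≠ 0) : c = b := by
  rcases a with a | a | a <;> rcases b with b | b | b <;> rcases c with c | c | c <;>
    simp_all [gram, Matrix.J, Matrix.one_apply]

theorem diagonal_mem_ospPart {x : Matrix (Idx n) (Idx n) K} (hx : x ∈ ospPart K n 0) :
    Matrix.diagonal x.diag ∈ ospPart K n 0 := by
  have hent : ∀ a b, gram K n a b ≠ 0 → x a a = - x b b := by
    intro a b hab
    have hs : (Pi.single a 1 : Idx n → K) ∈ vecPart K (parity n) (parity n a) := by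
      intro c hc
      have : c = a := by by_contra h; exact hc (by simp [h])
      rw [this]
    have h := hx.2 _ _ (Pi.single b 1) hs
    simp only [form, Matrix.mulVec_single_one, single_one_dotProduct] at h
    have e1 : x.col a ⬝ᵥ (gram K n).col b = x a a * gram K n a b := by
      refine Finset.sum_eq_single a (fun c _ hc => ?_) (by simp)
      by_contra h0
      exact hc (gram_left (right_ne_zero_of_mul h0) hab)
    have e2 : (gram K n).mulVec (x.col b) a = gram K n a b * x b b := by
      change ∑ c, gram K n a c * x c b = gram K n a b * x b b
      refine Finset.sum_eq_single b (fun c _ hc => ?_) (by simp)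
      by_contra h0
      exact hc (gram_right (left_ne_zero_of_mul h0) hab)
    rw [e1, e2] at h
    have : superSign K 0 (parity n a) = 1 := by simp [superSign]
    rw [this] at h
    exact mul_right_cancel₀ hab (by linear_combination h)
  refine ⟨?_, fun j u w hu => ?_⟩
  · intro a b h
    have : a = b := by by_contra hne; exact h (by simp [hne])
    simp [this]
  · have hs : superSign K 0 j = 1 := by simp [superSign]
    rw [hs, one_mul]
    simp only [form, dotProduct, Matrix.mulVec, Matrix.diagonal_apply, ite_mul, zero_mul,
      Finset.sum_ite_eq, Finset.mem_univ, if_true, Matrix.diag_apply, Finset.mul_sum,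
      ← Finset.sum_neg_distrib]
    refine Finset.sum_congr rfl fun a _ => Finset.sum_congr rfl fun b _ => ?_
    by_cases hab : gram K n a b = 0
    · simp [hab]
    · rw [hent a b hab]; ring

variable (K n)

section Triangular

variable (p : ℕ) [Fact p.Prime] [CharP K p]

variable {K n}

/-- The Borel subalgebra `b = h ⊕ n⁺` attached to the symplectic basis formed by the columns of
`P`: the elements of `osp(1|2n)` with upper triangular matrix. -/
def borel (P : Matrix.symplecticGroup (Fin n) K) : RestrictedLie K (parity n) p where
  part i := ospPart K n i ⊓ (upper K n).comap (conj P).toLinearMap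
  part_le _ _ h := h.1.1
  bracket_mem i j x y hx hy := by
    refine ⟨superBracket_mem_ospPart i j x y hx.1 hy.1, ?_⟩
    have h1 : conj P x ∈ upper K n := hx.2
    have h2 : conj P y ∈ upper K n := hy.2
    change conj P (x * y - superSign K i j • (y * x)) ∈ upper K n
    rw [map_sub, map_smul, map_mul, map_mul]
    exact sub_mem (upper_mul h1 h2) (Submodule.smul_mem _ _ (upper_mul h2 h1))
  pow_mem x hx := by
    refine ⟨pow_mem_ospPart p x hx.1, ?_⟩
    change conj P (x ^ p) ∈ upper K n
    rw [map_pow]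
    exact upper_pow hx.2 p

/-- The Cartan subalgebra `h` (it is purely even): the elements of `osp(1|2n)` with diagonal
matrix in the symplectic basis formed by the columns of `P`. -/
def cartan (P : Matrix.symplecticGroup (Fin n) K) : RestrictedLie K (parity n) p where
  part i := ospPart K n i ⊓ (diagonals K n).comap (conj P).toLinearMap
  part_le _ _ h := h.1.1
  bracket_mem i j x y hx hy := by
    refine ⟨superBracket_mem_ospPart i j x y hx.1 hy.1, ?_⟩
    obtain ⟨d, hd⟩ : conj P x ∈ diagonals K n := hx.2
    obtain ⟨e, he⟩ : conj P y ∈ diagonals K n := hy.2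
    change conj P (x * y - superSign K i j • (y * x)) ∈ diagonals K n
    rw [map_sub, map_smul, map_mul, map_mul, ← hd, ← he]
    refine sub_mem ⟨d * e, ?_⟩ (Submodule.smul_mem _ _ ⟨e * d, ?_⟩) <;>
      simp [Matrix.diagonal_mul_diagonal]
  pow_mem x hx := by
    refine ⟨pow_mem_ospPart p x hx.1, ?_⟩
    obtain ⟨d, hd⟩ : conj P x ∈ diagonals K n := hx.2
    change conj P (x ^ p) ∈ diagonals K n
    rw [map_pow, ← hd]
    exact ⟨d ^ p, by simp [Matrix.diagonal_pow]⟩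

/-- The components of the nilradical `n⁺`: the elements of `osp(1|2n)` with strictly upper
triangular matrix in the symplectic basis formed by the columns of `P`. -/
def nilPart (P : Matrix.symplecticGroup (Fin n) K) (i : ZMod 2) :
    Submodule K (Matrix (Idx n) (Idx n) K) :=
  ospPart K n i ⊓ (strictUpper K n).comap (conj P).toLinearMap

/-- The projection `x ↦ diag(x)`, written in the symplectic basis formed by the columns of `P`. -/
def diagProj (P : Matrix.symplecticGroup (Fin n) K) :
    Matrix (Idx n) (Idx n) K →ₗ[K] Matrix (Idx n) (Idx n) K :=
  (conj P⁻¹).toLinearMap ∘ₗ Matrix.diagonalLinearMap (Idx n) K K ∘ₗ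
    Matrix.diagLinearMap (Idx n) K K ∘ₗ (conj P).toLinearMap

theorem diagProj_apply (P : Matrix.symplecticGroup (Fin n) K) (x : Matrix (Idx n) (Idx n) K) :
    diagProj P x = conj P⁻¹ (Matrix.diagonal (conj P x).diag) := rfl

theorem diagProj_odd (P : Matrix.symplecticGroup (Fin n) K) {x : Matrix (Idx n) (Idx n) K}
    (hx : x ∈ ospPart K n 1) : diagProj P x = 0 := by
  have h : (conj P x).diag = 0 := by
    ext a
    exact diag_eq_zero_of_odd (conj_mem_ospPart P hx).1 a
  rw [diagProj_apply, h]
  simp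

theorem diagProj_mem (P : Matrix.symplecticGroup (Fin n) K) {x : Matrix (Idx n) (Idx n) K}
    (hx : x ∈ ospPart K n 0) : diagProj P x ∈ (cartan p P).part 0 := by
  have h := conj_mem_ospPart P⁻¹ (diagonal_mem_ospPart (conj_mem_ospPart P hx))
  refine ⟨h, ?_⟩
  change conj P (diagProj P x) ∈ diagonals K n
  rw [diagProj_apply, conj_conj_inv]
  exact ⟨_, rfl⟩

/-- `b = h + n⁺` in each parity. -/
theorem borel_part_eq (P : Matrix.symplecticGroup (Fin n) K) (i : ZMod 2) :
    (borel p P).part i = (cartan p P).part i ⊔ nilPart P i := by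
  have hd : ∀ x ∈ ospPart K n i, diagProj P x ∈ (cartan p P).part i := by
    intro x hx
    fin_cases i
    · exact diagProj_mem p P hx
    · have := diagProj_odd P hx
      rw [this]; exact zero_mem _
  apply le_antisymm
  · rintro x ⟨hx, hxu⟩
    replace hxu : conj P x ∈ upper K n := hxu
    refine Submodule.mem_sup.2 ⟨diagProj P x, hd x hx, x - diagProj P x, ⟨?_, ?_⟩, by simp⟩
    · exact sub_mem hx (hd x hx).1
    · change conj P (x - diagProj P x) ∈ strictUpper K n
      rw [map_sub, diagProj_apply, conj_conj_inv]
      intro a b hab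
      have hne : a ≠ b := by rintro rfl; simp at hab
      have h1 : conj P x a b ≠ 0 := by simpa [hne] using hab
      exact lt_of_le_of_ne (hxu a b h1) fun h => hne (wt_injective n h).symm
  · refine sup_le (fun x hx => ⟨hx.1, ?_⟩) (fun x hx => ⟨hx.1, ?_⟩)
    · obtain ⟨d, hd⟩ : conj P x ∈ diagonals K n := hx.2
      change conj P x ∈ upper K n
      rw [← hd]
      intro a b hab
      have : a = b := by by_contra hne; exact hab (by simp [hne])
      rw [this]
    · exact fun a b hab => le_of_lt (hx.2 a b hab)

/-- The projection `b → h` with kernel `n⁺`. -/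
def toCartan (P : Matrix.symplecticGroup (Fin n) K) :
    (borel p P).carrier →ₗ[K] (cartan p P).part 0 :=
  (diagProj P ∘ₗ (borel p P).carrier.subtype).codRestrict _ (by
    rintro ⟨x, hx⟩
    have : (borel p P).carrier ≤ ((cartan p P).part 0).comap (diagProj P) := by
      refine sup_le (fun y hy => diagProj_mem p P hy.1) (fun y hy => ?_)
      rw [Submodule.mem_comap, diagProj_odd P hy.1]
      exact zero_mem _
    exact this hx)

theorem borel_le_osp (P : Matrix.symplecticGroup (Fin n) K) (i : ZMod 2) :
    (borel p P).part i ≤ (osp K n p).part i := fun _ h => h.1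

theorem cartan_le_osp (P : Matrix.symplecticGroup (Fin n) K) (i : ZMod 2) :
    (cartan p P).part i ≤ (osp K n p).part i := fun _ h => h.1

/-- `Λ_χ`: the weights `λ` of `h` with `λ(h)^p - λ(h^{[p]}) = χ(h)^p` for all `h`. -/
def weights (P : Matrix.symplecticGroup (Fin n) K) (χ : (osp K n p).part 0 →ₗ[K] K) :
    Set ((cartan p P).part 0 →ₗ[K] K) :=
  {l | ∀ h : (cartan p P).part 0,
    l h ^ p - l ((cartan p P).pmap h) = χ (Submodule.inclusion (cartan_le_osp p P 0) h) ^ p}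

theorem toCartan_bracket (P : Matrix.symplecticGroup (Fin n) K) (i j : ZMod 2)
    (x : (borel p P).part i) (y : (borel p P).part j) :
    toCartan p P ((borel p P).incl (i + j) ((borel p P).bracket i j x y)) = 0 := by
  apply Subtype.ext
  change diagProj P (superBracket i j x.1 y.1) = 0
  have hx : conj P x.1 ∈ upper K n := x.2.2
  have hy : conj P y.1 ∈ upper K n := y.2.2
  have h : (conj P (superBracket i j x.1 y.1)).diag = 0 := by
    ext a
    simp only [superBracket, map_sub, map_smul, map_mul, Matrix.diag_apply, Matrix.sub_apply,
      Matrix.smul_apply, smul_eq_mul, Pi.zero_apply]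
    rw [diag_mul_of_upper hx hy, diag_mul_of_upper hy hx]
    by_cases hij : i = 1 ∧ j = 1
    · obtain ⟨rfl, rfl⟩ := hij
      rw [diag_eq_zero_of_odd (conj_mem_ospPart P x.2.1).1 a]
      simp
    · simp [superSign, hij, mul_comm]
  rw [diagProj_apply, h]
  simp

theorem toCartan_pmap (P : Matrix.symplecticGroup (Fin n) K) (x : (borel p P).part 0) :
    toCartan p P ((borel p P).incl 0 ((borel p P).pmap x)) =
      (cartan p P).pmap (toCartan p P ((borel p P).incl 0 x)) := by
  apply Subtype.ext
  change diagProj P (x.1 ^ p) = (diagProj P x.1) ^ p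
  have hx : conj P x.1 ∈ upper K n := x.2.2
  rw [diagProj_apply, diagProj_apply, ← map_pow, Matrix.diagonal_pow, map_pow]
  congr 2
  ext a
  simp [diag_pow_of_upper hx]

theorem toCartan_odd (P : Matrix.symplecticGroup (Fin n) K) (x : (borel p P).part 1) :
    toCartan p P ((borel p P).incl 1 x) = 0 :=
  Subtype.ext (diagProj_odd P x.2.1)

theorem sub_diagProj_mem_nilPart (P : Matrix.symplecticGroup (Fin n) K)
    (x : (borel p P).part 0) : x.1 - diagProj P x.1 ∈ nilPart P 0 := by
  obtain ⟨y, hy, z, hz, h⟩ := Submodule.mem_sup.1 ((borel_part_eq p P 0).le x.2)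
  have hy' : diagProj P y = y := by
    have h1 : conj P y ∈ diagonals K n := hy.2
    rw [diagProj_apply, mem_diagonals.1 h1, conj_inv_conj]
  have hz' : diagProj P z = 0 := by
    have h1 : conj P z ∈ strictUpper K n := hz.2
    have h2 : (conj P z).diag = 0 := by
      ext a
      by_contra h3
      exact lt_irrefl _ (h1 a a h3)
    rw [diagProj_apply, h2]
    simp
  rw [← h, map_add, hy', hz']
  simpa using hz

/-- The one-dimensional `U_χ(b)`-module `K_λ`, as a character: `h` acts through `λ` in `Λ_χ` and
`n⁺` acts by zero. Here `χ` vanishes on the even part of `n⁺`. -/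
def charHom (P : Matrix.symplecticGroup (Fin n) K) (χ : (osp K n p).part 0 →ₗ[K] K)
    (hχ : ∀ x : (osp K n p).part 0, x.1 ∈ nilPart P 0 → χ x = 0)
    (l : (cartan p P).part 0 →ₗ[K] K) (hl : l ∈ weights p P χ) :
    RedEnv (borel p P) (χ ∘ₗ Submodule.inclusion (borel_le_osp p P 0)) →ₐ[K] K :=
  RedEnv.lift (borel p P) _ (l ∘ₗ toCartan p P)
    (by
      intro i j x y
      simp only [LinearMap.comp_apply, toCartan_bracket, map_zero, add_zero, smul_eq_mul]
      by_cases hij : i = 1 ∧ j = 1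
      · obtain ⟨rfl, rfl⟩ := hij
        rw [toCartan_odd]
        simp
      · simp [superSign, hij, mul_comm])
    (by
      intro x
      simp only [LinearMap.comp_apply, toCartan_pmap]
      rw [hl (toCartan p P ((borel p P).incl 0 x))]
      have h := hχ (Submodule.inclusion (borel_le_osp p P 0) x -
        Submodule.inclusion (cartan_le_osp p P 0) (toCartan p P ((borel p P).incl 0 x)))
        (sub_diagProj_mem_nilPart p P x)
      rw [map_sub, sub_eq_zero] at h
      rw [h]
      rfl)

/-- The module structure map `U_χ(b) → End(K_λ)`. -/
def charRep (P : Matrix.symplecticGroup (Fin n) K) (χ : (osp K n p).part 0 →ₗ[K] K)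
    (hχ : ∀ x : (osp K n p).part 0, x.1 ∈ nilPart P 0 → χ x = 0)
    (l : (cartan p P).part 0 →ₗ[K] K) (hl : l ∈ weights p P χ) :
    RedEnv (borel p P) (χ ∘ₗ Submodule.inclusion (borel_le_osp p P 0)) →ₐ[K] Module.End K K :=
  (Algebra.lmul K K).comp (charHom p P χ hχ l hl)

/-- The baby Verma module `Z_χ(λ) = U_χ(g) ⊗_{U_χ(b)} K_λ` of `g = osp(1|2n)`. -/
abbrev BabyVerma (P : Matrix.symplecticGroup (Fin n) K) (χ : (osp K n p).part 0 →ₗ[K] K)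
    (hχ : ∀ x : (osp K n p).part 0, x.1 ∈ nilPart P 0 → χ x = 0)
    (l : (cartan p P).part 0 →ₗ[K] K) (hl : l ∈ weights p P χ) : Type _ :=
  Induced (RedEnv.map (borel p P) (osp K n p) (borel_le_osp p P) χ) (charRep p P χ hχ l hl)

/-- The `ZMod 2`-grading of the baby Verma module. -/
def babyVermaPart (P : Matrix.symplecticGroup (Fin n) K) (χ : (osp K n p).part 0 →ₗ[K] K)
    (hχ : ∀ x : (osp K n p).part 0, x.1 ∈ nilPart P 0 → χ x = 0)
    (l : (cartan p P).part 0 →ₗ[K] K) (hl : l ∈ weights p P χ) (i : ZMod 2) :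
    Submodule K (BabyVerma p P χ hχ l hl) :=
  inducedPart (RedEnv.map (borel p P) (osp K n p) (borel_le_osp p P) χ) (charRep p P χ hχ l hl)
    (RedEnv.part (osp K n p) χ) i

end Triangular

end OSp

end SuperLie

/-!
Simplicity of `Z = Z_χ(λ)` for regular nilpotent `χ` is a count of dimensions. Put
`d = p ^ (n ^ 2) * 2 ^ n`, the dimension of `U_χ(n⁻)`.

*Paraboson operators.* `osp(1|2n)` is generated by its odd part, a symplectic space `W`, and a
representation of `U_χ(osp(1|2n))` is the same thing as a linear map `a` from `W` to endomorphisms with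
`[{a w, a w'}, a z] = ω(z, w') a w + ω(z, w) a w'` and `(2 (a w)²) ^ p = χ({w, w}) ^ p`. This is
`IsParaHom`; the equivalence is `isParaHom_oddGen` with `IsParaHom.exists_algHom`. Since an arbitrary
even element is a sum of squares of odd ones, the relation for its `p`-th power needs Jacobson's formula
(`add_pow_prime_eq_jacobson`).

*Upper bound.* Ordered monomials in `n⁻` applied to the generator span `Z`, so `dim Z ≤ d`
(`finrank_babyVerma_le`).

*Lower bound.* Every nonzero `M` with `p`-character `χ` and a parity operator has `dim M ≥ d`
(`bvDim_le_finrank`). In a suitable symplectic basis, `χ` is nonzero on all simple root vectors of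
`n⁻_0` and zero on all other root vectors of `n⁻_0` (`exists_regular_basis`). By Engel's theorem some nonzero
vectors of `M` (Whittaker vectors) are killed by `y - χ(y)` for all root vectors `y` in `n⁻_0`, and by all
odd root vectors of `n⁻` but the simple one, whose square is a nonzero scalar on them
(`exists_whittaker_vectors`). Filter `M` by the degree in which words in these shifted operators
annihilate a vector. The operators lower the filtration and suitable dual elements of `osp(1|2n)` raise
it; since `χ` does not vanish on simple root vectors, on the associated graded space they satisfy the
relations of a Weyl–Clifford algebra, up to a triangular change. Hence monomials in the raising operators,
with exponents below `p` or `2`, applied to independent Whittaker vectors are linearly independent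
(`card_mul_prod_le_finrank`). This gives `p ^ (n ^ 2) * 2 ^ (n - 1)`, and the last factor `2` comes from
the odd simple root vector, which maps a homogeneous Whittaker vector to one of the opposite parity.
A nonzero graded submodule of `Z` therefore has dimension at least `d`, so it is `Z`.

*Nonvanishing.* Without the Poincaré–Birkhoff–Witt theorem, `Z ≠ 0` is shown by a nonzero map from `Z` to a
representation with a highest weight vector of weight `λ` (`vermaVec_ne_zero`), so it is enough to find
one. Oscillator
representations on functions on a discrete torus, twisted by scalars, realize the `p`-characters
`x ↦ ω(u, x u)`; these span the dual of `osp(1|2n)_0`, and tensor products add characters, so each `χ`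
has a nonzero representation (`exists_isParaHom`). Engel's theorem for `n⁺` supplies a highest weight
vector in it. Two admissible weights differ by a weight with values in the prime field, which is a sum of
fundamental weights; these occur in the supersymmetric algebra of the natural representation, with
`p`-character `0` (`hasHW_zero_of_pow_eq`).
-/

namespace SuperLie

/-! ### Filtrations and linear independence -/

section Filtration

variable {K : Type*} [Field K] {V : Type*} [AddCommGroup V] [Module K V]

/-- A family of vectors `r α` with degrees `e α` is graded independent for a filtration `G` if a
combination of members of the same degree `D` lies in `G (D - 1)` only when all its coefficients
vanish. When `r α ∈ G (e α)`, this is linear independence of the classes of the `r α` in the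
associated graded space of `G`. -/
def GradedIndep (G : ℤ → Submodule K V) {A : Type*} [Fintype A] (r : A → V) (e : A → ℤ) : Prop :=
  ∀ (D : ℤ) (c : A → K), (∀ α, c α ≠ 0 → e α = D) → ∑ α, c α • r α ∈ G (D - 1) → c = 0

theorem GradedIndep.linearIndependent {G : ℤ → Submodule K V} (hG : Monotone G) {A : Type*}
    [Fintype A] {r : A → V} {e : A → ℤ} (hr : ∀ α, r α ∈ G (e α)) (h : GradedIndep G r e) :
    LinearIndependent K r := by
  classical
  rw [Fintype.linearIndependent_iff]
  intro c hc
  by_contra hne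
  push Not at hne
  obtain ⟨α₀, hα₀⟩ := hne
  -- the component of top degree of a relation is a relation in the associated graded space
  obtain ⟨β, hβ, hmax⟩ := (Finset.univ.filter fun α => c α ≠ 0).exists_max_image e
    ⟨α₀, by simpa using hα₀⟩
  simp only [Finset.mem_filter, Finset.mem_univ, true_and] at hβ hmax
  have key := h (e β) (fun α => if e α = e β then c α else 0)
    (fun α hα => by by_contra hne; simp [hne] at hα) (by
      have h1 : ∑ α, (if e α = e β then c α else 0) • r α
          = - ∑ α, (if e α = e β then 0 else c α) • r α := by
        rw [eq_neg_iff_add_eq_zero, ← Finset.sum_add_distrib, ← hc]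
        refine Finset.sum_congr rfl fun α _ => ?_
        by_cases hα : e α = e β <;> simp [hα]
      rw [h1]
      refine neg_mem (sum_mem fun α _ => ?_)
      by_cases hα : e α = e β
      · simp [hα]
      · by_cases hcα : c α = 0
        · simp [hcα]
        · have := lt_of_le_of_ne (hmax α hcα) hα
          simp only [hα, if_false]
          exact Submodule.smul_mem _ _ (hG (by omega) (hr α)))
  have := congrFun key β
  simp at this
  exact hβ this

/-- If, modulo lower terms, `Y` annihilates the `r α` and acts on the `X ^ c (r α)` like `d/dX`,
then the `X ^ c (r α)` are again graded independent. -/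
theorem GradedIndep.step {G : ℤ → Submodule K V} {A : Type*} [Fintype A] {r : A → V} {e : A → ℤ}
    (h : GradedIndep G r e) (X Y : Module.End K V) (d : ℤ)
    (hY : ∀ D, ∀ v ∈ G D, Y v ∈ G (D - d)) (hYr : ∀ α, Y (r α) ∈ G (e α - d - 1))
    (κ : ℕ → K) (b : ℕ) (hκ : ∀ c, c + 1 < b → κ c ≠ 0)
    (hYX : ∀ α c, c + 1 < b → Y ((X ^ (c + 1)) (r α)) - κ c • (X ^ c) (r α) ∈ G (e α + c * d - 1)) :
    GradedIndep G (fun x : Fin b × A => (X ^ (x.1 : ℕ)) (r x.2))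
      (fun x => e x.2 + (x.1 : ℕ) * d) := by
  induction b with
  | zero => intro D c _ _; funext x; exact x.1.elim0
  | succ b ih =>
    specialize ih (fun c hc => hκ c (by omega)) (fun α c hc => hYX α c (by omega))
    intro D c hdeg hmem
    rw [Fintype.sum_prod_type, Fin.sum_univ_succ] at hmem
    have h1 := hY _ _ hmem
    rw [map_add, map_sum, map_sum] at h1
    have hz : ∑ α, Y (c (0, α) • (X ^ ((0 : Fin (b + 1)) : ℕ)) (r α)) ∈ G (D - d - 1) := by
      refine sum_mem fun α _ => ?_
      by_cases h0 : c (0, α) = 0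
      · simp [h0]
      · have := hdeg _ h0
        simp at this
        rw [map_smul, ← this]
        exact Submodule.smul_mem _ _ (by simpa using hYr α)
    have h2 : ∑ x : Fin b × A, (c (x.1.succ, x.2) * κ x.1) • (X ^ (x.1 : ℕ)) (r x.2)
        ∈ G (D - d - 1) := by
      have h3 : ∑ x : Fin b × A, (Y (c (x.1.succ, x.2) • (X ^ ((x.1 : ℕ) + 1)) (r x.2)) -
          (c (x.1.succ, x.2) * κ x.1) • (X ^ (x.1 : ℕ)) (r x.2)) ∈ G (D - d - 1) := by
        refine sum_mem fun x _ => ?_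
        by_cases h0 : c (x.1.succ, x.2) = 0
        · simp [h0]
        · have := hdeg _ h0
          simp only [Fin.val_succ] at this
          rw [map_smul, mul_smul, ← smul_sub]
          have h4 := hYX x.2 x.1 (by have := x.1.2; omega)
          have h5 : e x.2 + (x.1 : ℕ) * d - 1 = D - d - 1 := by rw [← this]; push_cast; ring
          rw [h5] at h4
          exact Submodule.smul_mem _ _ h4
      rw [Finset.sum_sub_distrib] at h3
      have h6 : ∑ x : Fin b × A, Y (c (x.1.succ, x.2) • (X ^ ((x.1 : ℕ) + 1)) (r x.2)) ∈
          G (D - d - 1) := by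
        rw [Fintype.sum_prod_type]
        rw [sub_right_comm] at h1
        have := sub_mem h1 hz
        rw [add_sub_cancel_left] at this
        simpa [map_sum] using this
      simpa using sub_mem h6 h3
    have h7 := ih (D - d) (fun x => c (x.1.succ, x.2) * κ x.1) (by
      intro x hx
      have := hdeg _ (left_ne_zero_of_mul hx)
      simp only [Fin.val_succ] at this
      rw [← this]; push_cast; ring) h2
    have h8 : ∀ (i : Fin b) α, c (i.succ, α) = 0 := fun i α =>
      (mul_eq_zero.1 (congrFun h7 (i, α))).resolve_right (hκ i (by have := i.2; omega))
    simp only [h8, zero_smul, Finset.sum_const_zero, add_zero] at hmem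
    have h9 := h D (fun α => c (0, α)) (fun α hα => by simpa using hdeg _ hα) (by simpa using hmem)
    funext ⟨i, α⟩
    refine Fin.cases ?_ (fun i => ?_) i
    · exact congrFun h9 α
    · exact h8 i α

theorem approx_kill_pow {G : ℤ → Submodule K V} {X Y : Module.End K V} {d d' e : ℤ} {ε : K} {r : V}
    (hX : ∀ D, ∀ v ∈ G D, X v ∈ G (D + d)) (hr : r ∈ G e) (hYr : Y r ∈ G (e - d' - 1))
    (hXY : ∀ D, ∀ v ∈ G D, Y (X v) - ε • X (Y v) ∈ G (D + d - d' - 1)) (c : ℕ) :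
    (X ^ c) r ∈ G (e + c * d) ∧ Y ((X ^ c) r) ∈ G (e + c * d - d' - 1) := by
  induction c with
  | zero => simpa using ⟨hr, hYr⟩
  | succ c ih =>
    rw [pow_succ', Module.End.mul_apply]
    have e1 : e + (c + 1 : ℕ) * d = e + c * d + d := by push_cast; ring
    rw [e1]
    refine ⟨hX _ _ ih.1, ?_⟩
    have h1 := hXY _ _ ih.1
    have h2 := hX _ _ ih.2
    have e2 : e + c * d - d' - 1 + d = e + c * d + d - d' - 1 := by ring
    rw [e2] at h2
    simpa using add_mem h1 (Submodule.smul_mem _ ε h2)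

theorem approx_deriv_pow {G : ℤ → Submodule K V} {X Y : Module.End K V} {d e : ℤ} {c₀ : K} {r : V}
    (hX : ∀ D, ∀ v ∈ G D, X v ∈ G (D + d)) (hr : r ∈ G e) (hYr : Y r ∈ G (e - d - 1))
    (hXY : ∀ D, ∀ v ∈ G D, Y (X v) - X (Y v) - c₀ • v ∈ G (D - 1)) (c : ℕ) :
    Y ((X ^ (c + 1)) r) - (((c + 1 : ℕ) : K) * c₀) • (X ^ c) r ∈ G (e + c * d - 1) := by
  have hXr : ∀ c : ℕ, (X ^ c) r ∈ G (e + c * d) := by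
    intro c
    induction c with
    | zero => simpa using hr
    | succ c ih =>
      rw [pow_succ', Module.End.mul_apply]
      have e1 : e + (c + 1 : ℕ) * d = e + c * d + d := by push_cast; ring
      rw [e1]
      exact hX _ _ ih
  induction c with
  | zero =>
    have h1 := hXY _ _ hr
    have h2 := hX _ _ hYr
    have e2 : e - d - 1 + d = e - 1 := by ring
    rw [e2] at h2
    have := add_mem h1 h2
    simp only [zero_add, pow_one, Nat.cast_one, one_mul, pow_zero, Module.End.one_apply,
      Nat.cast_zero, zero_mul, add_zero]
    convert this using 1
    abel
  | succ c ih =>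
    have h1 := hXY _ _ (hXr (c + 1))
    have h2 := hX _ _ ih
    have e2 : e + c * d - 1 + d = e + (c + 1 : ℕ) * d - 1 := by push_cast; ring
    rw [e2] at h2
    rw [map_sub, map_smul, ← Module.End.mul_apply X (X ^ c), ← pow_succ' X c] at h2
    rw [pow_succ' X (c + 1), Module.End.mul_apply]
    have := add_mem h1 h2
    convert this using 1
    push_cast
    module

/-- The dimension bound behind the simplicity of baby Verma modules: operators `Y i`, `X i`, lowering
and raising a filtration by `d i`, which satisfy the relations of a (super) Weyl algebra modulo lower
terms, at least when `Y i` precedes `X j`, generate from a graded independent family annihilated by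
the `Y i` a graded independent family of monomials. -/
theorem card_mul_prod_le_finrank [FiniteDimensional K V] {G : ℤ → Submodule K V} (hG : Monotone G)
    (p : ℕ) [CharP K p] [Fact p.Prime] {ι α : Type*} [DecidableEq ι] [LinearOrder α]
    (S : Finset ι) (key : ι → α)
    (X Y : ι → Module.End K V) (d : ι → ℤ) (b : ι → ℕ)
    (hX : ∀ i ∈ S, ∀ D, ∀ v ∈ G D, X i v ∈ G (D + d i))
    (hY : ∀ i ∈ S, ∀ D, ∀ v ∈ G D, Y i v ∈ G (D - d i))
    (hcross : ∀ i ∈ S, ∀ j ∈ S, i ≠ j → key i ≤ key j → ∃ ε : K, ∀ D, ∀ v ∈ G D,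
      Y i (X j v) - ε • X j (Y i v) ∈ G (D + d j - d i - 1))
    (hself : ∀ i ∈ S, ∃ c₀ : K, ∃ ε : K, c₀ ≠ 0 ∧
      (∀ D, ∀ v ∈ G D, Y i (X i v) - ε • X i (Y i v) - c₀ • v ∈ G (D - 1)) ∧
        ((ε = 1 ∧ b i = p) ∨ b i = 2))
    {A₀ : Type} [Fintype A₀] (r₀ : A₀ → V) (e₀ : A₀ → ℤ) (hr₀ : ∀ x, r₀ x ∈ G (e₀ x))
    (hYr₀ : ∀ i ∈ S, ∀ x, Y i (r₀ x) ∈ G (e₀ x - d i - 1)) (h₀ : GradedIndep G r₀ e₀) :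
    Fintype.card A₀ * ∏ i ∈ S, b i ≤ Module.finrank K V := by
  suffices H : ∀ s : Finset ι, s ⊆ S → ∃ (A : Type) (_ : Fintype A) (r : A → V) (e : A → ℤ),
      Fintype.card A = Fintype.card A₀ * ∏ i ∈ s, b i ∧ (∀ x, r x ∈ G (e x)) ∧
      GradedIndep G r e ∧ ∀ i ∈ S, i ∉ s → (∀ j ∈ s, key i ≤ key j) →
        ∀ x, Y i (r x) ∈ G (e x - d i - 1) by
    obtain ⟨A, _, r, e, hc, hr, hi, -⟩ := H S subset_rfl
    rw [← hc]
    exact (hi.linearIndependent hG hr).fintype_card_le_finrank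
  intro s
  induction s using Finset.induction_on_min_value key with
  | empty => exact fun _ => ⟨A₀, _, r₀, e₀, by simp, hr₀, h₀, fun i hi _ _ => hYr₀ i hi⟩
  | insert a s ha hle ih =>
    intro hs
    obtain ⟨A, _, r, e, hc, hr, hi, hk⟩ := ih ((Finset.subset_insert _ _).trans hs)
    have haS := hs (Finset.mem_insert_self a s)
    have hYa := hk a haS ha hle
    have hXpow : ∀ x (c : ℕ), (X a ^ c) (r x) ∈ G (e x + c * d a) := by
      intro x c
      induction c with
      | zero => simpa using hr x
      | succ c ih =>
        rw [pow_succ', Module.End.mul_apply]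
        have e1 : e x + (c + 1 : ℕ) * d a = e x + c * d a + d a := by push_cast; ring
        rw [e1]
        exact hX a haS _ _ ih
    obtain ⟨c₀, ε, hc₀, hrel, hb⟩ := hself a haS
    refine ⟨Fin (b a) × A, inferInstance, fun x => (X a ^ (x.1 : ℕ)) (r x.2),
      fun x => e x.2 + (x.1 : ℕ) * d a, ?_, fun x => hXpow _ _, ?_, ?_⟩
    · rw [Fintype.card_prod, hc, Finset.prod_insert ha, Fintype.card_fin]; ring
    · rcases hb with ⟨rfl, hb⟩ | hb
      · refine hi.step (X a) (Y a) (d a) (hY a haS) hYa (fun c => ((c + 1 : ℕ) : K) * c₀) (b a)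
          (fun c hcb => mul_ne_zero ?_ hc₀) (fun x c _ => ?_)
        · rw [hb] at hcb
          rw [Ne, CharP.cast_eq_zero_iff K p]
          exact Nat.not_dvd_of_pos_of_lt (Nat.succ_pos c) hcb
        · exact approx_deriv_pow (hX a haS) (hr x) (hYa x)
            (fun D v hv => by simpa using hrel D v hv) c
      · refine hi.step (X a) (Y a) (d a) (hY a haS) hYa (fun _ => c₀) (b a)
          (fun c hcb => hc₀) (fun x c hcb => ?_)
        obtain rfl : c = 0 := by omega
        have h1 := hrel _ _ (hr x)
        have h2 := hX a haS _ _ (hYa x)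
        rw [show e x - d a - 1 + d a = e x - 1 by ring] at h2
        have := add_mem h1 (Submodule.smul_mem _ ε h2)
        simp only [zero_add, pow_one, pow_zero, Module.End.one_apply, Nat.cast_zero, zero_mul,
          add_zero]
        convert this using 1
        abel
    · intro i hiS his hij x
      simp only [Finset.mem_insert, not_or] at his
      obtain ⟨ε, hε⟩ := hcross i hiS a haS his.1 (hij a (Finset.mem_insert_self _ _))
      exact (approx_kill_pow (hX a haS) (hr x.2)
        (hk i hiS his.2 (fun j hj => hij j (Finset.mem_insert_of_mem hj)) x.2) hε x.1).2

end Filtration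

/-! ### Common eigenvectors and spanning by ordered monomials -/

section Ordered

variable {K : Type*} [Field K] {V : Type*} [AddCommGroup V] [Module K V]

theorem exists_eigenvector_mem [IsAlgClosed K] [FiniteDimensional K V] {E : Submodule K V}
    (hE : E ≠ ⊥) (T : Module.End K V) (hT : ∀ v ∈ E, T v ∈ E) :
    ∃ μ : K, ∃ v ∈ E, v ≠ 0 ∧ T v = μ • v := by
  have : Nontrivial E := (Submodule.nontrivial_iff_ne_bot).2 hE
  obtain ⟨μ, hμ⟩ := Module.End.exists_eigenvalue (T.restrict hT)
  obtain ⟨v, hv⟩ := hμ.exists_hasEigenvector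
  refine ⟨μ, v.1, v.2, fun h => hv.2 (Subtype.ext h), ?_⟩
  exact congrArg Subtype.val hv.apply_eq_smul

theorem exists_mem_ker_of_pow_eq_zero [IsAlgClosed K] [FiniteDimensional K V] {E : Submodule K V}
    (hE : E ≠ ⊥) (T : Module.End K V) (hT : ∀ v ∈ E, T v ∈ E) {m : ℕ} (hm : T ^ m = 0) :
    ∃ v ∈ E, v ≠ 0 ∧ T v = 0 := by
  obtain ⟨μ, v, hv, hv0, hμ⟩ := exists_eigenvector_mem hE T hT
  refine ⟨v, hv, hv0, ?_⟩
  have h1 : ∀ k : ℕ, (T ^ k) v = μ ^ k • v := by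
    intro k
    induction k with
    | zero => simp
    | succ k ih => rw [pow_succ', Module.End.mul_apply, ih, map_smul, hμ, smul_smul, pow_succ]
  have h2 := h1 m
  rw [hm, LinearMap.zero_apply] at h2
  have h3 : μ = 0 := by
    have := (smul_eq_zero.1 h2.symm).resolve_right hv0
    exact pow_eq_zero_iff (fun h => by simp [h] at this) |>.1 this
  rw [hμ, h3, zero_smul]

/-- A form of Engel's theorem for nilpotent operators `Y i` that supercommute modulo the earlier
ones. -/
theorem exists_common_kernel [IsAlgClosed K] [FiniteDimensional K V] [Nontrivial V]
    {ι α : Type*} [DecidableEq ι] [LinearOrder α] (S : Finset ι) (key : ι → α)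
    (Y : ι → Module.End K V) (hnil : ∀ i ∈ S, ∃ m : ℕ, Y i ^ m = 0)
    (hcomm : ∀ i ∈ S, ∀ j ∈ S, ∃ ε : K, ∀ v, (∀ l ∈ S, key l < key i → Y l v = 0) →
      Y j (Y i v) = ε • Y i (Y j v)) :
    (⨅ i ∈ S, LinearMap.ker (Y i)) ≠ ⊥ := by
  suffices H : ∀ s : Finset ι, s ⊆ S → (∀ i ∈ s, ∀ j ∈ S, key j < key i → j ∈ s) →
      (⨅ i ∈ s, LinearMap.ker (Y i)) ≠ ⊥ from H S subset_rfl fun _ _ _ h _ => h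
  intro s
  induction s using Finset.induction_on_max_value key with
  | empty => intros; simp
  | insert a s ha hle ih =>
    intro hs hdown
    have haS := hs (Finset.mem_insert_self a s)
    have hdown' : ∀ i ∈ s, ∀ j ∈ S, key j < key i → j ∈ s := by
      intro i hi j hj hij
      rcases Finset.mem_insert.1 (hdown i (Finset.mem_insert_of_mem hi) j hj hij) with rfl | h
      · exact absurd (hle i hi) (not_le.2 hij)
      · exact h
    have hE := ih ((Finset.subset_insert _ _).trans hs) hdown'
    obtain ⟨m, hm⟩ := hnil a haS
    obtain ⟨v, hv, hv0, hva⟩ := exists_mem_ker_of_pow_eq_zero hE (Y a) (by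
      intro v hv
      simp only [Submodule.mem_iInf, LinearMap.mem_ker] at hv ⊢
      intro j hj
      obtain ⟨ε, hε⟩ := hcomm a haS j (hs (Finset.mem_insert_of_mem hj))
      rw [hε v, hv j hj, map_zero, smul_zero]
      intro l hl hla
      rcases Finset.mem_insert.1 (hdown a (Finset.mem_insert_self _ _) l hl hla) with rfl | h
      · exact absurd hla (lt_irrefl _)
      · exact hv l h) hm
    rw [Submodule.ne_bot_iff]
    refine ⟨v, ?_, hv0⟩
    simp only [Submodule.mem_iInf, LinearMap.mem_ker, Finset.mem_insert] at hv ⊢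
    rintro i (rfl | hi)
    · exact hva
    · exact hv i hi

/-- The sum `T + Y T + ⋯ + Y ^ c T`. -/
def powSum (Y : Module.End K V) (T : Submodule K V) : ℕ → Submodule K V
  | 0 => T
  | c + 1 => T ⊔ (powSum Y T c).map Y

theorem le_powSum (Y : Module.End K V) (T : Submodule K V) (c : ℕ) : T ≤ powSum Y T c := by
  cases c
  · exact le_rfl
  · exact le_sup_left

theorem powSum_le_succ (Y : Module.End K V) (T : Submodule K V) (c : ℕ) :
    powSum Y T c ≤ powSum Y T (c + 1) := by
  induction c with
  | zero => exact le_sup_left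
  | succ c ih => exact sup_le_sup_left (Submodule.map_mono ih) _

theorem finiteDimensional_powSum (Y : Module.End K V) (T : Submodule K V) [FiniteDimensional K T]
    (c : ℕ) : FiniteDimensional K (powSum Y T c) ∧
      Module.finrank K (powSum Y T c) ≤ (c + 1) * Module.finrank K T := by
  induction c with
  | zero => exact ⟨by assumption, by simp only [zero_add, one_mul]; exact le_rfl⟩
  | succ c ih =>
    obtain ⟨h1, h2⟩ := ih
    refine ⟨inferInstanceAs (FiniteDimensional K ↥(T ⊔ (powSum Y T c).map Y)), ?_⟩
    calc Module.finrank K (powSum Y T (c + 1))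
        ≤ Module.finrank K T + Module.finrank K ((powSum Y T c).map Y) :=
          Submodule.finrank_add_le_finrank_add_finrank _ _
      _ ≤ Module.finrank K T + Module.finrank K (powSum Y T c) := by
          gcongr; exact Submodule.finrank_map_le _ _
      _ ≤ (c + 1 + 1) * Module.finrank K T := by linarith

theorem map_powSum_le (Y : Module.End K V) (T : Submodule K V) (c : ℕ) :
    (powSum Y T c).map Y ≤ powSum Y T c ⊔ T.map (Y ^ (c + 1)) := by
  induction c with
  | zero => simp [powSum]
  | succ c ih =>
    have h1 : (powSum Y T (c + 1)).map Y = T.map Y ⊔ ((powSum Y T c).map Y).map Y := by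
      rw [powSum, Submodule.map_sup]
    have h2 : (T.map (Y ^ (c + 1))).map Y = T.map (Y ^ (c + 1 + 1)) := by
      rw [← Submodule.map_comp, pow_succ' Y (c + 1)]; rfl
    have h3 : (powSum Y T c).map Y ≤ powSum Y T (c + 1) := le_sup_right
    rw [h1]
    refine sup_le ?_ ?_
    · exact ((Submodule.map_mono (le_powSum Y T c)).trans h3).trans le_sup_left
    · refine (Submodule.map_mono ih).trans ?_
      rw [Submodule.map_sup, h2]
      exact sup_le_sup_right h3 _

/-- If the `Y i` supercommute modulo the earlier ones, and `Y i ^ b i` is a combination of earlier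
ones, then the ordered monomials with exponents below the `b i` span, from a vector `v`, a stable
subspace. -/
theorem exists_stable_finrank_le {ι α : Type*} [DecidableEq ι] [LinearOrder α] (S : Finset ι)
    (key : ι → α) (Y : ι → Module.End K V) (b : ι → ℕ) (hb : ∀ i ∈ S, 0 < b i)
    (hcomm : ∀ i ∈ S, ∀ j ∈ S, ∃ ε : K, ∀ T : Submodule K V,
      (∀ l ∈ S, key l < key i → ∀ t ∈ T, Y l t ∈ T) → ∀ t ∈ T, Y j (Y i t) - ε • Y i (Y j t) ∈ T)
    (hpow : ∀ i ∈ S, ∀ T : Submodule K V, (∀ l ∈ S, key l < key i → ∀ t ∈ T, Y l t ∈ T) →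
      ∀ t ∈ T, (Y i ^ b i) t ∈ T) (v : V) :
    ∃ T : Submodule K V, v ∈ T ∧ (∀ i ∈ S, ∀ t ∈ T, Y i t ∈ T) ∧ FiniteDimensional K T ∧
      Module.finrank K T ≤ ∏ i ∈ S, b i := by
  suffices H : ∀ s : Finset ι, s ⊆ S → (∀ i ∈ s, ∀ j ∈ S, key j < key i → j ∈ s) →
      ∃ T : Submodule K V, v ∈ T ∧ (∀ i ∈ s, ∀ t ∈ T, Y i t ∈ T) ∧ FiniteDimensional K T ∧
        Module.finrank K T ≤ ∏ i ∈ s, b i from H S subset_rfl fun _ _ _ h _ => h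
  intro s
  induction s using Finset.induction_on_max_value key with
  | empty =>
    intros
    exact ⟨K ∙ v, Submodule.mem_span_singleton_self v, by simp, inferInstance,
      by simpa using finrank_span_le_card ({v} : Set V)⟩
  | insert a s ha hle ih =>
    intro hs hdown
    have haS := hs (Finset.mem_insert_self a s)
    have hdown' : ∀ i ∈ s, ∀ j ∈ S, key j < key i → j ∈ s := by
      intro i hi j hj hij
      rcases Finset.mem_insert.1 (hdown i (Finset.mem_insert_of_mem hi) j hj hij) with rfl | h
      · exact absurd (hle i hi) (not_le.2 hij)
      · exact h
    have hlow : ∀ l ∈ S, key l < key a → l ∈ s := by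
      intro l hl hla
      rcases Finset.mem_insert.1 (hdown a (Finset.mem_insert_self _ _) l hl hla) with rfl | h
      · exact absurd hla (lt_irrefl _)
      · exact h
    obtain ⟨T, hvT, hst, hfin, hrk⟩ := ih ((Finset.subset_insert _ _).trans hs) hdown'
    have hstab : ∀ c, ∀ j ∈ s, ∀ t ∈ powSum (Y a) T c, Y j t ∈ powSum (Y a) T c := by
      intro c
      induction c with
      | zero => exact hst
      | succ c ihc =>
        intro j hj t ht
        obtain ⟨t₁, ht₁, t₂, ht₂, rfl⟩ := Submodule.mem_sup.1 ht
        obtain ⟨u, hu, rfl⟩ := ht₂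
        obtain ⟨ε, hε⟩ := hcomm a haS j (hs (Finset.mem_insert_of_mem hj))
        have h1 := hε (powSum (Y a) T c) (fun l hl hla => ihc l (hlow l hl hla)) u hu
        have h2 : Y a (Y j u) ∈ powSum (Y a) T (c + 1) :=
          Submodule.mem_sup_right ⟨_, ihc j hj u hu, rfl⟩
        rw [map_add]
        refine add_mem (le_powSum _ _ _ (hst j hj t₁ ht₁)) ?_
        simpa using add_mem (powSum_le_succ _ _ _ h1) (Submodule.smul_mem _ ε h2)
    obtain ⟨c, hc⟩ : ∃ c, b a = c + 1 := ⟨b a - 1, by have := hb a haS; omega⟩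
    obtain ⟨hf, hr⟩ := finiteDimensional_powSum (Y a) T c
    refine ⟨powSum (Y a) T c, le_powSum _ _ _ hvT, ?_, hf, ?_⟩
    · intro i hi t ht
      rcases Finset.mem_insert.1 hi with rfl | hi
      · have h1 := map_powSum_le (Y i) T c ⟨t, ht, rfl⟩
        refine (sup_le le_rfl ?_ : _ ≤ powSum (Y i) T c) h1
        rintro _ ⟨u, hu, rfl⟩
        rw [← hc]
        exact le_powSum _ _ _ (hpow i haS T (fun l hl hla => hst l (hlow l hl hla)) u hu)
      · exact hstab c i hi t ht
    · rw [Finset.prod_insert ha, hc]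
      exact hr.trans (Nat.mul_le_mul_left _ hrk)

end Ordered

/-! ### Filtrations by annihilating words -/

section AnnFilt

variable {K : Type*} [Field K] {V : Type*} [AddCommGroup V] [Module K V] {ι : Type*}

/-- For operators `Y i` of positive degree `d i`, the vectors annihilated by all words in the `Y i`,
`i ∈ S`, of total degree larger than `D`. -/
def annFilt (S : Finset ι) (Y : ι → Module.End K V) (d : ι → ℤ) (D : ℤ) : Submodule K V where
  carrier := {v | ∀ L : List ι, (∀ i ∈ L, i ∈ S) → D < (L.map d).sum → (L.map Y).prod v = 0}
  zero_mem' := by intro L _ _; simp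
  add_mem' := by
    intro x y hx hy L h1 h2
    rw [map_add, hx L h1 h2, hy L h1 h2, add_zero]
  smul_mem' := by
    intro c x hx L h1 h2
    rw [map_smul, hx L h1 h2, smul_zero]

variable {S : Finset ι} {Y : ι → Module.End K V} {d : ι → ℤ}

theorem annFilt_mono : Monotone (annFilt S Y d) :=
  fun _ _ h _ hv L h1 h2 => hv L h1 (lt_of_le_of_lt h h2)

theorem eq_zero_of_mem_annFilt {D : ℤ} (hD : D < 0) {v : V} (hv : v ∈ annFilt S Y d D) : v = 0 := by
  simpa using hv [] (by simp) (by simpa using hD)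

theorem apply_mem_annFilt {D : ℤ} {i : ι} (hi : i ∈ S) {v : V} (hv : v ∈ annFilt S Y d D) :
    Y i v ∈ annFilt S Y d (D - d i) := by
  intro L h1 h2
  have := hv (L ++ [i]) (by simpa [or_imp, forall_and, hi] using h1) (by simp; linarith)
  simpa using this

theorem mem_annFilt_of {D : ℤ} (hD : 0 ≤ D) {v : V}
    (hv : ∀ i ∈ S, Y i v ∈ annFilt S Y d (D - d i)) : v ∈ annFilt S Y d D := by
  intro L h1 h2
  rcases List.eq_nil_or_concat L with rfl | ⟨L, i, rfl⟩
  · simp at h2; omega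
  · simp only [List.concat_eq_append, List.mem_append, List.mem_singleton, List.map_append,
      List.map_cons, List.map_nil, List.sum_append, List.sum_singleton, List.prod_append,
      List.prod_singleton] at h1 h2 ⊢
    exact hv i (h1 i (Or.inr rfl)) L (fun j hj => h1 j (Or.inl hj)) (by linarith)

end AnnFilt

/-! ### Paraboson operators -/

section Parabose

variable {K : Type*} [Field K] {V : Type*} [AddCommGroup V] [Module K V]

/-- The matrix, antidiagonal with entries `c k`, of a symplectic form on a space with basis
`t 0, …, t (N - 1)`. -/
def antiForm (N : ℕ) (c : ℕ → K) (k j : ℕ) : K := if k + j + 1 = N then c k else 0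

/-- The anticommutator `a i * a j + a j * a i`. -/
def anti (a : ℕ → Module.End K V) (i j : ℕ) : Module.End K V := a i * a j + a j * a i

/-- The paraboson relations for `a 0, …, a (N - 1)`: these are the defining relations of
`osp(1|N)` in terms of its odd part, the `a i` being the action of the odd elements attached to a
basis of the symplectic space for which the form is antidiagonal. -/
def IsParabose (N : ℕ) (c : ℕ → K) (a : ℕ → Module.End K V) : Prop :=
  ∀ i j k, i < N → j < N → k < N →
    anti a i j * a k - a k * anti a i j = antiForm N c k j • a i + antiForm N c k i • a j

/-- Indices of a basis of the even part of `n⁻`. -/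
def evenPairs (n : ℕ) : Finset (ℕ × ℕ) :=
  (Finset.range (2 * n) ×ˢ Finset.range (2 * n)).filter fun x => x.1 ≤ x.2 ∧ x.1 + x.2 + 2 ≤ 2 * n

theorem mem_evenPairs {n : ℕ} {x : ℕ × ℕ} :
    x ∈ evenPairs n ↔ x.1 ≤ x.2 ∧ x.1 + x.2 + 2 ≤ 2 * n := by
  simp only [evenPairs, Finset.mem_filter, Finset.mem_product, Finset.mem_range]
  constructor
  · exact fun h => h.2
  · intro h; exact ⟨⟨by omega, by omega⟩, h⟩

/-- The dimension `p ^ dim n⁻_0 * 2 ^ dim n⁻_1` of the baby Verma modules. -/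
def bvDim (p n : ℕ) : ℕ := p ^ (evenPairs n).card * 2 ^ n

theorem anti_comm (a : ℕ → Module.End K V) (i j : ℕ) : anti a i j = anti a j i := by
  unfold anti; rw [add_comm]

variable {N n p : ℕ} {c : ℕ → K} {a : ℕ → Module.End K V}

theorem antiForm_smul_mem {T : Submodule K V} {k j : ℕ} {x : V} (h : k + j + 1 = N → x ∈ T) :
    antiForm N c k j • x ∈ T := by
  unfold antiForm
  split_ifs with h1
  · exact T.smul_mem _ (h h1)
  · simp

theorem IsParabose.anti_apply (h : IsParabose N c a) {i j k : ℕ} (hi : i < N) (hj : j < N)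
    (hk : k < N) (v : V) : anti a i j (a k v) =
      a k (anti a i j v) + (antiForm N c k j • a i v + antiForm N c k i • a j v) := by
  have h1 := congrArg (fun f => f v) (h i j k hi hj hk)
  simp only [LinearMap.sub_apply, Module.End.mul_apply, LinearMap.add_apply,
    LinearMap.smul_apply] at h1
  rw [← h1]; abel

theorem IsParabose.anti_anti_apply (h : IsParabose N c a) {i j k l : ℕ} (hi : i < N) (hj : j < N)
    (hk : k < N) (hl : l < N) (v : V) : anti a i j (anti a k l v) = anti a k l (anti a i j v) +
      (antiForm N c k j • anti a i l v + antiForm N c k i • anti a j l v +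
        antiForm N c l j • anti a k i v + antiForm N c l i • anti a k j v) := by
  have e1 : anti a k l v = a k (a l v) + a l (a k v) := rfl
  rw [e1, map_add, h.anti_apply hi hj hk, h.anti_apply hi hj hl, h.anti_apply hi hj hl,
    h.anti_apply hi hj hk]
  simp only [anti, LinearMap.add_apply, Module.End.mul_apply, map_add, map_smul]
  module

theorem apply_apply_eq (a : ℕ → Module.End K V) (i k : ℕ) (v : V) :
    a i (a k v) = - a k (a i v) + anti a i k v := by
  simp [anti]

/-- Degrees of the root vectors of `n⁻`. -/
def negDeg (n : ℕ) : ℕ × ℕ ⊕ ℕ → ℤ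
  | .inl x => 2 * (2 * n - 1) - 2 * (x.1 + x.2)
  | .inr i => 2 * n - 1 - 2 * i

/-- The operators attached to the root vectors of `n⁻`, shifted by the functional `χ`. -/
def negOp (a : ℕ → Module.End K V) (χ : ℕ → ℕ → K) : ℕ × ℕ ⊕ ℕ → Module.End K V
  | .inl x => anti a x.1 x.2 - χ x.1 x.2 • 1
  | .inr i => a i

/-- The operators dual to the root vectors of `n⁻` for the form `χ([x, y])`. -/
def dualOp (n : ℕ) (a : ℕ → Module.End K V) : ℕ × ℕ ⊕ ℕ → Module.End K V
  | .inl x => anti a (2 * n - 1 - x.1) (2 * n - 2 - x.2)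
  | .inr i => a (2 * n - 2 - i)

/-- The index set of the root vectors of `n⁻`, restricted to the odd root vectors with index below
`m`. -/
def negIdx (n m : ℕ) : Finset (ℕ × ℕ ⊕ ℕ) := (evenPairs n).disjSum (Finset.range m)

theorem inl_mem_negIdx {m : ℕ} {x : ℕ × ℕ} :
    Sum.inl x ∈ negIdx n m ↔ x.1 ≤ x.2 ∧ x.1 + x.2 + 2 ≤ 2 * n := by
  simp [negIdx, ← mem_evenPairs]

theorem inr_mem_negIdx {m i : ℕ} : (Sum.inr i : ℕ × ℕ ⊕ ℕ) ∈ negIdx n m ↔ i < m := by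
  simp [negIdx]

theorem forall_mem_negIdx {m : ℕ} {P : ℕ × ℕ ⊕ ℕ → Prop} : (∀ i ∈ negIdx n m, P i) ↔
    (∀ i j, i ≤ j → i + j + 2 ≤ 2 * n → P (.inl (i, j))) ∧ ∀ i < m, P (.inr i) := by
  constructor
  · exact fun h => ⟨fun i j h1 h2 => h _ (inl_mem_negIdx.2 ⟨h1, h2⟩),
      fun i hi => h _ (inr_mem_negIdx.2 hi)⟩
  · rintro ⟨h1, h2⟩ (⟨i, j⟩ | i) hi
    · exact h1 i j (inl_mem_negIdx.1 hi).1 (inl_mem_negIdx.1 hi).2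
    · exact h2 i (inr_mem_negIdx.1 hi)

theorem prod_negIdx (p n m : ℕ) :
    ∏ i ∈ negIdx n m, Sum.elim (fun _ => p) (fun _ => 2) i = p ^ (evenPairs n).card * 2 ^ m := by
  simp [negIdx, Finset.prod_disjSum]

/-- `U(n⁻) v` is stable under `n⁻`, finite dimensional and spanned by ordered monomials; it is stable
under everything when `v` is an eigenvector of the Borel subalgebra. -/
theorem IsParabose.exists_stable (h : IsParabose (2 * n) c a) (hp : 0 < p) (h2 : (2 : K) ≠ 0)
    (hpow : ∀ i j, i + j + 2 ≤ 2 * n → ∃ κ : K, anti a i j ^ p = κ • 1) {v : V}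
    (hv1 : ∀ k, n ≤ k → k < 2 * n → a k v = 0)
    (hv2 : ∀ k l, k < 2 * n → l < 2 * n → 2 * n ≤ k + l + 1 → ∃ κ : K, anti a k l v = κ • v) :
    ∃ T : Submodule K V, v ∈ T ∧ (∀ k < 2 * n, ∀ t ∈ T, a k t ∈ T) ∧ FiniteDimensional K T ∧
      Module.finrank K T ≤ bvDim p n := by
  have hY0 : ∀ x, negOp a 0 (.inl x) = anti a x.1 x.2 := by intro x; simp [negOp]
  have hanti : ∀ (T : Submodule K V) (m : ℤ), (∀ l ∈ negIdx n n, - negDeg n l < m →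
      ∀ t ∈ T, negOp a 0 l t ∈ T) → ∀ i j : ℕ, i + j + 2 ≤ 2 * n →
      - (2 * (2 * (n : ℤ) - 1) - 2 * (i + j)) < m → ∀ t ∈ T, anti a i j t ∈ T := by
    intro T m hT i j hij hm t ht
    rcases le_total i j with hle | hle
    · have := hT (.inl (i, j)) (inl_mem_negIdx.2 ⟨hle, hij⟩) (by simpa [negDeg] using hm) t ht
      rwa [hY0] at this
    · have := hT (.inl (j, i)) (inl_mem_negIdx.2 ⟨hle, by simp only; omega⟩)
        (by simp only [negDeg]; linarith) t ht
      rwa [hY0, anti_comm] at this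
  have hodd : ∀ (T : Submodule K V) (m : ℤ), (∀ l ∈ negIdx n n, - negDeg n l < m →
      ∀ t ∈ T, negOp a 0 l t ∈ T) → ∀ i : ℕ, i < n →
      - (2 * (n : ℤ) - 1 - 2 * i) < m → ∀ t ∈ T, a i t ∈ T := by
    intro T m hT i hij hm t ht
    exact hT (.inr i) (inr_mem_negIdx.2 hij) (by simpa [negDeg] using hm) t ht
  obtain ⟨T, hvT, hT, hTf, hTr⟩ := exists_stable_finrank_le (negIdx n n) (fun i => - negDeg n i)
    (negOp a 0) (Sum.elim (fun _ => p) (fun _ => 2))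
    (by rintro (x | x) _ <;> simp [hp])
    (by
      rintro (⟨i, j⟩ | i) hi (⟨k, l⟩ | k) hk
      · obtain ⟨hi1, hi2⟩ := inl_mem_negIdx.1 hi
        obtain ⟨hk1, hk2⟩ := inl_mem_negIdx.1 hk
        simp only at hi1 hi2 hk1 hk2
        refine ⟨1, fun T hT t ht => ?_⟩
        rw [hY0, hY0, h.anti_anti_apply (by omega) (by omega) (by omega) (by omega), one_smul,
          add_sub_cancel_left]
        have H := hanti T _ hT
        simp only [negDeg] at H
        refine add_mem (add_mem (add_mem ?_ ?_) ?_) ?_ <;>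
          exact antiForm_smul_mem fun e => H _ _ (by omega) (by omega) t ht
      · obtain ⟨hi1, hi2⟩ := inl_mem_negIdx.1 hi
        have hk1 := inr_mem_negIdx.1 hk
        simp only at hi1 hi2
        refine ⟨1, fun T hT t ht => ?_⟩
        rw [hY0, negOp, h.anti_apply (by omega) (by omega) (by omega), one_smul, sub_add_cancel_left]
        have H := hodd T _ hT
        simp only [negDeg] at H
        refine neg_mem (add_mem ?_ ?_) <;>
          exact antiForm_smul_mem fun e => H _ (by omega) (by omega) t ht
      · have hi1 := inr_mem_negIdx.1 hi
        obtain ⟨hk1, hk2⟩ := inl_mem_negIdx.1 hk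
        simp only at hk1 hk2
        refine ⟨1, fun T hT t ht => ?_⟩
        rw [hY0, negOp, h.anti_apply (by omega) (by omega) (by omega), one_smul, add_sub_cancel_left]
        have H := hodd T _ hT
        simp only [negDeg] at H
        refine add_mem ?_ ?_ <;>
          exact antiForm_smul_mem fun e => H _ (by omega) (by omega) t ht
      · have hi1 := inr_mem_negIdx.1 hi
        have hk1 := inr_mem_negIdx.1 hk
        refine ⟨-1, fun T hT t ht => ?_⟩
        rw [negOp, negOp, apply_apply_eq, neg_one_smul, sub_neg_eq_add, neg_add_cancel_comm]
        have H := hanti T _ hT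
        simp only [negDeg] at H
        exact H _ _ (by omega) (by omega) t ht)
    (by
      rintro (⟨i, j⟩ | i) hi T hT t ht
      · obtain ⟨hi1, hi2⟩ := inl_mem_negIdx.1 hi
        obtain ⟨κ, hκ⟩ := hpow i j hi2
        rw [hY0, Sum.elim_inl, hκ]
        exact T.smul_mem _ ht
      · have hi1 := inr_mem_negIdx.1 hi
        have h3 : (negOp a 0 (.inr i) ^ 2) t = (2 : K)⁻¹ • anti a i i t := by
          rw [eq_inv_smul_iff₀ h2]
          simp [negOp, anti, pow_two, two_smul]
        rw [Sum.elim_inr, h3]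
        have H := hanti T _ hT
        simp only [negDeg] at H
        exact T.smul_mem _ (H i i (by omega) (by omega) t ht)) v
  let C : Set (Submodule K V) := {F | v ∈ F ∧ ∀ i ∈ negIdx n n, ∀ t ∈ F, negOp a 0 i t ∈ F}
  have hF : sInf C ∈ C := by
    refine ⟨(Submodule.mem_sInf).2 fun F hF => hF.1, fun i hi t ht => ?_⟩
    exact (Submodule.mem_sInf).2 fun F hF => hF.2 i hi t ((Submodule.mem_sInf).1 ht F hF)
  have hFT : sInf C ≤ T := sInf_le ⟨hvT, hT⟩
  set F := sInf C with hFdef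
  have hFe : ∀ i j, i + j + 2 ≤ 2 * n → ∀ t ∈ F, anti a i j t ∈ F := fun i j hij t ht =>
    hanti F (2 * n + 2 * n) (fun l hl _ => hF.2 l hl) i j hij (by omega) t ht
  have hFo : ∀ i < n, ∀ t ∈ F, a i t ∈ F := fun i hi t ht => hF.2 (.inr i) (inr_mem_negIdx.2 hi) t ht
  -- the vectors that all of `g` maps into `F` form a subspace stable under `n⁻`
  let Q : Submodule K V :=
    { carrier := {m | m ∈ F ∧ (∀ k < 2 * n, a k m ∈ F) ∧
        ∀ k < 2 * n, ∀ l < 2 * n, anti a k l m ∈ F}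
      zero_mem' := by simp
      add_mem' := by
        rintro x y ⟨h1, h2, h3⟩ ⟨h1', h2', h3'⟩
        refine ⟨add_mem h1 h1', fun k hk => ?_, fun k hk l hl => ?_⟩
        · rw [map_add]; exact add_mem (h2 k hk) (h2' k hk)
        · rw [map_add]; exact add_mem (h3 k hk l hl) (h3' k hk l hl)
      smul_mem' := by
        rintro r x ⟨h1, h2, h3⟩
        refine ⟨F.smul_mem _ h1, fun k hk => ?_, fun k hk l hl => ?_⟩
        · rw [map_smul]; exact F.smul_mem _ (h2 k hk)
        · rw [map_smul]; exact F.smul_mem _ (h3 k hk l hl) }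
  have hQ : Q ∈ C := by
    refine ⟨⟨hF.1, fun k hk => ?_, fun k hk l hl => ?_⟩, forall_mem_negIdx.2 ⟨?_, ?_⟩⟩
    · by_cases hkn : k < n
      · exact hFo k hkn v hF.1
      · rw [hv1 k (by omega) hk]; exact zero_mem _
    · by_cases hkl : k + l + 2 ≤ 2 * n
      · exact hFe k l hkl v hF.1
      · obtain ⟨κ, hκ⟩ := hv2 k l hk hl (by omega)
        rw [hκ]; exact F.smul_mem _ hF.1
    · rintro i j hij1 hij2 m ⟨hm1, hm2, hm3⟩
      rw [hY0]
      refine ⟨hFe i j hij2 m hm1, fun k hk => ?_, fun k hk l hl => ?_⟩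
      · have h4 := h.anti_apply (i := i) (j := j) (k := k) (by omega) (by omega) hk m
        rw [← sub_eq_iff_eq_add] at h4
        rw [← h4]
        refine sub_mem (hFe i j hij2 _ (hm2 k hk)) (add_mem ?_ ?_) <;>
          exact F.smul_mem _ (hm2 _ (by omega))
      · rw [h.anti_anti_apply hk hl (by omega) (by omega)]
        refine add_mem (hFe i j hij2 _ (hm3 k hk l hl)) (add_mem (add_mem (add_mem ?_ ?_) ?_) ?_) <;>
          exact F.smul_mem _ (hm3 _ (by omega) _ (by omega))
    · rintro i hi m ⟨hm1, hm2, hm3⟩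
      refine ⟨hFo i hi m hm1, fun k hk => ?_, fun k hk l hl => ?_⟩
      · rw [negOp, apply_apply_eq]
        exact add_mem (neg_mem (hFo i hi _ (hm2 k hk))) (hm3 k hk i (by omega))
      · rw [negOp, h.anti_apply hk hl (by omega)]
        refine add_mem (hFo i hi _ (hm3 k hk l hl)) (add_mem ?_ ?_) <;>
          exact F.smul_mem _ (hm2 _ (by omega))
  have hFQ : F ≤ Q := sInf_le hQ
  refine ⟨F, hF.1, fun k hk t ht => (hFQ ht).2.1 k hk,
    Submodule.finiteDimensional_of_le hFT, (Submodule.finrank_mono hFT).trans ?_⟩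
  rwa [prod_negIdx] at hTr

end Parabose

/-! ### The lower bound for the dimension of a module -/

section LowerBound

variable {K : Type*} [Field K] {V : Type*} [AddCommGroup V] [Module K V]
variable {n p : ℕ} {c : ℕ → K} {a : ℕ → Module.End K V} {χ : ℕ → ℕ → K}

/-- The hypotheses on a functional `χ` on `n⁻` that is nonzero on every simple root vector and zero on
the other root vectors, and on a module with `p`-character `χ`. -/
structure IsWhittaker (n p : ℕ) (c : ℕ → K) (a : ℕ → Module.End K V) (χ : ℕ → ℕ → K) : Prop where
  rel : IsParabose (2 * n) c a
  two : (2 : K) ≠ 0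
  form_ne : ∀ k < 2 * n, c k ≠ 0
  char_symm : ∀ i j, χ i j = χ j i
  char_zero : ∀ i j, i + j + 2 < 2 * n → χ i j = 0
  char_ne : ∀ i j, i + j + 2 = 2 * n → χ i j ≠ 0
  nil : ∀ i j, i + j + 2 ≤ 2 * n → (anti a i j - χ i j • 1) ^ p = 0

/-- The filtration by annihilation by words in the shifted root vectors of `n⁻`. On its associated
graded space, `g` acts through commuting operators, up to the lowering part. -/
def whFilt (n : ℕ) (a : ℕ → Module.End K V) (χ : ℕ → ℕ → K) : ℤ → Submodule K V :=
  annFilt (negIdx n (n - 1)) (negOp a χ) (negDeg n)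

theorem two_smul_sq (a : ℕ → Module.End K V) (i : ℕ) : anti a i i = (2 : K) • a i ^ 2 := by
  rw [anti, pow_two, two_smul]

theorem IsWhittaker.anti_sub_mem (h : IsWhittaker n p c a χ) {i j : ℕ} (hij : i + j + 2 ≤ 2 * n)
    {D : ℤ} {v : V} (hv : v ∈ whFilt n a χ D) :
    anti a i j v - χ i j • v ∈ whFilt n a χ (D + 2 * (i + j) - 2 * (2 * n - 1)) := by
  rcases le_total i j with hle | hle
  · have := apply_mem_annFilt (i := .inl (i, j)) (inl_mem_negIdx.2 ⟨hle, hij⟩) hv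
    refine annFilt_mono ?_ this
    simp only [negDeg]; linarith
  · have := apply_mem_annFilt (i := .inl (j, i)) (inl_mem_negIdx.2 ⟨hle, by simp only; omega⟩) hv
    rw [anti_comm, h.char_symm]
    refine annFilt_mono ?_ this
    simp only [negDeg]; linarith

theorem IsWhittaker.anti_low_mem (h : IsWhittaker n p c a χ) {i j : ℕ} (hij : i + j + 2 < 2 * n)
    {D D' : ℤ} (hD : D + 2 * (i + j) - 2 * (2 * n - 1) ≤ D') {v : V} (hv : v ∈ whFilt n a χ D) :
    anti a i j v ∈ whFilt n a χ D' := by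
  have := h.anti_sub_mem hij.le hv
  rw [h.char_zero i j hij, zero_smul, sub_zero] at this
  exact annFilt_mono hD this

theorem odd_low_mem {i : ℕ} (hi : i + 1 < n) {D D' : ℤ} (hD : D + 2 * i - (2 * n - 1) ≤ D') {v : V}
    (hv : v ∈ whFilt n a χ D) : a i v ∈ whFilt n a χ D' := by
  have := apply_mem_annFilt (i := .inr i) (inr_mem_negIdx.2 (by omega)) hv
  refine annFilt_mono ?_ this
  simp only [negDeg]; linarith

/-- An element of degree `e` raises the filtration by at most `e + 2`. -/
theorem IsWhittaker.raise_aux (h : IsWhittaker n p c a χ) (m : ℕ) : ∀ D : ℤ, ∀ v ∈ whFilt n a χ D,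
    (∀ k < 2 * n, D + 2 * k - (2 * n - 1) + 8 * n ≤ m →
      a k v ∈ whFilt n a χ (D + 2 * k - (2 * n - 1) + 2)) ∧
    (∀ k < 2 * n, ∀ l < 2 * n, D + 2 * (k + l) - 2 * (2 * n - 1) + 8 * n ≤ m →
      anti a k l v ∈ whFilt n a χ (D + 2 * (k + l) - 2 * (2 * n - 1) + 2)) := by
  induction m with
  | zero =>
    intro D v hv
    refine ⟨fun k hk hD => ?_, fun k hk l hl hD => ?_⟩ <;>
      rw [eq_zero_of_mem_annFilt (by push_cast at hD; omega) hv, map_zero] <;> exact zero_mem _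
  | succ m ih =>
    intro D v hv
    by_cases hD0 : D < 0
    · rw [eq_zero_of_mem_annFilt hD0 hv]
      simp
    refine ⟨fun k hk hD => ?_, fun k hk l hl hD => ?_⟩
    · by_cases hkn : k + 1 < n
      · exact odd_low_mem hkn (by omega) hv
      refine mem_annFilt_of (by omega) (forall_mem_negIdx.2 ⟨fun i j hij hij2 => ?_, fun i hi => ?_⟩)
      · have h1 := (ih _ _ (h.anti_sub_mem hij2 hv)).1 k hk (by push_cast at hD; omega)
        have h2 : negOp a χ (.inl (i, j)) (a k v) = a k (anti a i j v - χ i j • v) +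
            (antiForm (2 * n) c k j • a i v + antiForm (2 * n) c k i • a j v) := by
          simp only [negOp, LinearMap.sub_apply, LinearMap.smul_apply, Module.End.one_apply,
            map_sub, map_smul]
          rw [h.rel.anti_apply (by omega) (by omega) hk]; abel
        rw [h2]
        refine add_mem (annFilt_mono ?_ h1) (add_mem ?_ ?_)
        · simp only [negDeg]; linarith
        · refine antiForm_smul_mem fun e => annFilt_mono ?_
            ((ih _ _ hv).1 i (by omega) (by push_cast at hD; omega))
          simp only [negDeg]; omega
        · refine antiForm_smul_mem fun e => annFilt_mono ?_
            ((ih _ _ hv).1 j (by omega) (by push_cast at hD; omega))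
          simp only [negDeg]; omega
      · have h1 := (ih _ _ (odd_low_mem (show i + 1 < n by omega) le_rfl hv)).1 k hk
          (by push_cast at hD; omega)
        rw [negOp, apply_apply_eq]
        refine add_mem (neg_mem (annFilt_mono ?_ h1)) (annFilt_mono ?_
          ((ih _ _ hv).2 i (by omega) k hk (by push_cast at hD; omega)))
        · simp only [negDeg]; linarith
        · simp only [negDeg]; linarith
    · by_cases hkl : k + l + 2 ≤ 2 * n
      · have h1 := h.anti_sub_mem hkl hv
        rw [← sub_add_cancel (anti a k l v) (χ k l • v)]
        refine add_mem (annFilt_mono (by omega) h1) ?_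
        by_cases hkl2 : k + l + 2 < 2 * n
        · rw [h.char_zero k l hkl2, zero_smul]; exact zero_mem _
        · exact Submodule.smul_mem _ _ (annFilt_mono (by omega) hv)
      refine mem_annFilt_of (by omega) (forall_mem_negIdx.2 ⟨fun i j hij hij2 => ?_, fun i hi => ?_⟩)
      · have h1 := (ih _ _ (h.anti_sub_mem hij2 hv)).2 k hk l hl (by push_cast at hD; omega)
        have h2 : negOp a χ (.inl (i, j)) (anti a k l v) = anti a k l (anti a i j v - χ i j • v) +
            (antiForm (2 * n) c k j • anti a i l v + antiForm (2 * n) c k i • anti a j l v +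
        antiForm (2 * n) c l j • anti a k i v + antiForm (2 * n) c l i • anti a k j v) := by
          simp only [negOp, LinearMap.sub_apply, LinearMap.smul_apply, Module.End.one_apply,
            map_sub, map_smul]
          rw [h.rel.anti_anti_apply (by omega) (by omega) hk hl]; abel
        rw [h2]
        have H : ∀ i' j' : ℕ, i' < 2 * n → j' < 2 * n → i' + j' + (2 * n - 1) = k + l + i + j →
            anti a i' j' v ∈ whFilt n a χ (D + 2 * (k + l) - 2 * (2 * n - 1) + 2 -
              negDeg n (.inl (i, j))) := by
          intro i' j' hi' hj' e
          refine annFilt_mono ?_ ((ih _ _ hv).2 i' hi' j' hj' (by push_cast at hD; omega))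
          simp only [negDeg]; omega
        refine add_mem (annFilt_mono ?_ h1) (add_mem (add_mem (add_mem ?_ ?_) ?_) ?_)
        · simp only [negDeg]; linarith
        all_goals
          exact antiForm_smul_mem fun e => H _ _ (by omega) (by omega) (by omega)
      · have h1 := (ih _ _ (odd_low_mem (show i + 1 < n by omega) le_rfl hv)).2 k hk l hl
          (by push_cast at hD; omega)
        have h4 := h.rel.anti_apply hk hl (show i < 2 * n by omega) v
        rw [← sub_eq_iff_eq_add] at h4
        rw [negOp, ← h4]
        refine sub_mem (annFilt_mono ?_ h1) (add_mem ?_ ?_)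
        · simp only [negDeg]; linarith
        · refine antiForm_smul_mem fun e => annFilt_mono ?_
            ((ih _ _ hv).1 k (by omega) (by push_cast at hD; omega))
          simp only [negDeg]; omega
        · refine antiForm_smul_mem fun e => annFilt_mono ?_
            ((ih _ _ hv).1 l (by omega) (by push_cast at hD; omega))
          simp only [negDeg]; omega

theorem IsWhittaker.odd_mem (h : IsWhittaker n p c a χ) {k : ℕ} (hk : k < 2 * n) {D D' : ℤ}
    (hD : D + 2 * k - (2 * n - 1) + 2 ≤ D') {v : V} (hv : v ∈ whFilt n a χ D) :
    a k v ∈ whFilt n a χ D' :=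
  annFilt_mono hD ((h.raise_aux (D + 2 * k - (2 * n - 1) + 8 * n).toNat D v hv).1 k hk
    (Int.self_le_toNat _))

theorem IsWhittaker.anti_mem (h : IsWhittaker n p c a χ) {k l : ℕ} (hk : k < 2 * n)
    (hl : l < 2 * n) {D D' : ℤ} (hD : D + 2 * (k + l) - 2 * (2 * n - 1) + 2 ≤ D') {v : V}
    (hv : v ∈ whFilt n a χ D) : anti a k l v ∈ whFilt n a χ D' :=
  annFilt_mono hD ((h.raise_aux (D + 2 * (k + l) - 2 * (2 * n - 1) + 8 * n).toNat D v hv).2 k hk l hl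
    (Int.self_le_toNat _))

/-- The order of the root vectors of `n⁻`: by increasing degree, and within a degree along the
triangular shape of the form `χ([x, y])` on the root vectors and their duals. -/
def negKey (n : ℕ) (i : ℕ × ℕ ⊕ ℕ) : ℤ ×ₗ ℤ :=
  toLex (- negDeg n i, Sum.elim (fun x => - (x.1 : ℤ)) (fun _ => 0) i)

theorem negKey_le {i j : ℕ × ℕ ⊕ ℕ} (h : negKey n i ≤ negKey n j) :
    negDeg n j < negDeg n i ∨ negDeg n i = negDeg n j ∧
      Sum.elim (fun x => - (x.1 : ℤ)) (fun _ => 0) i ≤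
        Sum.elim (fun x : ℕ × ℕ => - (x.1 : ℤ)) (fun _ => 0) j := by
  unfold negKey at h
  rw [Prod.Lex.toLex_le_toLex] at h
  rcases h with h | h
  · exact Or.inl (by simpa using h)
  · exact Or.inr ⟨by simpa using h.1, h.2⟩

theorem IsWhittaker.cross (h : IsWhittaker n p c a χ) {i j : ℕ × ℕ ⊕ ℕ}
    (hi : i ∈ negIdx n (n - 1)) (hj : j ∈ negIdx n (n - 1)) (hne : i ≠ j)
    (hle : negKey n i ≤ negKey n j) : ∃ ε : K, ∀ D, ∀ v ∈ whFilt n a χ D,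
      negOp a χ i (dualOp n a j v) - ε • dualOp n a j (negOp a χ i v) ∈
        whFilt n a χ (D + negDeg n j - negDeg n i - 1) := by
  replace hle := negKey_le hle
  rcases i with ⟨i, j'⟩ | i <;> rcases j with ⟨i₀, j₀⟩ | i₀
  · obtain ⟨hi1, hi2⟩ := inl_mem_negIdx.1 hi
    obtain ⟨hj1, hj2⟩ := inl_mem_negIdx.1 hj
    simp only [negDeg, Sum.elim_inl] at hi1 hi2 hj1 hj2 hle ⊢
    have hne' : ¬ (i = i₀ ∧ j' = j₀) := fun e => hne (by rw [e.1, e.2])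
    refine ⟨1, fun D v hv => ?_⟩
    have h2 := h.rel.anti_anti_apply (i := i) (j := j') (k := 2 * n - 1 - i₀) (l := 2 * n - 2 - j₀)
      (by omega) (by omega) (by omega) (by omega) v
    simp only [negOp, dualOp, LinearMap.sub_apply, LinearMap.smul_apply, Module.End.one_apply,
      map_sub, map_smul, one_smul]
    rw [h2, sub_sub_sub_cancel_right, add_sub_cancel_left]
    refine add_mem (add_mem (add_mem ?_ ?_) ?_) ?_ <;>
      exact antiForm_smul_mem fun e => h.anti_low_mem (by omega) (by omega) hv
  · obtain ⟨hi1, hi2⟩ := inl_mem_negIdx.1 hi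
    have hj1 := inr_mem_negIdx.1 hj
    simp only [negDeg, Sum.elim_inl, Sum.elim_inr] at hi1 hi2 hle ⊢
    refine ⟨1, fun D v hv => ?_⟩
    have h2 := h.rel.anti_apply (i := i) (j := j') (k := 2 * n - 2 - i₀)
      (by omega) (by omega) (by omega) v
    simp only [negOp, dualOp, LinearMap.sub_apply, LinearMap.smul_apply, Module.End.one_apply,
      map_sub, map_smul, one_smul]
    rw [h2, sub_sub_sub_cancel_right, add_sub_cancel_left]
    refine add_mem ?_ ?_ <;>
      exact antiForm_smul_mem fun e => odd_low_mem (by omega) (by omega) hv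
  · have hi1 := inr_mem_negIdx.1 hi
    obtain ⟨hj1, hj2⟩ := inl_mem_negIdx.1 hj
    simp only [negDeg, Sum.elim_inl, Sum.elim_inr] at hj1 hj2 hle ⊢
    refine ⟨1, fun D v hv => ?_⟩
    have h2 := h.rel.anti_apply (i := 2 * n - 1 - i₀) (j := 2 * n - 2 - j₀) (k := i)
      (by omega) (by omega) (by omega) v
    simp only [negOp, dualOp, one_smul]
    rw [h2, sub_add_cancel_left]
    refine neg_mem (add_mem ?_ ?_) <;>
      exact antiForm_smul_mem fun e => odd_low_mem (by omega) (by omega) hv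
  · have hi1 := inr_mem_negIdx.1 hi
    have hj1 := inr_mem_negIdx.1 hj
    have hne' : i ≠ i₀ := fun e => hne (by rw [e])
    simp only [negDeg, Sum.elim_inr] at hle ⊢
    refine ⟨-1, fun D v hv => ?_⟩
    simp only [negOp, dualOp]
    rw [apply_apply_eq, neg_one_smul, sub_neg_eq_add, neg_add_cancel_comm]
    exact h.anti_low_mem (by omega) (by omega) hv

theorem IsWhittaker.self (h : IsWhittaker n p c a χ) {i : ℕ × ℕ ⊕ ℕ}
    (hi : i ∈ negIdx n (n - 1)) : ∃ c₀ : K, ∃ ε : K, c₀ ≠ 0 ∧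
      (∀ D, ∀ v ∈ whFilt n a χ D, negOp a χ i (dualOp n a i v) - ε • dualOp n a i (negOp a χ i v)
        - c₀ • v ∈ whFilt n a χ (D - 1)) ∧
        ((ε = 1 ∧ Sum.elim (fun _ => p) (fun _ => 2) i = p) ∨
          Sum.elim (fun _ => p) (fun _ => 2) i = 2) := by
  rcases i with ⟨i, j⟩ | i
  · obtain ⟨hi1, hi2⟩ := inl_mem_negIdx.1 hi
    simp only at hi1 hi2
    have hlow : ∀ D, ∀ v ∈ whFilt n a χ D,
        anti a j (2 * n - 2 - j) v - χ j (2 * n - 2 - j) • v ∈ whFilt n a χ (D - 1) :=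
      fun D v hv => annFilt_mono (by omega) (h.anti_sub_mem (by omega) hv)
    have hck := h.form_ne (2 * n - 1 - i) (by omega)
    have hcχ := h.char_ne j (2 * n - 2 - j) (by omega)
    have e2 : antiForm (2 * n) c (2 * n - 1 - i) i = c (2 * n - 1 - i) := by
      rw [antiForm, if_pos (by omega)]
    have e3 : antiForm (2 * n) c (2 * n - 2 - j) j = 0 := by
      rw [antiForm, if_neg (by omega)]
    have e4 : antiForm (2 * n) c (2 * n - 2 - j) i = 0 := by
      rw [antiForm, if_neg (by omega)]
    have h2 := fun v => h.rel.anti_anti_apply (i := i) (j := j) (k := 2 * n - 1 - i)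
      (l := 2 * n - 2 - j) (by omega) (by omega) (by omega) (by omega) v
    rcases Nat.lt_or_eq_of_le hi1 with hlt | rfl
    · have e1 : antiForm (2 * n) c (2 * n - 1 - i) j = 0 := by
        rw [antiForm, if_neg (by omega)]
      refine ⟨c (2 * n - 1 - i) * χ j (2 * n - 2 - j), 1, mul_ne_zero hck hcχ, fun D v hv => ?_,
        Or.inl ⟨rfl, rfl⟩⟩
      simp only [negOp, dualOp, LinearMap.sub_apply, LinearMap.smul_apply, Module.End.one_apply,
        map_sub, map_smul, one_smul]
      rw [h2, sub_sub_sub_cancel_right, add_sub_cancel_left, e1, e2, e3, e4]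
      simp only [zero_smul, zero_add, add_zero]
      rw [mul_smul, ← smul_sub]
      exact Submodule.smul_mem _ _ (hlow D v hv)
    · refine ⟨2 * (c (2 * n - 1 - i) * χ i (2 * n - 2 - i)), 1,
        mul_ne_zero h.two (mul_ne_zero hck hcχ), fun D v hv => ?_, Or.inl ⟨rfl, rfl⟩⟩
      simp only [negOp, dualOp, LinearMap.sub_apply, LinearMap.smul_apply, Module.End.one_apply,
        map_sub, map_smul, one_smul]
      rw [h2, sub_sub_sub_cancel_right, add_sub_cancel_left, e2, e3]
      simp only [zero_smul, add_zero]
      rw [← two_smul K, mul_smul, mul_smul, ← smul_sub, ← smul_sub]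
      exact Submodule.smul_mem _ _ (Submodule.smul_mem _ _ (hlow D v hv))
  · have hi1 := inr_mem_negIdx.1 hi
    refine ⟨χ i (2 * n - 2 - i), -1, h.char_ne _ _ (by omega), fun D v hv => ?_, Or.inr rfl⟩
    simp only [negOp, dualOp]
    rw [apply_apply_eq, neg_one_smul, sub_neg_eq_add, neg_add_cancel_comm]
    exact annFilt_mono (by omega) (h.anti_sub_mem (by omega) hv)

/-- Engel's theorem for root vectors of `n⁻`, shifted by a functional on `n⁻` that vanishes on all but
the simple root vectors, and on the squares of the odd root vectors involved. -/
theorem exists_whittaker_vectors [IsAlgClosed K] [FiniteDimensional K V] [Nontrivial V]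
    (h : IsParabose (2 * n) c a) (h2 : (2 : K) ≠ 0) {m : ℕ} (hmn : m ≤ n)
    (hsymm : ∀ i j, χ i j = χ j i) (hzero : ∀ i j, i + j + 2 < 2 * n → χ i j = 0)
    (hm : ∀ i < m, χ i i = 0) (hnil : ∀ i j, i + j + 2 ≤ 2 * n → (anti a i j - χ i j • 1) ^ p = 0) :
    (⨅ i ∈ negIdx n m, LinearMap.ker (negOp a χ i)) ≠ ⊥ := by
  have hanti : ∀ (v : V) (r : ℤ), (∀ l ∈ negIdx n m, - negDeg n l < r → negOp a χ l v = 0) →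
      ∀ i j : ℕ, i + j + 2 ≤ 2 * n → χ i j = 0 →
      - (2 * (2 * (n : ℤ) - 1) - 2 * (i + j)) < r → anti a i j v = 0 := by
    intro v r hT i j hij h0 hr
    rcases le_total i j with hle | hle
    · have := hT (.inl (i, j)) (inl_mem_negIdx.2 ⟨hle, hij⟩) (by simpa [negDeg] using hr)
      simpa [negOp, h0] using this
    · have := hT (.inl (j, i)) (inl_mem_negIdx.2 ⟨hle, by simp only; omega⟩)
        (by simp only [negDeg]; linarith)
      rw [anti_comm]
      rw [hsymm] at h0
      simpa [negOp, h0] using this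
  refine exists_common_kernel (negIdx n m) (fun i => - negDeg n i) _
    (forall_mem_negIdx.2 ⟨fun i j _ hij => ⟨p, hnil i j hij⟩, fun i hi => ⟨2 * p, ?_⟩⟩) ?_
  · have h3 := hnil i i (by omega)
    rw [hm i hi, zero_smul, sub_zero, two_smul_sq, smul_pow, smul_eq_zero, ← pow_mul] at h3
    exact h3.resolve_left (pow_ne_zero _ h2)
  rintro (⟨i, j⟩ | i) hi (⟨k, l⟩ | k) hk
  · obtain ⟨hi1, hi2⟩ := inl_mem_negIdx.1 hi
    obtain ⟨hk1, hk2⟩ := inl_mem_negIdx.1 hk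
    simp only at hi1 hi2 hk1 hk2
    refine ⟨1, fun v hv => ?_⟩
    have H := hanti v _ hv
    simp only [negDeg] at H
    have h3 : antiForm (2 * n) c i l • anti a k j v + antiForm (2 * n) c i k • anti a l j v +
        antiForm (2 * n) c j l • anti a i k v + antiForm (2 * n) c j k • anti a i l v ∈
        (⊥ : Submodule K V) := by
      refine add_mem (add_mem (add_mem ?_ ?_) ?_) ?_ <;>
        exact antiForm_smul_mem fun e => (Submodule.mem_bot K).2
          (H _ _ (by omega) (hzero _ _ (by omega)) (by omega))
    rw [Submodule.mem_bot] at h3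
    simp only [negOp, LinearMap.sub_apply, LinearMap.smul_apply, Module.End.one_apply,
      map_sub, map_smul, one_smul]
    rw [h.anti_anti_apply (by omega) (by omega) (by omega) (by omega), h3]
    module
  · obtain ⟨hi1, hi2⟩ := inl_mem_negIdx.1 hi
    have hk1 := inr_mem_negIdx.1 hk
    simp only at hi1 hi2
    refine ⟨1, fun v hv => ?_⟩
    have h3 : antiForm (2 * n) c k j • a i v + antiForm (2 * n) c k i • a j v ∈
        (⊥ : Submodule K V) := by
      refine add_mem ?_ ?_ <;>
        exact antiForm_smul_mem fun e => (Submodule.mem_bot K).2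
          (hv (.inr _) (inr_mem_negIdx.2 (by omega)) (by simp only [negDeg]; omega))
    rw [Submodule.mem_bot] at h3
    simp only [negOp, LinearMap.sub_apply, LinearMap.smul_apply, Module.End.one_apply,
      map_sub, map_smul, one_smul]
    rw [h.anti_apply (by omega) (by omega) (by omega), h3, add_zero]
  · have hi1 := inr_mem_negIdx.1 hi
    obtain ⟨hk1, hk2⟩ := inl_mem_negIdx.1 hk
    simp only at hk1 hk2
    refine ⟨1, fun v hv => ?_⟩
    have h3 : antiForm (2 * n) c i l • a k v + antiForm (2 * n) c i k • a l v ∈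
        (⊥ : Submodule K V) := by
      refine add_mem ?_ ?_ <;>
        exact antiForm_smul_mem fun e => (Submodule.mem_bot K).2
          (hv (.inr _) (inr_mem_negIdx.2 (by omega)) (by simp only [negDeg]; omega))
    rw [Submodule.mem_bot] at h3
    simp only [negOp, LinearMap.sub_apply, LinearMap.smul_apply, Module.End.one_apply,
      map_sub, map_smul, one_smul]
    rw [h.anti_apply (by omega) (by omega) (by omega), h3, add_zero]
  · have hi1 := inr_mem_negIdx.1 hi
    have hk1 := inr_mem_negIdx.1 hk
    refine ⟨-1, fun v hv => ?_⟩
    have H := hanti v _ hv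
    simp only [negDeg] at H
    have h0 : χ k i = 0 := by
      by_cases hki : k = i
      · rw [hki]; exact hm i hi1
      · exact hzero _ _ (by omega)
    rw [negOp, negOp, apply_apply_eq, H k i (by omega) h0 (by omega), add_zero, neg_one_smul]

/-- A nonzero graded module whose `p`-character is regular nilpotent has dimension at least that of a
baby Verma module. The odd simple root vector `a (n - 1)` acts invertibly on the Whittaker vectors and
exchanges their parities, which accounts for one of the factors `2`. -/
theorem IsWhittaker.bvDim_le [IsAlgClosed K] [FiniteDimensional K V] [Nontrivial V]
    [Fact p.Prime] [CharP K p] (h : IsWhittaker n p c a χ) (hn : 1 ≤ n)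
    (s : Module.End K V) (hs : s * s = 1) (hsa : ∀ k < 2 * n, s * a k = - (a k * s)) :
    bvDim p n ≤ Module.finrank K V := by
  have hsa' : ∀ k < 2 * n, ∀ v, s (a k v) = - a k (s v) := fun k hk v => by
    simpa using congrArg (fun f => f v) (hsa k hk)
  have hsq : ∀ i j, i < 2 * n → j < 2 * n → ∀ v, s (anti a i j v) = anti a i j (s v) := by
    intro i j hi hj v
    simp only [anti, LinearMap.add_apply, Module.End.mul_apply, map_add, hsa' _ hi, hsa' _ hj,
      map_neg, neg_neg]
  have hwh := exists_whittaker_vectors (p := p) (m := n - 1) h.rel h.two (by omega) h.char_symm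
    h.char_zero (fun i hi => h.char_zero _ _ (by omega)) h.nil
  set E := ⨅ i ∈ negIdx n (n - 1), LinearMap.ker (negOp a χ i) with hE
  have memE : ∀ v, v ∈ E ↔ ∀ i ∈ negIdx n (n - 1), negOp a χ i v = 0 := by
    intro v; simp [hE, Submodule.mem_iInf]
  have hEG : ∀ v ∈ E, v ∈ whFilt n a χ 0 := fun v hv =>
    mem_annFilt_of le_rfl fun i hi => by rw [(memE v).1 hv i hi]; exact zero_mem _
  have hEs : ∀ v ∈ E, s v ∈ E := by
    intro v hv
    rw [memE] at hv ⊢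
    refine forall_mem_negIdx.2 ⟨fun i j hij hij2 => ?_, fun i hi => ?_⟩
    · have h1 := congrArg s (hv (.inl (i, j)) (inl_mem_negIdx.2 ⟨hij, hij2⟩))
      simp only [negOp, LinearMap.sub_apply, LinearMap.smul_apply, Module.End.one_apply,
        map_sub, map_smul, map_zero] at h1 ⊢
      rw [← hsq i j (by omega) (by omega), h1]
    · have h1 := congrArg s (hv (.inr i) (inr_mem_negIdx.2 hi))
      rw [negOp, hsa' i (by omega), map_zero, neg_eq_zero] at h1
      exact h1
  obtain ⟨μ, w, hw, hw0, hμ⟩ := exists_eigenvector_mem hwh s hEs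
  have hμ0 : μ ≠ 0 := by
    rintro rfl
    rw [zero_smul] at hμ
    have h1 := congrArg (fun f => f w) hs
    simp only [Module.End.mul_apply, hμ, map_zero, Module.End.one_apply] at h1
    exact hw0 h1.symm
  have hqu : ∀ i, i + 1 < n → anti a i (n - 1) w = 0 := by
    intro i hi
    have h1 := (memE w).1 hw (.inl (i, n - 1)) (inl_mem_negIdx.2 ⟨by simp only; omega,
      by simp only; omega⟩)
    simpa [negOp, h.char_zero i (n - 1) (by omega)] using h1
  have hu : a (n - 1) w ∈ E := by
    rw [memE] at hw ⊢
    refine forall_mem_negIdx.2 ⟨fun i j hij hij2 => ?_, fun i hi => ?_⟩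
    · have h1 := congrArg (a (n - 1)) (hw (.inl (i, j)) (inl_mem_negIdx.2 ⟨hij, hij2⟩))
      simp only [negOp, LinearMap.sub_apply, LinearMap.smul_apply, Module.End.one_apply,
        map_sub, map_smul, map_zero] at h1 ⊢
      have h3 : antiForm (2 * n) c (n - 1) j • a i w + antiForm (2 * n) c (n - 1) i • a j w ∈
          (⊥ : Submodule K V) := by
        refine add_mem ?_ ?_ <;>
          exact antiForm_smul_mem fun e => (Submodule.mem_bot K).2
            (hw (.inr _) (inr_mem_negIdx.2 (by omega)))
      rw [Submodule.mem_bot] at h3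
      rw [h.rel.anti_apply (by omega) (by omega) (by omega), h3, add_zero, h1]
    · have h1 := hw (.inr i) (inr_mem_negIdx.2 hi)
      rw [negOp] at h1 ⊢
      rw [apply_apply_eq, h1, hqu i (by omega), map_zero, neg_zero, add_zero]
  have huu : a (n - 1) (a (n - 1) w) ≠ 0 := by
    intro h0
    have h1 := (memE w).1 hw (.inl (n - 1, n - 1)) (inl_mem_negIdx.2 ⟨le_rfl, by simp only; omega⟩)
    simp only [negOp, LinearMap.sub_apply, LinearMap.smul_apply, Module.End.one_apply, anti,
      LinearMap.add_apply, Module.End.mul_apply, h0, add_zero, zero_sub, neg_eq_zero] at h1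
    exact (smul_ne_zero (h.char_ne (n - 1) (n - 1) (by omega)) hw0) h1
  have hu0 : a (n - 1) w ≠ 0 := fun h0 => huu (by rw [h0, map_zero])
  have hlin : LinearIndependent K ![w, a (n - 1) w] := by
    rw [LinearIndependent.pair_iff]
    intro x y hxy
    have h1 := congrArg s hxy
    rw [map_add, map_smul, map_smul, hsa' _ (by omega), hμ, map_smul, map_zero] at h1
    have h3 : (μ * 2 * x) • w = 0 := by
      have : (μ * 2 * x) • w = μ • (x • w + y • a (n - 1) w) +
        (x • μ • w + y • -(μ • a (n - 1) w)) := by module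
      rw [this, hxy, h1, smul_zero, add_zero]
    have hx : x = 0 := by
      have := (smul_eq_zero.1 h3).resolve_right hw0
      exact (mul_eq_zero.1 this).resolve_left (mul_ne_zero hμ0 h.two)
    rw [hx, zero_smul, zero_add] at hxy
    exact ⟨hx, (smul_eq_zero.1 hxy).resolve_right hu0⟩
  have hr0 : ∀ x : Fin 2, ![w, a (n - 1) w] x ∈ E := by
    intro x; fin_cases x
    · exact hw
    · exact hu
  have main := card_mul_prod_le_finrank (G := whFilt n a χ) annFilt_mono p (negIdx n (n - 1))
    (negKey n) (dualOp n a) (negOp a χ) (negDeg n) (Sum.elim (fun _ => p) (fun _ => 2))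
    (forall_mem_negIdx.2 ⟨fun i j hij hij2 D v hv => h.anti_mem (by omega) (by omega)
      (by simp only [negDeg]; omega) hv, fun i hi D v hv => h.odd_mem (by omega)
      (by simp only [negDeg]; omega) hv⟩)
    (fun i hi D v hv => apply_mem_annFilt hi hv)
    (fun i hi j hj hne hle => h.cross hi hj hne hle)
    (fun i hi => h.self hi) ![w, a (n - 1) w] (fun _ => 0) (fun x => hEG _ (hr0 x))
    (fun i hi x => by rw [(memE _).1 (hr0 x) i hi]; exact zero_mem _)
    (by
      intro D x hx hmem
      by_contra hne
      obtain ⟨α, hα⟩ := Function.ne_iff.1 hne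
      have hD : D = 0 := (hx α hα).symm
      rw [hD] at hmem
      have := eq_zero_of_mem_annFilt (by norm_num) hmem
      exact hα (Fintype.linearIndependent_iff.1 hlin x this α))
  rw [prod_negIdx, Fintype.card_fin] at main
  refine le_trans (le_of_eq ?_) main
  obtain ⟨m, rfl⟩ : ∃ m, n = m + 1 := ⟨n - 1, by omega⟩
  rw [bvDim, Nat.add_sub_cancel, pow_succ 2 m]; ring

end LowerBound

/-! ### Jacobson's formula for `p`-th powers -/

section Jacobson

open Polynomial

variable {R : Type*} [Ring R]

theorem choose_pred_prime_cast (p : ℕ) [hp : Fact p.Prime] [CharP R p] (m : ℕ) (hm : m < p) :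
    ((p - 1).choose m : R) = (-1) ^ m := by
  induction m with
  | zero => simp
  | succ m ih =>
    have h1 : p.choose (m + 1) = (p - 1).choose m + (p - 1).choose (m + 1) := by
      obtain ⟨q, hq⟩ : ∃ q, p = q + 1 := ⟨p - 1, by have := hp.1.pos; omega⟩
      subst hq
      exact Nat.choose_succ_succ _ _
    have h2 : ((p.choose (m + 1) : ℕ) : R) = 0 := by
      rw [CharP.cast_eq_zero_iff R p]
      exact hp.1.dvd_choose_self (Nat.succ_ne_zero _) hm
    rw [h1, Nat.cast_add, ih (by omega)] at h2
    rw [pow_succ, mul_neg_one]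
    exact (neg_eq_of_add_eq_zero_right h2).symm

/-- In characteristic `p`, the derivative of `z ↦ z ^ p` in the direction `w` is
`(ad z) ^ (p - 1) w`. -/
theorem sum_pow_mul_pow_eq_ad_pow (p : ℕ) [hp : Fact p.Prime] [CharP R p] (z w : R) :
    ∑ i ∈ Finset.range p, z ^ i * w * z ^ (p - 1 - i) =
      ((LinearMap.mulLeft ℤ z - LinearMap.mulRight ℤ z) ^ (p - 1)) w := by
  have hc : Commute (LinearMap.mulLeft ℤ z) (-LinearMap.mulRight ℤ z) :=
    (LinearMap.commute_mulLeft_right z z).neg_right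
  rw [sub_eq_add_neg, hc.add_pow, LinearMap.sum_apply, Nat.sub_add_cancel hp.1.pos]
  refine Finset.sum_congr rfl fun i hi => ?_
  have hip : i < p := Finset.mem_range.1 hi
  have hsign : ((-1 : R)) ^ (p - 1 - i) * (-1) ^ i = 1 := by
    rw [← pow_add, show p - 1 - i + i = p - 1 by omega]
    have h0 := choose_pred_prime_cast (R := R) p (p - 1) (by omega)
    rw [← h0]; simp
  have h1 : (((p - 1).choose i : ℕ) : Module.End ℤ R) w = (-1) ^ i * w := by
    rw [← choose_pred_prime_cast (R := R) p i hip]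
    simp [Module.End.natCast_apply, nsmul_eq_mul]
  have h2 : ∀ (m : ℕ) (u : R), ((-LinearMap.mulRight ℤ z) ^ m) u = (-1) ^ m * (u * z ^ m) := by
    intro m u
    induction m with
    | zero => simp
    | succ m ih =>
      rw [pow_succ', Module.End.mul_apply, ih]
      simp [pow_succ, mul_assoc]
  rw [Module.End.mul_apply, Module.End.mul_apply, h1, h2, LinearMap.pow_mulLeft,
    LinearMap.mulLeft_apply]
  have h3 : Commute ((-1 : R) ^ (p - 1 - i)) (z ^ i) := (Commute.neg_one_left _).pow_left _
  have h4 : Commute ((-1 : R) ^ i) (z ^ i) := (Commute.neg_one_left _).pow_left _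
  calc z ^ i * w * z ^ (p - 1 - i)
      = ((-1) ^ (p - 1 - i) * (-1) ^ i) * (z ^ i * (w * z ^ (p - 1 - i))) := by
        rw [hsign, one_mul, mul_assoc]
    _ = (-1) ^ (p - 1 - i) * (((-1) ^ i * z ^ i) * (w * z ^ (p - 1 - i))) := by
        simp only [mul_assoc]
    _ = ((-1) ^ (p - 1 - i) * z ^ i) * ((-1) ^ i * (w * z ^ (p - 1 - i))) := by
        rw [h4.eq]; simp only [mul_assoc]
    _ = z ^ i * ((-1) ^ (p - 1 - i) * ((-1) ^ i * w * z ^ (p - 1 - i))) := by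
        rw [h3.eq]; simp only [mul_assoc]

/-- The coefficients of `(ad (x + T y)) ^ m y`, which are Lie polynomials in `x` and `y`. -/
noncomputable def jacobsonCoeff (x y : R) (m i : ℕ) : R :=
  (((LinearMap.mulLeft ℤ (C x + X * C y) - LinearMap.mulRight ℤ (C x + X * C y)) ^ m :
    Module.End ℤ R[X]) (C y)).coeff i

theorem jacobsonCoeff_zero (x y : R) (i : ℕ) :
    jacobsonCoeff x y 0 i = if i = 0 then y else 0 := by
  simp [jacobsonCoeff, coeff_C]

theorem jacobsonCoeff_succ_zero (x y : R) (m : ℕ) : jacobsonCoeff x y (m + 1) 0 =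
    x * jacobsonCoeff x y m 0 - jacobsonCoeff x y m 0 * x := by
  rw [jacobsonCoeff, pow_succ', Module.End.mul_apply]
  simp [jacobsonCoeff]

theorem jacobsonCoeff_succ_succ (x y : R) (m i : ℕ) : jacobsonCoeff x y (m + 1) (i + 1) =
    (x * jacobsonCoeff x y m (i + 1) - jacobsonCoeff x y m (i + 1) * x) +
      (y * jacobsonCoeff x y m i - jacobsonCoeff x y m i * y) := by
  rw [jacobsonCoeff, pow_succ', Module.End.mul_apply]
  set f := ((LinearMap.mulLeft ℤ (C x + X * C y) - LinearMap.mulRight ℤ (C x + X * C y)) ^ m :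
    Module.End ℤ R[X]) (C y) with hf
  have h1 : (X * C y * f).coeff (i + 1) = y * f.coeff i := by
    rw [mul_assoc, coeff_X_mul, coeff_C_mul]
  have h2 : (f * (X * C y)).coeff (i + 1) = f.coeff i * y := by
    rw [← mul_assoc, coeff_mul_C, coeff_mul_X]
  simp only [LinearMap.sub_apply, LinearMap.mulLeft_apply, LinearMap.mulRight_apply, coeff_sub,
    add_mul, mul_add, coeff_add, h1, h2, coeff_C_mul, coeff_mul_C, jacobsonCoeff, ← hf]
  abel

/-- Jacobson's formula. -/
theorem add_pow_prime_eq_jacobson {K : Type*} [Field K] [Algebra K R] (p : ℕ) [hp : Fact p.Prime]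
    [CharP K p] [CharP R p] (x y : R) : (x + y) ^ p = x ^ p + y ^ p +
      ∑ i ∈ Finset.range (p - 1), ((i + 1 : ℕ) : K)⁻¹ • jacobsonCoeff x y (p - 1) i := by
  set z : R[X] := C x + X * C y with hz
  have hdz : derivative z = C y := by simp [hz, derivative_mul]
  have hd : ∀ m : ℕ, derivative (z ^ m) = ∑ i ∈ Finset.range m, z ^ i * C y * z ^ (m - 1 - i) := by
    intro m
    induction m with
    | zero => simp
    | succ m ih =>
      rw [pow_succ, derivative_mul, ih, hdz, Finset.sum_range_succ, Finset.sum_mul]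
      congr 1
      · refine Finset.sum_congr rfl fun i hi => ?_
        have := Finset.mem_range.1 hi
        rw [mul_assoc, ← pow_succ, show m - 1 - i + 1 = m + 1 - 1 - i by omega]
      · simp
  have hcoeff : ∀ i, (z ^ p).coeff (i + 1) * ((i : R) + 1) = jacobsonCoeff x y (p - 1) i := by
    intro i
    rw [← coeff_derivative, hd p, sum_pow_mul_pow_eq_ad_pow, jacobsonCoeff]
  have hdeg : z.natDegree ≤ 1 := by
    refine natDegree_add_le_of_degree_le (by simp) ?_
    rw [X_mul_C]
    exact (natDegree_C_mul_le y X).trans natDegree_X_le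
  have h0 : (z ^ p).coeff 0 = x ^ p := by
    have : ∀ m : ℕ, (z ^ m).coeff 0 = x ^ m := by
      intro m
      induction m with
      | zero => simp
      | succ m ih => rw [pow_succ, mul_coeff_zero, ih, pow_succ]; simp [hz]
    exact this p
  have hlast : (z ^ p).coeff p = y ^ p := by
    have := coeff_pow_of_natDegree_le (m := p) hdeg
    rw [mul_one] at this
    rw [this]
    simp [hz]
  have hone : (x + y) ^ p = ∑ i ∈ Finset.range (p + 1), (z ^ p).coeff i := by
    let φ : R[X] →+* R := eval₂RingHom' (RingHom.id R) 1 (fun _ => Commute.one_right _)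
    have h1 : φ z = x + y := by
      simp [φ, hz]
    have h2 : φ (z ^ p) = ∑ i ∈ Finset.range (p + 1), (z ^ p).coeff i := by
      change eval₂ (RingHom.id R) 1 (z ^ p) = _
      rw [eval₂_eq_sum_range' (RingHom.id R) (n := p + 1)]
      · simp
      · have := natDegree_pow_le_of_le p hdeg
        omega
    rw [← h1, ← map_pow, h2]
  obtain ⟨q, hq⟩ : ∃ q, p = q + 1 := ⟨p - 1, by have := hp.1.pos; omega⟩
  rw [hone, Finset.sum_range_succ, hlast]
  have h5 : ∑ i ∈ Finset.range p, (z ^ p).coeff i =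
      ∑ i ∈ Finset.range (p - 1), (z ^ p).coeff (i + 1) + x ^ p := by
    rw [show Finset.range p = Finset.range (p - 1 + 1) by
      rw [Nat.sub_add_cancel hp.1.pos], Finset.sum_range_succ', h0]
  rw [h5, Finset.sum_congr rfl (g := fun i => ((i + 1 : ℕ) : K)⁻¹ • jacobsonCoeff x y (p - 1) i)]
  · abel
  · intro i hi
    have hi' := Finset.mem_range.1 hi
    have hne : ((i + 1 : ℕ) : K) ≠ 0 := by
      rw [Ne, CharP.cast_eq_zero_iff K p]
      exact Nat.not_dvd_of_pos_of_lt (Nat.succ_pos i) (by omega)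
    rw [eq_inv_smul_iff₀ hne, ← hcoeff i, Nat.cast_smul_eq_nsmul, nsmul_eq_mul]
    push_cast
    exact (Commute.add_left (Nat.cast_commute _ _) (Commute.one_left _)).eq

/-- The failure of a Lie algebra homomorphism to commute with `p`-th powers is additive. -/
theorem map_add_pow_prime {K A B : Type*} [Field K] [Ring A] [Algebra K A] [Ring B] [Algebra K B]
    (p : ℕ) [hp : Fact p.Prime] [CharP K p] [CharP A p] [CharP B p] (L : Submodule K A) (F : A →ₗ[K] B)
    (hL : ∀ x ∈ L, ∀ y ∈ L, x * y - y * x ∈ L)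
    (hF : ∀ x ∈ L, ∀ y ∈ L, F (x * y - y * x) = F x * F y - F y * F x) {x y : A} (hx : x ∈ L)
    (hy : y ∈ L) : (F x + F y) ^ p - F ((x + y) ^ p) =
      (F x ^ p - F (x ^ p)) + (F y ^ p - F (y ^ p)) := by
  have key : ∀ m i, jacobsonCoeff x y m i ∈ L ∧
      F (jacobsonCoeff x y m i) = jacobsonCoeff (F x) (F y) m i := by
    intro m
    induction m with
    | zero =>
      intro i
      rw [jacobsonCoeff_zero, jacobsonCoeff_zero]
      split_ifs
      · exact ⟨hy, rfl⟩
      · exact ⟨zero_mem _, map_zero _⟩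
    | succ m ih =>
      intro i
      cases i with
      | zero =>
        rw [jacobsonCoeff_succ_zero, jacobsonCoeff_succ_zero, hF _ hx _ (ih 0).1, (ih 0).2]
        exact ⟨hL _ hx _ (ih 0).1, rfl⟩
      | succ i =>
        rw [jacobsonCoeff_succ_succ, jacobsonCoeff_succ_succ, map_add, hF _ hx _ (ih _).1,
          hF _ hy _ (ih _).1, (ih _).2, (ih _).2]
        exact ⟨add_mem (hL _ hx _ (ih _).1) (hL _ hy _ (ih _).1), rfl⟩
  rw [add_pow_prime_eq_jacobson (K := K) p x y, add_pow_prime_eq_jacobson (K := K) p (F x) (F y)]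
  simp only [map_add, map_sum, map_smul, (key _ _).2]
  abel

end Jacobson

/-! ### The odd and even parts of `osp(1|2n)` -/

section OddPart

variable {K : Type*} [Field K] {n : ℕ}

/-- The symplectic form on the odd part of the superspace. -/
def symp (K : Type*) [Field K] (n : ℕ) :
    (Fin n ⊕ Fin n → K) →ₗ[K] (Fin n ⊕ Fin n → K) →ₗ[K] K :=
  LinearMap.mk₂ K (fun x y => x ⬝ᵥ (Matrix.J (Fin n) K).mulVec y)
    (by intros; rw [add_dotProduct]) (by intros; rw [smul_dotProduct])
    (by intros; rw [Matrix.mulVec_add, dotProduct_add])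
    (by intros; rw [Matrix.mulVec_smul, dotProduct_smul])

theorem symp_apply (x y : Fin n ⊕ Fin n → K) :
    symp K n x y = x ⬝ᵥ (Matrix.J (Fin n) K).mulVec y := rfl

theorem symp_swap (x y : Fin n ⊕ Fin n → K) : symp K n x y = - symp K n y x := by
  rw [symp_apply, symp_apply, Matrix.dotProduct_mulVec, ← Matrix.mulVec_transpose,
    Matrix.J_transpose, Matrix.neg_mulVec, neg_dotProduct, dotProduct_comm]

theorem J_mulVec_J_mulVec (x : Fin n ⊕ Fin n → K) :
    (Matrix.J (Fin n) K).mulVec ((Matrix.J (Fin n) K).mulVec x) = -x := by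
  rw [Matrix.mulVec_mulVec, Matrix.J_squared, Matrix.neg_mulVec, Matrix.one_mulVec]

/-- The odd element of `osp(1|2n)` attached to a vector `w` of the odd part of the superspace: it maps
`v` to `w` and `y` to `ω(y, w) v`. -/
def oddElt (K : Type*) [Field K] (n : ℕ) :
    (Fin n ⊕ Fin n → K) →ₗ[K] Matrix (Idx n) (Idx n) K where
  toFun w := Matrix.fromBlocks 0 (Matrix.of fun _ j => (Matrix.J (Fin n) K).mulVec w j)
    (Matrix.of fun i _ => w i) 0
  map_add' x y := by
    ext (i | i) (j | j) <;> simp [Matrix.mulVec_add]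
  map_smul' c x := by
    ext (i | i) (j | j) <;> simp [Matrix.mulVec_smul]

/-- The even element `[U_w, U_w'] = U_w U_w' + U_w' U_w` for odd elements `U_w`, `U_w'`. -/
def evenElt (w w' : Fin n ⊕ Fin n → K) : Matrix (Idx n) (Idx n) K :=
  oddElt K n w * oddElt K n w' + oddElt K n w' * oddElt K n w

/-- The `gl(2n)`-block of a matrix. -/
def blk (K : Type*) [Field K] (n : ℕ) :
    Matrix (Idx n) (Idx n) K →ₗ[K] Matrix (Fin n ⊕ Fin n) (Fin n ⊕ Fin n) K where
  toFun x := x.toBlocks₂₂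
  map_add' _ _ := rfl
  map_smul' _ _ := rfl

/-- The column of a matrix that describes the image of `v`. -/
def col (K : Type*) [Field K] (n : ℕ) :
    Matrix (Idx n) (Idx n) K →ₗ[K] (Fin n ⊕ Fin n → K) where
  toFun x := fun i => x (.inr i) (.inl ())
  map_add' _ _ := rfl
  map_smul' _ _ := rfl

theorem col_oddElt (w : Fin n ⊕ Fin n → K) : col K n (oddElt K n w) = w := rfl

theorem blk_oddElt (w : Fin n ⊕ Fin n → K) : blk K n (oddElt K n w) = 0 := rfl

theorem evenElt_eq (w w' : Fin n ⊕ Fin n → K) : evenElt w w' = Matrix.fromBlocks 0 0 0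
    (Matrix.vecMulVec w ((Matrix.J (Fin n) K).mulVec w') +
      Matrix.vecMulVec w' ((Matrix.J (Fin n) K).mulVec w)) := by
  have h := symp_swap w w'
  simp only [symp_apply, dotProduct] at h
  simp only [evenElt, oddElt, LinearMap.coe_mk, AddHom.coe_mk, Matrix.fromBlocks_multiply,
    Matrix.fromBlocks_add]
  congr 1
  · ext i j
    simp only [Matrix.add_apply, Matrix.mul_apply, Matrix.zero_apply, Matrix.of_apply, zero_mul,
      zero_add]
    simp only [mul_comm _ (w' _), mul_comm _ (w _)]
    rw [h]; simp
  · simp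
  · simp
  · ext i j
    simp [Matrix.mul_apply, Matrix.vecMulVec_apply]

theorem blk_evenElt_mulVec (w w' y : Fin n ⊕ Fin n → K) :
    (blk K n (evenElt w w')).mulVec y = symp K n y w' • w + symp K n y w • w' := by
  rw [evenElt_eq]
  change Matrix.mulVec (Matrix.vecMulVec w _ + Matrix.vecMulVec w' _) y = _
  rw [Matrix.add_mulVec, Matrix.vecMulVec_mulVec, Matrix.vecMulVec_mulVec, symp_apply, symp_apply,
    dotProduct_comm y, dotProduct_comm y]
  simp

theorem evenElt_comm (w w' : Fin n ⊕ Fin n → K) : evenElt w w' = evenElt w' w := add_comm _ _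

theorem form_eq (x y : Idx n → K) : form x y =
    x (.inl ()) * y (.inl ()) + symp K n (fun i => x (.inr i)) (fun i => y (.inr i)) := by
  simp only [form, dotProduct, gram, Matrix.mulVec, Fintype.sum_sum_type, Matrix.fromBlocks_apply₁₁,
    Matrix.fromBlocks_apply₁₂, Matrix.fromBlocks_apply₂₁, Matrix.fromBlocks_apply₂₂, symp_apply]
  simp

theorem eq_zero_of_mem_vecPart {x : Idx n → K} {j : ZMod 2} (hx : x ∈ vecPart K (parity n) j) :
    (j = 0 ∧ ∀ i, x (.inr i) = 0) ∨ (j = 1 ∧ x (.inl ()) = 0) := by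
  have h01 : ∀ j : ZMod 2, j = 0 ∨ j = 1 := by decide
  rcases h01 j with rfl | rfl
  · left
    refine ⟨rfl, fun i => ?_⟩
    by_contra h
    have := hx _ h
    simp [parity] at this
  · right
    refine ⟨rfl, ?_⟩
    by_contra h
    have := hx _ h
    simp [parity] at this

theorem oddElt_mulVec (w : Fin n ⊕ Fin n → K) (x : Idx n → K) : (oddElt K n w).mulVec x =
    Sum.elim (fun _ => symp K n (fun i => x (.inr i)) w) (fun i => x (.inl ()) * w i) := by
  funext i
  rcases i with i | i
  · simp [oddElt, Matrix.mulVec, dotProduct, symp_apply, mul_comm]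
  · simp [oddElt, Matrix.mulVec, dotProduct, mul_comm]

theorem oddElt_mem (w : Fin n ⊕ Fin n → K) : oddElt K n w ∈ ospPart K n 1 := by
  refine ⟨?_, fun j x y hx => ?_⟩
  · rintro (i | i) (j | j) h <;> simp [oddElt] at h <;> simp [parity]
    decide
  · rw [form_eq, form_eq, oddElt_mulVec, oddElt_mulVec]
    simp only [Sum.elim_inl, Sum.elim_inr]
    have e1 : (fun i => x (.inl ()) * w i) = x (.inl ()) • w := rfl
    have e2 : (fun i => y (.inl ()) * w i) = y (.inl ()) • w := rfl
    rw [e1, e2]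
    rcases eq_zero_of_mem_vecPart hx with ⟨rfl, h⟩ | ⟨rfl, h⟩
    · have e3 : (fun i => x (.inr i)) = 0 := by ext i; exact h i
      rw [e3]
      simp only [map_zero, LinearMap.zero_apply, map_smul, LinearMap.smul_apply, smul_eq_mul,
        superSign]
      rw [symp_swap w]
      simp
    · rw [h]
      simp only [map_zero, zero_smul, LinearMap.zero_apply, map_smul, smul_eq_mul,
        superSign]
      simp
      ring

theorem eq_oddElt {x : Matrix (Idx n) (Idx n) K} (hx : x ∈ ospPart K n 1) :
    x = oddElt K n (col K n x) := by
  have hp := hx.1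
  ext (i | i) (j | j)
  · have : x (.inl i) (.inl j) = 0 := by
      by_contra h
      have := hp _ _ h
      simp [parity] at this
    simp [oddElt, this]
  · have h := hx.2 0 (Pi.single (.inl ()) 1) (Pi.single (.inr j) 1) (by
      intro a ha
      have : a = .inl () := by by_contra hne; simp [hne] at ha
      rw [this]; rfl)
    rw [form_eq, form_eq] at h
    simp only [Matrix.mulVec_single_one] at h
    have e1 : (fun i : Fin n ⊕ Fin n => (Pi.single (Sum.inl ()) 1 : Idx n → K) (.inr i)) = 0 := by
      ext i; simp
    have e2 : (fun i : Fin n ⊕ Fin n => (Pi.single (Sum.inr j) 1 : Idx n → K) (.inr i)) =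
        Pi.single j 1 := by
      ext i; simp [Pi.single_apply]
    rw [e1, e2, symp_swap, symp_apply] at h
    simp [superSign] at h
    simp only [oddElt, LinearMap.coe_mk, AddHom.coe_mk, Matrix.fromBlocks_apply₁₂, Matrix.of_apply]
    exact h.symm
  · rfl
  · have : x (.inr i) (.inr j) = 0 := by
      by_contra h
      have := hp _ _ h
      simp [parity] at this
    simp [oddElt, this]

theorem evenElt_mem (w w' : Fin n ⊕ Fin n → K) : evenElt w w' ∈ ospPart K n 0 := by
  have := superBracket_mem_ospPart 1 1 _ _ (oddElt_mem (K := K) w) (oddElt_mem w')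
  have h : (1 + 1 : ZMod 2) = 0 := by decide
  rw [h] at this
  simpa [superBracket, superSign, evenElt] using this

theorem even_apply_eq_zero {x : Matrix (Idx n) (Idx n) K} (hx : x ∈ ospPart K n 0)
    (h2 : (2 : K) ≠ 0) :
    x (.inl ()) (.inl ()) = 0 ∧ (∀ i, x (.inl ()) (.inr i) = 0) ∧ ∀ i, x (.inr i) (.inl ()) = 0 := by
  refine ⟨?_, fun i => ?_, fun i => ?_⟩
  · have h := (diagonal_mem_ospPart hx).2 0 (Pi.single (.inl ()) 1) (Pi.single (.inl ()) 1) (by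
      intro a ha
      have : a = .inl () := by by_contra hne; simp [hne] at ha
      rw [this]; rfl)
    rw [form_eq, form_eq] at h
    have e1 : (fun i : Fin n ⊕ Fin n => (Pi.single (Sum.inl ()) 1 : Idx n → K) (.inr i)) = 0 := by
      ext i; simp
    rw [e1] at h
    simp only [map_zero, LinearMap.zero_apply, superSign] at h
    simp at h
    have h3 : (2 : K) * x (.inl ()) (.inl ()) = 0 := by linear_combination h
    exact (mul_eq_zero.1 h3).resolve_left h2
  · by_contra h
    have := hx.1 _ _ h
    simp [parity] at this
  · by_contra h
    have := hx.1 _ _ h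
    simp [parity] at this

theorem even_eq_fromBlocks {x : Matrix (Idx n) (Idx n) K} (hx : x ∈ ospPart K n 0)
    (h2 : (2 : K) ≠ 0) : x = Matrix.fromBlocks 0 0 0 (blk K n x) := by
  obtain ⟨h1, h3, h4⟩ := even_apply_eq_zero hx h2
  ext (i | i) (j | j)
  · simpa using h1
  · simpa using h3 j
  · simpa using h4 i
  · rfl

theorem symp_blk {x : Matrix (Idx n) (Idx n) K} (hx : x ∈ ospPart K n 0)
    (u w : Fin n ⊕ Fin n → K) :
    symp K n ((blk K n x).mulVec u) w = - symp K n u ((blk K n x).mulVec w) := by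
  have h := hx.2 1 (Sum.elim 0 u) (Sum.elim 0 w) (by
    rintro (a | a) ha
    · simp at ha
    · rfl)
  rw [form_eq, form_eq] at h
  have e : ∀ u : Fin n ⊕ Fin n → K, (fun i => x.mulVec (Sum.elim 0 u) (.inr i)) =
      (blk K n x).mulVec u := by
    intro u
    ext i
    simp [Matrix.mulVec, dotProduct, blk, Matrix.toBlocks₂₂]
  simp only [e] at h
  simpa [superSign] using h

/-- The even part of `osp(1|2n)` acts on the odd part as on the symplectic space. -/
theorem even_mul_oddElt {x : Matrix (Idx n) (Idx n) K} (hx : x ∈ ospPart K n 0) (h2 : (2 : K) ≠ 0)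
    (w : Fin n ⊕ Fin n → K) :
    x * oddElt K n w - oddElt K n w * x = oddElt K n ((blk K n x).mulVec w) := by
  have h := superBracket_mem_ospPart 0 1 _ _ hx (oddElt_mem (K := K) w)
  rw [zero_add] at h
  have h1 : x * oddElt K n w - oddElt K n w * x ∈ ospPart K n 1 := by
    simpa [superBracket, superSign] using h
  rw [eq_oddElt h1]
  congr 1
  ext i
  obtain ⟨-, -, h5⟩ := even_apply_eq_zero hx h2
  change (x * oddElt K n w - oddElt K n w * x) (.inr i) (.inl ()) = _
  rw [Matrix.sub_apply, Matrix.mul_apply, Matrix.mul_apply]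
  simp [oddElt, h5, (even_apply_eq_zero hx h2).1, blk, Matrix.mulVec, dotProduct, Matrix.toBlocks₂₂]

theorem even_mul_evenElt {x : Matrix (Idx n) (Idx n) K} (hx : x ∈ ospPart K n 0) (h2 : (2 : K) ≠ 0)
    (w w' : Fin n ⊕ Fin n → K) : x * evenElt w w' - evenElt w w' * x =
      evenElt ((blk K n x).mulVec w) w' + evenElt w ((blk K n x).mulVec w') := by
  unfold evenElt
  rw [← even_mul_oddElt hx h2, ← even_mul_oddElt hx h2]
  noncomm_ring

/-- The resolution of the identity of the symplectic space by a pair of dual bases. -/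
theorem sum_symp_smul_single (y : Fin n ⊕ Fin n → K) :
    ∑ k, symp K n y (-(Matrix.J (Fin n) K).mulVec (Pi.single k 1)) • Pi.single k (1 : K) = y := by
  have h : ∀ k, symp K n y (-(Matrix.J (Fin n) K).mulVec (Pi.single k 1)) = y k := by
    intro k
    rw [symp_apply, Matrix.mulVec_neg, J_mulVec_J_mulVec, neg_neg, dotProduct_single_one]
  simp only [h]
  ext i
  simp [Finset.sum_apply, Pi.single_apply]

theorem sum_symp_smul_dual (y : Fin n ⊕ Fin n → K) :
    ∑ k, symp K n y (Pi.single k 1) • -(Matrix.J (Fin n) K).mulVec (Pi.single k (1 : K)) = -y := by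
  have h := sum_symp_smul_single (-(Matrix.J (Fin n) K).mulVec y)
  have h1 : ∀ k, symp K n (-(Matrix.J (Fin n) K).mulVec y)
      (-(Matrix.J (Fin n) K).mulVec (Pi.single k 1)) = symp K n y (Pi.single k 1) := by
    intro k
    rw [map_neg, map_neg, LinearMap.neg_apply, neg_neg, symp_swap y, symp_apply, symp_apply,
      J_mulVec_J_mulVec, dotProduct_neg, dotProduct_single_one, single_one_dotProduct]
  simp only [h1] at h
  have h3 := congrArg (fun z => -(Matrix.J (Fin n) K).mulVec z) h
  simp only [Matrix.mulVec_neg, J_mulVec_J_mulVec, neg_neg] at h3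
  rw [← h3, Matrix.mulVec_sum, ← Finset.sum_neg_distrib]
  refine Finset.sum_congr rfl fun k _ => ?_
  rw [Matrix.mulVec_smul, smul_neg]

/-- An even element is recovered from its action on the symplectic space. -/
theorem two_smul_even_eq {x : Matrix (Idx n) (Idx n) K} (hx : x ∈ ospPart K n 0) (h2 : (2 : K) ≠ 0) :
    (2 : K) • x = ∑ k, evenElt ((blk K n x).mulVec (Pi.single k 1))
      (-(Matrix.J (Fin n) K).mulVec (Pi.single k 1)) := by
  have h3 : ∑ k, evenElt ((blk K n x).mulVec (Pi.single k 1))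
      (-(Matrix.J (Fin n) K).mulVec (Pi.single k 1)) ∈ ospPart K n 0 :=
    sum_mem fun k _ => evenElt_mem _ _
  rw [even_eq_fromBlocks h3 h2, even_eq_fromBlocks ((ospPart K n 0).smul_mem 2 hx) h2]
  congr 1
  refine Matrix.toLin'.injective (LinearMap.ext fun y => ?_)
  rw [Matrix.toLin'_apply, Matrix.toLin'_apply, map_sum, Matrix.sum_mulVec, map_smul,
    Matrix.smul_mulVec]
  simp only [blk_evenElt_mulVec]
  rw [Finset.sum_add_distrib]
  have e1 : ∑ k, symp K n y (-(Matrix.J (Fin n) K).mulVec (Pi.single k 1)) •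
      (blk K n x).mulVec (Pi.single k (1 : K)) = (blk K n x).mulVec y := by
    conv_rhs => rw [← sum_symp_smul_single y, Matrix.mulVec_sum]
    simp only [Matrix.mulVec_smul]
  have e2 : ∑ k, symp K n y ((blk K n x).mulVec (Pi.single k 1)) •
      -(Matrix.J (Fin n) K).mulVec (Pi.single k (1 : K)) = (blk K n x).mulVec y := by
    have := sum_symp_smul_dual ((blk K n x).mulVec y)
    rw [← neg_inj, ← this, ← Finset.sum_neg_distrib]
    refine Finset.sum_congr rfl fun k _ => ?_
    rw [symp_blk hx, neg_smul]
  rw [e1, e2, two_smul]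

theorem evenElt_add_self (w w' : Fin n ⊕ Fin n → K) :
    evenElt (w + w') (w + w') = evenElt w w + evenElt w' w' + (2 : K) • evenElt w w' := by
  simp only [evenElt, map_add, two_smul]
  noncomm_ring

/-- The even part is spanned by the squares of odd elements. -/
theorem even_mem_span (h2 : (2 : K) ≠ 0) {x : Matrix (Idx n) (Idx n) K} (hx : x ∈ ospPart K n 0) :
    x ∈ Submodule.span K (Set.range fun w : Fin n ⊕ Fin n → K => evenElt w w) := by
  have h1 : ∀ w w' : Fin n ⊕ Fin n → K,
      evenElt w w' ∈ Submodule.span K (Set.range fun w : Fin n ⊕ Fin n → K => evenElt w w) := by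
    intro w w'
    have h3 : evenElt w w' =
        (2 : K)⁻¹ • (evenElt (w + w') (w + w') - evenElt w w - evenElt w' w') := by
      rw [eq_inv_smul_iff₀ h2, evenElt_add_self]; abel
    rw [h3]
    exact Submodule.smul_mem _ _ (sub_mem (sub_mem (Submodule.subset_span ⟨_, rfl⟩)
      (Submodule.subset_span ⟨_, rfl⟩)) (Submodule.subset_span ⟨_, rfl⟩))
  have h4 : x = (2 : K)⁻¹ • ((2 : K) • x) := by rw [inv_smul_smul₀ h2]
  rw [h4, two_smul_even_eq hx h2]
  exact Submodule.smul_mem _ _ (sum_mem fun k _ => h1 _ _)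

theorem evenElt_mul_self {w w' : Fin n ⊕ Fin n → K} (h : symp K n w w' = 0) (h2 : (2 : K) ≠ 0) :
    evenElt w w' * evenElt w w' = 0 := by
  have hs : ∀ w, symp K n w w = 0 := by
    intro w
    have := symp_swap w w
    have h3 : (2 : K) * symp K n w w = 0 := by linear_combination this
    exact (mul_eq_zero.1 h3).resolve_left h2
  have h3 : blk K n (evenElt w w') * blk K n (evenElt w w') = 0 := by
    refine Matrix.toLin'.injective (LinearMap.ext fun y => ?_)
    rw [Matrix.toLin'_apply, ← Matrix.mulVec_mulVec, blk_evenElt_mulVec, blk_evenElt_mulVec]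
    simp [hs, h, symp_swap w' w]
  rw [even_eq_fromBlocks (evenElt_mem w w') h2, Matrix.fromBlocks_multiply]
  simp [h3]

end OddPart

/-! ### Paraboson presentation of `U_χ(osp(1|2n))` -/

section Gen

variable {K : Type*} [Field K] {ι : Type*} [Fintype ι] [DecidableEq ι] {π : ι → ZMod 2} {p : ℕ}

theorem RedEnv.lift_gen (S : RestrictedLie K π p) (χ : S.part 0 →ₗ[K] K)
    {A : Type*} [Ring A] [Algebra K A] (f : S.carrier →ₗ[K] A)
    (hf : ∀ i j x y, f (S.incl i x) * f (S.incl j y) =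
      superSign K i j • (f (S.incl j y) * f (S.incl i x))
        + f (S.incl (i + j) (S.bracket i j x y)))
    (hp : ∀ x, f (S.incl 0 x) ^ p - f (S.incl 0 (S.pmap x)) = algebraMap K A (χ x ^ p))
    (x : S.carrier) : RedEnv.lift S χ f hf hp (RedEnv.gen S χ x) = f x := by
  have h := RingQuot.liftAlgHom_mkAlgHom_apply K (Env.lift S f hf) (s := RedRel S χ) (by
      rintro _ _ ⟨x⟩
      rw [map_sub, map_pow, Env.lift_gen, Env.lift_gen, AlgHom.commutes]
      exact hp x) (Env.gen S x)
  rw [Env.lift_gen] at h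
  exact h

theorem RedEnv.adjoin_gen (S : RestrictedLie K π p) (χ : S.part 0 →ₗ[K] K) :
    Algebra.adjoin K (Set.range (RedEnv.gen S χ)) = ⊤ := by
  let q : TensorAlgebra K S.carrier →ₐ[K] RedEnv S χ :=
    (RingQuot.mkAlgHom K (RedRel S χ)).comp (RingQuot.mkAlgHom K (EnvRel S))
  have hq : Function.Surjective q :=
    (RingQuot.mkAlgHom_surjective K (RedRel S χ)).comp (RingQuot.mkAlgHom_surjective K (EnvRel S))
  have h1 : (Algebra.adjoin K (Set.range (TensorAlgebra.ι K (M := S.carrier)))).map q = q.range := by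
    rw [TensorAlgebra.adjoin_range_ι, Algebra.map_top]
  rw [AlgHom.map_adjoin, (AlgHom.range_eq_top q).2 hq, ← Set.range_comp] at h1
  exact h1

/-- A property of elements of `U_χ(s)` that defines a subalgebra holds once it holds on `s`. -/
theorem RedEnv.mem_of_gen_mem {S : RestrictedLie K π p} {χ : S.part 0 →ₗ[K] K}
    (T : Subalgebra K (RedEnv S χ)) (h : ∀ x, RedEnv.gen S χ x ∈ T) (u : RedEnv S χ) : u ∈ T := by
  have h1 : Algebra.adjoin K (Set.range (RedEnv.gen S χ)) ≤ T :=
    Algebra.adjoin_le (by rintro _ ⟨x, rfl⟩; exact h x)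
  rw [RedEnv.adjoin_gen] at h1
  exact h1 Algebra.mem_top

end Gen

section Para

variable {K : Type*} [Field K] {n p : ℕ} [Fact p.Prime] [CharP K p]

/-- The generators of `U_χ(osp(1|2n))` attached to the odd elements of `osp(1|2n)`. -/
noncomputable def oddGen (χ : (osp K n p).part 0 →ₗ[K] K) :
    (Fin n ⊕ Fin n → K) →ₗ[K] RedEnv (osp K n p) χ :=
  RedEnv.gen (osp K n p) χ ∘ₗ (osp K n p).incl 1 ∘ₗ
    (oddElt K n).codRestrict ((osp K n p).part 1) (fun w => oddElt_mem w)

/-- The image in `U_χ(osp(1|2n))` of an even element. -/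
noncomputable def evenGen (χ : (osp K n p).part 0 →ₗ[K] K) :
    (osp K n p).part 0 →ₗ[K] RedEnv (osp K n p) χ :=
  RedEnv.gen (osp K n p) χ ∘ₗ (osp K n p).incl 0

variable (χ : (osp K n p).part 0 →ₗ[K] K)

theorem incl_eq {i j : ZMod 2} (x : (osp K n p).part i) (y : (osp K n p).part j) (h : x.1 = y.1) :
    (osp K n p).incl i x = (osp K n p).incl j y := Subtype.ext h

/-- `U_w ^ 2` and more generally the anticommutators of odd elements are even elements. -/
theorem oddGen_anti (w w' : Fin n ⊕ Fin n → K) :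
    oddGen χ w * oddGen χ w' + oddGen χ w' * oddGen χ w = evenGen χ ⟨evenElt w w', evenElt_mem w w'⟩ := by
  have h := RedEnv.gen_comm (osp K n p) χ 1 1 ⟨oddElt K n w, oddElt_mem w⟩
    ⟨oddElt K n w', oddElt_mem w'⟩
  rw [incl_eq ((osp K n p).bracket 1 1 ⟨oddElt K n w, oddElt_mem w⟩ ⟨oddElt K n w', oddElt_mem w'⟩)
    (⟨evenElt w w', evenElt_mem w w'⟩ : (osp K n p).part 0)
    (by simp [RestrictedLie.bracket, superBracket, superSign, evenElt])] at h
  have h1 : oddGen χ w * oddGen χ w' = superSign K 1 1 • (oddGen χ w' * oddGen χ w) +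
    evenGen χ ⟨evenElt w w', evenElt_mem w w'⟩ := h
  rw [h1]
  simp [superSign]

theorem evenGen_comm (h2 : (2 : K) ≠ 0) (x : (osp K n p).part 0) (w : Fin n ⊕ Fin n → K) :
    evenGen χ x * oddGen χ w - oddGen χ w * evenGen χ x = oddGen χ ((blk K n x.1).mulVec w) := by
  have h := RedEnv.gen_comm (osp K n p) χ 0 1 x ⟨oddElt K n w, oddElt_mem w⟩
  rw [incl_eq ((osp K n p).bracket 0 1 x ⟨oddElt K n w, oddElt_mem w⟩)
    (⟨oddElt K n ((blk K n x.1).mulVec w), oddElt_mem _⟩ : (osp K n p).part 1)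
    (by
      have := even_mul_oddElt x.2 h2 w
      simpa [RestrictedLie.bracket, superBracket, superSign] using this)] at h
  have h1 : evenGen χ x * oddGen χ w = superSign K 0 1 • (oddGen χ w * evenGen χ x) +
    oddGen χ ((blk K n x.1).mulVec w) := h
  rw [h1]
  simp [superSign]

theorem evenGen_pow (x : (osp K n p).part 0) :
    evenGen χ x ^ p - evenGen χ ((osp K n p).pmap x) = algebraMap K _ (χ x ^ p) :=
  RedEnv.gen_pow (osp K n p) χ x

theorem pmap_evenElt (h2 : (2 : K) ≠ 0) {w w' : Fin n ⊕ Fin n → K} (h : symp K n w w' = 0) :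
    (osp K n p).pmap ⟨evenElt w w', evenElt_mem w w'⟩ = 0 := by
  apply Subtype.ext
  change evenElt w w' ^ p = 0
  obtain ⟨q, hq⟩ := Nat.exists_eq_add_of_le (Fact.out : p.Prime).two_le
  rw [hq, pow_add, pow_two, evenElt_mul_self h h2, zero_mul]

theorem symp_self (h2 : (2 : K) ≠ 0) (w : Fin n ⊕ Fin n → K) : symp K n w w = 0 := by
  have := symp_swap w w
  have h3 : (2 : K) * symp K n w w = 0 := by linear_combination this
  exact (mul_eq_zero.1 h3).resolve_left h2

/-- A linear map from the symplectic space to an algebra that satisfies the paraboson relations,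
together with the `p`-th power relations for the squares of odd elements. -/
structure IsParaHom {B : Type*} [Ring B] [Algebra K B] (a : (Fin n ⊕ Fin n → K) →ₗ[K] B) : Prop where
  rel : ∀ w w' z, (a w * a w' + a w' * a w) * a z - a z * (a w * a w' + a w' * a w) =
    symp K n z w' • a w + symp K n z w • a w'
  pow : ∀ w, ((2 : K) • (a w * a w)) ^ p = algebraMap K B (χ ⟨evenElt w w, evenElt_mem w w⟩ ^ p)

theorem isParaHom_oddGen (h2 : (2 : K) ≠ 0) : IsParaHom χ (oddGen χ) where
  rel w w' z := by
    rw [oddGen_anti, evenGen_comm χ h2, blk_evenElt_mulVec, map_add, map_smul, map_smul]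
  pow w := by
    rw [two_smul, oddGen_anti, ← evenGen_pow, pmap_evenElt h2 (symp_self h2 w), map_zero, sub_zero]

variable {χ}

/-- Extension of paraboson operators to a linear map on all matrices, whose restriction to
`osp(1|2n)` is a homomorphism of Lie superalgebras. -/
noncomputable def paraExt {B : Type*} [Ring B] [Algebra K B] (a : (Fin n ⊕ Fin n → K) →ₗ[K] B) :
    Matrix (Idx n) (Idx n) K →ₗ[K] B where
  toFun x := (2 : K)⁻¹ • ∑ k, (a ((blk K n x).mulVec (Pi.single k 1)) *
      a (-(Matrix.J (Fin n) K).mulVec (Pi.single k 1)) +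
      a (-(Matrix.J (Fin n) K).mulVec (Pi.single k 1)) *
        a ((blk K n x).mulVec (Pi.single k 1))) + a (col K n x)
  map_add' x y := by
    simp only [map_add, Matrix.add_mulVec, add_mul, mul_add, Finset.sum_add_distrib, smul_add]
    abel
  map_smul' c x := by
    simp only [map_smul, Matrix.smul_mulVec, smul_mul_assoc, mul_smul_comm, ← smul_add,
      ← Finset.smul_sum, RingHom.id_apply]
    rw [smul_comm (2 : K)⁻¹ c, ← smul_add]

section Ext

variable {B : Type*} [Ring B] [Algebra K B] {a : (Fin n ⊕ Fin n → K) →ₗ[K] B}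

theorem paraExt_oddElt (w : Fin n ⊕ Fin n → K) : paraExt a (oddElt K n w) = a w := by
  simp only [paraExt, LinearMap.coe_mk, AddHom.coe_mk, blk_oddElt, col_oddElt, Matrix.zero_mulVec,
    map_zero, zero_mul, mul_zero, add_zero, Finset.sum_const_zero, smul_zero, zero_add]

theorem col_even (h2 : (2 : K) ≠ 0) {x : Matrix (Idx n) (Idx n) K} (hx : x ∈ ospPart K n 0) :
    col K n x = 0 := by
  ext i
  exact (even_apply_eq_zero hx h2).2.2 i

theorem paraExt_comm (h : IsParaHom χ a) (h2 : (2 : K) ≠ 0) {x : Matrix (Idx n) (Idx n) K}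
    (hx : x ∈ ospPart K n 0) (z : Fin n ⊕ Fin n → K) :
    paraExt a x * a z - a z * paraExt a x = a ((blk K n x).mulVec z) := by
  simp only [paraExt, LinearMap.coe_mk, AddHom.coe_mk, col_even h2 hx, map_zero, add_zero]
  rw [smul_mul_assoc, mul_smul_comm, ← smul_sub, Finset.sum_mul, Finset.mul_sum,
    ← Finset.sum_sub_distrib, inv_smul_eq_iff₀ h2]
  simp only [h.rel]
  rw [Finset.sum_add_distrib, two_smul]
  congr 1
  · have := congrArg (fun y => a ((blk K n x).mulVec y)) (sum_symp_smul_single z)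
    simp only [Matrix.mulVec_sum, Matrix.mulVec_smul, map_sum, map_smul] at this
    exact this
  · have := congrArg a (sum_symp_smul_dual ((blk K n x).mulVec z))
    simp only [map_sum, map_smul, symp_blk hx] at this
    rw [map_neg, ← neg_inj] at this
    simpa using this

theorem paraExt_evenElt (h2 : (2 : K) ≠ 0) (w w' : Fin n ⊕ Fin n → K) :
    paraExt a (evenElt w w') = a w * a w' + a w' * a w := by
  simp only [paraExt, LinearMap.coe_mk, AddHom.coe_mk, col_even h2 (evenElt_mem w w'), map_zero,
    add_zero, blk_evenElt_mulVec, map_add, map_smul]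
  have key : ∀ w : Fin n ⊕ Fin n → K, ∑ k, symp K n (Pi.single k 1) w •
      a (-(Matrix.J (Fin n) K).mulVec (Pi.single k 1)) = a w := by
    intro w
    have := congrArg a (sum_symp_smul_dual w)
    simp only [map_sum, map_smul] at this
    rw [map_neg, ← neg_inj, neg_neg, ← Finset.sum_neg_distrib] at this
    rw [← this]
    refine Finset.sum_congr rfl fun k _ => ?_
    rw [symp_swap, neg_smul]
  have e1 : ∀ k, (symp K n (Pi.single k 1) w' • a w + symp K n (Pi.single k 1) w • a w') *
      a (-(Matrix.J (Fin n) K).mulVec (Pi.single k 1)) +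
      a (-(Matrix.J (Fin n) K).mulVec (Pi.single k 1)) *
        (symp K n (Pi.single k 1) w' • a w + symp K n (Pi.single k 1) w • a w') =
      (a w * (symp K n (Pi.single k 1) w' • a (-(Matrix.J (Fin n) K).mulVec (Pi.single k 1))) +
      (symp K n (Pi.single k 1) w' • a (-(Matrix.J (Fin n) K).mulVec (Pi.single k 1))) * a w) +
      (a w' * (symp K n (Pi.single k 1) w • a (-(Matrix.J (Fin n) K).mulVec (Pi.single k 1))) +
      (symp K n (Pi.single k 1) w • a (-(Matrix.J (Fin n) K).mulVec (Pi.single k 1))) * a w') := by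
    intro k
    simp only [add_mul, mul_add, smul_mul_assoc, mul_smul_comm]
    abel
  simp only [e1]
  simp only [Finset.sum_add_distrib, ← Finset.mul_sum, ← Finset.sum_mul, key]
  rw [inv_smul_eq_iff₀ h2, two_smul]
  abel

theorem paraExt_lie (h : IsParaHom χ a) (h2 : (2 : K) ≠ 0) {x y : Matrix (Idx n) (Idx n) K}
    (hx : x ∈ ospPart K n 0) (hy : y ∈ ospPart K n 0) :
    paraExt a (x * y - y * x) = paraExt a x * paraExt a y - paraExt a y * paraExt a x := by
  have hy' := even_mem_span h2 hy
  clear hy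
  induction hy' using Submodule.span_induction with
  | mem y hy =>
    obtain ⟨w, rfl⟩ := hy
    rw [even_mul_evenElt hx h2, map_add, paraExt_evenElt h2, paraExt_evenElt h2,
      paraExt_evenElt h2, ← paraExt_comm h h2 hx]
    noncomm_ring
  | zero => simp
  | add y z _ _ h1 h3 =>
    rw [mul_add, add_mul, add_sub_add_comm, map_add, h1, h3, map_add]
    noncomm_ring
  | smul c y _ h1 =>
    rw [mul_smul_comm, smul_mul_assoc, ← smul_sub, map_smul, h1, map_smul, mul_smul_comm,
      smul_mul_assoc, smul_sub]

theorem even_lie_mem {x y : Matrix (Idx n) (Idx n) K}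
    (hx : x ∈ ospPart K n 0) (hy : y ∈ ospPart K n 0) : x * y - y * x ∈ ospPart K n 0 := by
  have := superBracket_mem_ospPart 0 0 x y hx hy
  simpa [superBracket, superSign] using this

theorem paraExt_pow (h : IsParaHom χ a) (h2 : (2 : K) ≠ 0) (x : (osp K n p).part 0) :
    paraExt a x.1 ^ p - paraExt a (x.1 ^ p) = algebraMap K B (χ x ^ p) := by
  rcases subsingleton_or_nontrivial B with hB | hB
  · exact Subsingleton.elim _ _
  have : CharP B p := charP_of_injective_algebraMap (algebraMap K B).injective p
  have hp0 : p ≠ 0 := (Fact.out : p.Prime).ne_zero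
  obtain ⟨x, hx⟩ := x
  have hx' := even_mem_span h2 hx
  have key : ∃ hx : x ∈ ospPart K n 0, paraExt a x ^ p - paraExt a (x ^ p) =
      algebraMap K B (χ ⟨x, hx⟩ ^ p) := by
    clear hx
    induction hx' using Submodule.span_induction with
    | mem y hy =>
      obtain ⟨w, rfl⟩ := hy
      refine ⟨evenElt_mem w w, ?_⟩
      have h1 : evenElt w w ^ p = 0 := congrArg Subtype.val (pmap_evenElt (p := p) h2 (symp_self h2 w))
      simp only [h1, map_zero, sub_zero]
      rw [paraExt_evenElt h2, ← two_smul K, h.pow w]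
    | zero =>
      refine ⟨zero_mem _, ?_⟩
      have : (⟨0, zero_mem _⟩ : (osp K n p).part 0) = 0 := rfl
      rw [this]
      simp [hp0]
    | add y z _ _ h1 h3 =>
      obtain ⟨hy, h1⟩ := h1
      obtain ⟨hz, h3⟩ := h3
      refine ⟨add_mem hy hz, ?_⟩
      have := map_add_pow_prime p (ospPart K n 0) (paraExt a) (fun x hx y hy => even_lie_mem hx hy)
        (fun x hx y hy => paraExt_lie h h2 hx hy) hy hz
      rw [map_add, this, h1, h3, ← map_add, ← add_pow_char]
      congr 2
      exact (map_add χ ⟨y, hy⟩ ⟨z, hz⟩).symm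
    | smul c y _ h1 =>
      obtain ⟨hy, h1⟩ := h1
      refine ⟨Submodule.smul_mem _ c hy, ?_⟩
      have : χ ⟨c • y, Submodule.smul_mem _ c hy⟩ = c * χ ⟨y, hy⟩ := map_smul χ c ⟨y, hy⟩
      rw [this, map_smul, smul_pow, smul_pow, map_smul, ← smul_sub, h1, mul_pow,
        Algebra.smul_def, map_mul]
  exact key.2

/-- Paraboson operators extend to an algebra homomorphism from `U_χ(osp(1|2n))`. -/
theorem IsParaHom.exists_algHom (h : IsParaHom χ a) (h2 : (2 : K) ≠ 0) :
    ∃ φ : RedEnv (osp K n p) χ →ₐ[K] B, ∀ w, φ (oddGen χ w) = a w := by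
  have h11 : (1 + 1 : ZMod 2) = 0 := by decide
  have hodd : ∀ x : (osp K n p).part 1, x.1 = oddElt K n (col K n x.1) := fun x => eq_oddElt x.2
  refine ⟨RedEnv.lift (osp K n p) χ (paraExt a ∘ₗ (osp K n p).carrier.subtype) ?_ ?_, fun w => ?_⟩
  · have h01 : ∀ j : ZMod 2, j = 0 ∨ j = 1 := by decide
    intro i j x y
    change paraExt a x.1 * paraExt a y.1 = superSign K i j • (paraExt a y.1 * paraExt a x.1) +
      paraExt a (x.1 * y.1 - superSign K i j • (y.1 * x.1))
    rcases h01 i with rfl | rfl <;> rcases h01 j with rfl | rfl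
    · have := paraExt_lie h h2 x.2 y.2
      simp only [superSign]
      simp [this]
    · rw [hodd y, paraExt_oddElt]
      have h1 := paraExt_comm h h2 x.2 (col K n y.1)
      have h3 := even_mul_oddElt x.2 h2 (col K n y.1)
      have h4 : superSign K 0 1 = 1 := by simp [superSign]
      rw [h4, one_smul, one_smul, h3, paraExt_oddElt, ← h1]
      abel
    · rw [hodd x, paraExt_oddElt]
      have h1 := paraExt_comm h h2 y.2 (col K n x.1)
      have h3 := even_mul_oddElt y.2 h2 (col K n x.1)
      have h4 : superSign K 1 0 = 1 := by simp [superSign]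
      rw [h4, one_smul, one_smul, ← neg_sub, h3, map_neg, paraExt_oddElt, ← h1]
      abel
    · rw [hodd x, hodd y, paraExt_oddElt, paraExt_oddElt]
      have h4 : superSign K 1 1 = -1 := by simp [superSign]
      have h5 : oddElt K n (col K n x.1) * oddElt K n (col K n y.1) -
          (-1 : K) • (oddElt K n (col K n y.1) * oddElt K n (col K n x.1)) =
          evenElt (col K n x.1) (col K n y.1) := by
        rw [evenElt]; simp
      rw [h4, h5, paraExt_evenElt h2]
      simp
  · intro x
    exact paraExt_pow h h2 x
  · exact (RedEnv.lift_gen (osp K n p) χ _ _ _ _).trans (paraExt_oddElt w)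

end Ext

/-- `U_χ(osp(1|2n))` is generated by the odd elements. -/
theorem mem_of_oddGen_mem (h2 : (2 : K) ≠ 0) (T : Subalgebra K (RedEnv (osp K n p) χ))
    (h : ∀ w, oddGen χ w ∈ T) (u : RedEnv (osp K n p) χ) : u ∈ T := by
  refine RedEnv.mem_of_gen_mem T (fun x => ?_) u
  obtain ⟨x, hx⟩ := x
  obtain ⟨y, hy, z, hz, rfl⟩ := Submodule.mem_sup.1 hx
  have h1 : RedEnv.gen (osp K n p) χ ⟨y + z, hx⟩ = evenGen χ ⟨y, hy⟩ + oddGen χ (col K n z) := by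
    have : (⟨y + z, hx⟩ : (osp K n p).carrier) = (osp K n p).incl 0 ⟨y, hy⟩ +
        (osp K n p).incl 1 ⟨oddElt K n (col K n z), oddElt_mem _⟩ := by
      apply Subtype.ext
      change y + z = y + oddElt K n (col K n z)
      rw [← eq_oddElt hz]
    rw [this, map_add]
    rfl
  rw [h1]
  refine add_mem ?_ (h _)
  have h3 : (2 : K) • evenGen χ ⟨y, hy⟩ ∈ T := by
    have h4 : (2 : K) • (⟨y, hy⟩ : (osp K n p).part 0) =
        ∑ k, ⟨evenElt ((blk K n y).mulVec (Pi.single k 1))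
          (-(Matrix.J (Fin n) K).mulVec (Pi.single k 1)), evenElt_mem _ _⟩ := by
      apply Subtype.ext
      rw [Submodule.coe_sum]
      exact two_smul_even_eq hy h2
    rw [← map_smul, h4, map_sum]
    refine sum_mem fun k _ => ?_
    rw [← oddGen_anti]
    exact add_mem (mul_mem (h _) (h _)) (mul_mem (h _) (h _))
  rw [← inv_smul_smul₀ h2 (evenGen χ ⟨y, hy⟩)]
  exact T.smul_mem h3 _

end Para

/-! ### The symplectic basis attached to a triangular decomposition -/

section Basis

variable {K : Type*} [Field K] {n : ℕ}

/-- The position of a basis vector in the order `f_0, …, f_{n-1}, e_{n-1}, …, e_0`. -/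
def pos : Fin n ⊕ Fin n → ℕ
  | .inl i => 2 * n - 1 - i
  | .inr i => i

/-- The basis vector in a given position. -/
def stdVec (K : Type*) [Field K] (n : ℕ) (k : ℕ) : Fin n ⊕ Fin n → K :=
  fun a => if pos a = k then 1 else 0

theorem pos_lt (a : Fin n ⊕ Fin n) : pos a < 2 * n := by
  rcases a with a | a <;> simp only [pos] <;> have := a.2 <;> omega

theorem pos_injective : Function.Injective (pos (n := n)) := by
  rintro (a | a) (b | b) h <;> simp only [pos] at h <;> have h1 := a.2 <;> have h2 := b.2
  · have : a = b := by ext; omega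
    rw [this]
  · omega
  · omega
  · have : a = b := by ext; omega
    rw [this]

theorem stdVec_pos (a : Fin n ⊕ Fin n) : stdVec K n (pos a) = Pi.single a 1 := by
  ext b
  simp [stdVec, Pi.single_apply, pos_injective.eq_iff]

theorem exists_pos {k : ℕ} (hk : k < 2 * n) : ∃ a : Fin n ⊕ Fin n, pos a = k := by
  by_cases h : k < n
  · exact ⟨.inr ⟨k, h⟩, rfl⟩
  · exact ⟨.inl ⟨2 * n - 1 - k, by omega⟩, by simp only [pos]; omega⟩

theorem stdVec_ne {k : ℕ} {a : Fin n ⊕ Fin n} (h : stdVec K n k a ≠ 0) : pos a = k := by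
  by_contra h1
  simp [stdVec, h1] at h

/-- The values of the symplectic form on pairs of dual vectors of the basis. -/
def stdSign (K : Type*) [Field K] (n : ℕ) (k : ℕ) : K := if k < n then 1 else -1

theorem stdSign_ne_zero (k : ℕ) : stdSign K n k ≠ 0 := by
  unfold stdSign; split_ifs <;> simp

theorem J_mulVec_inl (x : Fin n ⊕ Fin n → K) (i : Fin n) :
    (Matrix.J (Fin n) K).mulVec x (.inl i) = - x (.inr i) := by
  simp [Matrix.J, Matrix.mulVec, dotProduct, Matrix.neg_apply, Matrix.one_apply]

theorem J_mulVec_inr (x : Fin n ⊕ Fin n → K) (i : Fin n) :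
    (Matrix.J (Fin n) K).mulVec x (.inr i) = x (.inl i) := by
  simp [Matrix.J, Matrix.mulVec, dotProduct, Matrix.one_apply]

theorem J_stdVec {l : ℕ} (hl : l < 2 * n) :
    (Matrix.J (Fin n) K).mulVec (stdVec K n l) = (-stdSign K n l) • stdVec K n (2 * n - 1 - l) := by
  ext (a | a)
  · have e1 : stdVec K n l (.inr a) = if (a : ℕ) = l then 1 else 0 := rfl
    have e2 : stdVec K n (2 * n - 1 - l) (.inl a) =
      if 2 * n - 1 - (a : ℕ) = 2 * n - 1 - l then 1 else 0 := rfl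
    rw [J_mulVec_inl, Pi.smul_apply, smul_eq_mul, e1, e2, stdSign]
    have := a.2
    by_cases h : (a : ℕ) = l
    · rw [if_pos h, if_pos (by omega), if_pos (by omega)]; ring
    · rw [if_neg h, if_neg (show ¬ (2 * n - 1 - (a : ℕ) = 2 * n - 1 - l) by omega)]; ring
  · have e1 : stdVec K n l (.inl a) = if 2 * n - 1 - (a : ℕ) = l then 1 else 0 := rfl
    have e2 : stdVec K n (2 * n - 1 - l) (.inr a) =
      if (a : ℕ) = 2 * n - 1 - l then 1 else 0 := rfl
    rw [J_mulVec_inr, Pi.smul_apply, smul_eq_mul, e1, e2, stdSign]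
    have := a.2
    by_cases h : 2 * n - 1 - (a : ℕ) = l
    · rw [if_pos h, if_neg (by omega), if_pos (by omega)]; ring
    · rw [if_neg h, if_neg (show ¬ ((a : ℕ) = 2 * n - 1 - l) by omega)]; ring

theorem symp_stdVec {k j : ℕ} (hk : k < 2 * n) (hj : j < 2 * n) :
    symp K n (stdVec K n k) (stdVec K n j) = antiForm (2 * n) (stdSign K n) k j := by
  obtain ⟨a, rfl⟩ := exists_pos hk
  rw [symp_apply, J_stdVec hj, stdVec_pos, single_one_dotProduct]
  simp only [Pi.smul_apply, smul_eq_mul, antiForm, stdVec, stdSign]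
  by_cases h : pos a + j + 1 = 2 * n
  · rw [if_pos h, if_pos (show pos a = 2 * n - 1 - j by omega)]
    by_cases h1 : j < n
    · rw [if_pos h1, if_neg (show ¬ pos a < n by omega)]; simp
    · rw [if_neg h1, if_pos (show pos a < n by omega)]; simp
  · rw [if_neg h, if_neg (show ¬ pos a = 2 * n - 1 - j by omega)]; ring

theorem sum_smul_stdVec (u : Fin n ⊕ Fin n → K) : u = ∑ a, u a • stdVec K n (pos a) := by
  ext b
  simp [stdVec_pos, Finset.sum_apply, Pi.single_apply]

variable (P : Matrix.symplecticGroup (Fin n) K)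

/-- The vectors of the symplectic basis formed by the columns of `P`, in the order of `stdVec`. -/
def bvec (k : ℕ) : Fin n ⊕ Fin n → K :=
  (P : Matrix (Fin n ⊕ Fin n) (Fin n ⊕ Fin n) K).mulVec (stdVec K n k)

theorem symp_mulVec (u w : Fin n ⊕ Fin n → K) :
    symp K n ((P : Matrix (Fin n ⊕ Fin n) (Fin n ⊕ Fin n) K).mulVec u)
      ((P : Matrix (Fin n ⊕ Fin n) (Fin n ⊕ Fin n) K).mulVec w) = symp K n u w := by
  have h := SymplecticGroup.mem_iff'.1 P.2
  rw [symp_apply, symp_apply, Matrix.mulVec_mulVec, ← Matrix.vecMul_transpose,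
    ← Matrix.dotProduct_mulVec, Matrix.mulVec_mulVec, ← Matrix.mul_assoc, h]

theorem symp_bvec {k j : ℕ} (hk : k < 2 * n) (hj : j < 2 * n) :
    symp K n (bvec P k) (bvec P j) = antiForm (2 * n) (stdSign K n) k j := by
  rw [bvec, bvec, symp_mulVec, symp_stdVec hk hj]

theorem mul_inv_mulVec (u : Fin n ⊕ Fin n → K) :
    (P : Matrix (Fin n ⊕ Fin n) (Fin n ⊕ Fin n) K).mulVec
      ((P⁻¹ : Matrix.symplecticGroup (Fin n) K) |>.1.mulVec u) = u := by
  have h : (P : Matrix (Fin n ⊕ Fin n) (Fin n ⊕ Fin n) K) *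
      (P⁻¹ : Matrix.symplecticGroup (Fin n) K).1 = 1 := congrArg Subtype.val (mul_inv_cancel P)
  rw [Matrix.mulVec_mulVec, h, Matrix.one_mulVec]

theorem exists_eq_sum_bvec (w : Fin n ⊕ Fin n → K) :
    ∃ u : Fin n ⊕ Fin n → K, w = ∑ a, u a • bvec P (pos a) := by
  refine ⟨(P⁻¹ : Matrix.symplecticGroup (Fin n) K).1.mulVec w, ?_⟩
  conv_lhs => rw [← mul_inv_mulVec P w,
    sum_smul_stdVec ((P⁻¹ : Matrix.symplecticGroup (Fin n) K).1.mulVec w), Matrix.mulVec_sum]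
  simp only [Matrix.mulVec_smul, bvec]

theorem conj_oddElt (u : Fin n ⊕ Fin n → K) :
    conj P (oddElt K n ((P : Matrix (Fin n ⊕ Fin n) (Fin n ⊕ Fin n) K).mulVec u)) = oddElt K n u := by
  have h1 := eq_oddElt (conj_mem_ospPart P⁻¹ (oddElt_mem (K := K) u))
  have h2 : col K n (conj P⁻¹ (oddElt K n u)) =
      (P : Matrix (Fin n ⊕ Fin n) (Fin n ⊕ Fin n) K).mulVec u := by
    ext i
    rw [conj_apply, inv_inv]
    change (block P * oddElt K n u * block P⁻¹) (.inr i) (.inl ()) = _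
    simp [block, oddElt, Matrix.fromBlocks_multiply, Matrix.mul_apply, Matrix.mulVec, dotProduct]
  rw [h2] at h1
  rw [← h1, conj_conj_inv]

theorem conj_evenElt (u w : Fin n ⊕ Fin n → K) :
    conj P (evenElt ((P : Matrix (Fin n ⊕ Fin n) (Fin n ⊕ Fin n) K).mulVec u)
      ((P : Matrix (Fin n ⊕ Fin n) (Fin n ⊕ Fin n) K).mulVec w)) = evenElt u w := by
  rw [evenElt, map_add, map_mul, map_mul, conj_oddElt, conj_oddElt, evenElt]

theorem wt_lt_iff (a b : Fin n ⊕ Fin n) : wt n (.inr a) < wt n (.inr b) ↔ pos a < pos b := by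
  rcases a with a | a <;> rcases b with b | b <;> simp only [wt, pos] <;> have h1 := a.2 <;>
    have h2 := b.2 <;> omega

theorem wt_pos_iff (a : Fin n ⊕ Fin n) : 0 < wt n (.inr a) ↔ n ≤ pos a := by
  rcases a with a | a <;> simp only [wt, pos] <;> have h1 := a.2 <;> omega

theorem wt_neg_iff (a : Fin n ⊕ Fin n) : wt n (.inr a) < 0 ↔ pos a < n := by
  rcases a with a | a <;> simp only [wt, pos] <;> have h1 := a.2 <;> omega

theorem oddElt_bvec_mem {k : ℕ} (hk : n ≤ k) (hk2 : k < 2 * n) :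
    oddElt K n (bvec P k) ∈ nilPart P 1 := by
  refine ⟨oddElt_mem _, ?_⟩
  change conj P (oddElt K n (bvec P k)) ∈ strictUpper K n
  rw [bvec, conj_oddElt]
  rintro (i | i) (j | j) h <;> simp only [oddElt, LinearMap.coe_mk, AddHom.coe_mk,
    Matrix.fromBlocks_apply₁₁, Matrix.fromBlocks_apply₁₂, Matrix.fromBlocks_apply₂₁,
    Matrix.fromBlocks_apply₂₂, Matrix.of_apply, Matrix.zero_apply, ne_eq, not_true_eq_false] at h
  · rw [J_stdVec hk2] at h
    have := stdVec_ne (right_ne_zero_of_mul h)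
    exact (wt_neg_iff j).2 (by omega)
  · have := stdVec_ne h
    exact (wt_pos_iff i).2 (by omega)

/-- The nonzero entries of the even element attached to two vectors of the standard basis. -/
theorem evenElt_stdVec_ne {k l : ℕ} (hk : k < 2 * n) (hl : l < 2 * n) {x y : Idx n}
    (h : evenElt (stdVec K n k) (stdVec K n l) x y ≠ 0) : ∃ a b, x = .inr a ∧ y = .inr b ∧
      pos a + 2 * n = pos b + k + l + 1 := by
  rw [evenElt_eq] at h
  rcases x with x | a <;> rcases y with y | b <;> simp only [
    Matrix.fromBlocks_apply₁₁, Matrix.fromBlocks_apply₁₂, Matrix.fromBlocks_apply₂₁,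
    Matrix.fromBlocks_apply₂₂, Matrix.zero_apply, ne_eq, not_true_eq_false] at h
  refine ⟨a, b, rfl, rfl, ?_⟩
  rw [J_stdVec hk, J_stdVec hl, Matrix.add_apply, Matrix.vecMulVec_apply, Matrix.vecMulVec_apply] at h
  by_cases h0 : stdVec K n k a * ((-stdSign K n l) • stdVec K n (2 * n - 1 - l)) b = 0
  · rw [h0, zero_add] at h
    have h1 := stdVec_ne (left_ne_zero_of_mul h)
    have h2 := stdVec_ne (right_ne_zero_of_mul (right_ne_zero_of_mul h))
    omega
  · have h1 := stdVec_ne (left_ne_zero_of_mul h0)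
    have h2 := stdVec_ne (right_ne_zero_of_mul (right_ne_zero_of_mul h0))
    omega

theorem evenElt_bvec_mem_nilPart {k l : ℕ} (hk : k < 2 * n) (hl : l < 2 * n) (hkl : 2 * n ≤ k + l) :
    evenElt (bvec P k) (bvec P l) ∈ nilPart P 0 := by
  refine ⟨evenElt_mem _ _, ?_⟩
  change conj P (evenElt (bvec P k) (bvec P l)) ∈ strictUpper K n
  rw [bvec, bvec, conj_evenElt]
  intro x y h
  obtain ⟨a, b, rfl, rfl, hab⟩ := evenElt_stdVec_ne hk hl h
  exact (wt_lt_iff b a).2 (by omega)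

theorem evenElt_bvec_mem_cartan (p : ℕ) [Fact p.Prime] [CharP K p] {k l : ℕ} (hkl : k + l + 1 = 2 * n) :
    evenElt (bvec P k) (bvec P l) ∈ (cartan p P).part 0 := by
  refine ⟨evenElt_mem _ _, ?_⟩
  change conj P (evenElt (bvec P k) (bvec P l)) ∈ diagonals K n
  rw [bvec, bvec, conj_evenElt, mem_diagonals]
  ext x y
  by_cases hxy : x = y
  · rw [hxy]; simp
  · rw [Matrix.diagonal_apply_ne _ hxy]
    by_contra h
    obtain ⟨a, b, rfl, rfl, hab⟩ := evenElt_stdVec_ne (by omega) (by omega) (Ne.symm h)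
    exact hxy (congrArg _ (pos_injective (by omega)))

/-- The even elements `x` for which `conj P x` satisfies a triangularity condition are spanned by the
elements attached to pairs of vectors of the basis for which the condition holds. -/
theorem mem_span_evenElt_bvec (h2 : (2 : K) ≠ 0) {x : Matrix (Idx n) (Idx n) K} (hx : x ∈ ospPart K n 0)
    {R : ℕ → ℕ → Prop} (hR : ∀ a b : Fin n ⊕ Fin n, conj P x (.inr a) (.inr b) ≠ 0 → R (pos a) (pos b)) :
    x ∈ Submodule.span K {y | ∃ k l, k < 2 * n ∧ l < 2 * n ∧ R k l ∧
      y = evenElt (bvec P k) (bvec P (2 * n - 1 - l))} := by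
  have h1 : x = (2 : K)⁻¹ • conj P⁻¹ ((2 : K) • conj P x) := by
    rw [map_smul, conj_inv_conj, inv_smul_smul₀ h2]
  have hc : ∀ u w : Fin n ⊕ Fin n → K, conj P⁻¹ (evenElt u w) =
      evenElt ((P : Matrix (Fin n ⊕ Fin n) (Fin n ⊕ Fin n) K).mulVec u)
      ((P : Matrix (Fin n ⊕ Fin n) (Fin n ⊕ Fin n) K).mulVec w) := by
    intro u w
    rw [← conj_evenElt P u w, conj_inv_conj]
  rw [h1, two_smul_even_eq (conj_mem_ospPart P hx) h2, map_sum]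
  refine Submodule.smul_mem _ _ (sum_mem fun b _ => ?_)
  rw [hc, ← stdVec_pos, J_stdVec (pos_lt b), sum_smul_stdVec
    ((blk K n (conj P x)).mulVec (stdVec K n (pos b))), Matrix.mulVec_sum]
  simp only [Matrix.mulVec_smul, neg_smul, neg_neg]
  have e1 : ∀ (c : Fin n ⊕ Fin n → K) (f : Fin n ⊕ Fin n → Fin n ⊕ Fin n → K) (d : K)
      (w : Fin n ⊕ Fin n → K), evenElt (∑ a, c a • f a) (d • w) = ∑ a, (c a * d) • evenElt (f a) w := by
    intro c f d w
    simp only [evenElt, map_sum, map_smul, Finset.sum_mul, Finset.mul_sum, smul_mul_assoc,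
      mul_smul_comm, smul_smul, smul_add, Finset.sum_add_distrib]
    simp only [Finset.smul_sum, smul_smul, mul_comm d]
  rw [e1]
  refine sum_mem fun a _ => ?_
  by_cases h0 : (blk K n (conj P x)).mulVec (stdVec K n (pos b)) a = 0
  · rw [h0, zero_mul, zero_smul]; exact zero_mem _
  · refine Submodule.smul_mem _ _ (Submodule.subset_span ⟨pos a, pos b, pos_lt a, pos_lt b, hR a b ?_, rfl⟩)
    rw [stdVec_pos, Matrix.mulVec_single_one] at h0
    exact h0

end Basis

/-! ### Highest weight vectors and baby Verma modules -/

section Map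

variable {K : Type*} [Field K] {ι : Type*} [Fintype ι] [DecidableEq ι] {π : ι → ZMod 2} {p : ℕ}

theorem RedEnv.map_gen (S T : RestrictedLie K π p) (hST : ∀ i, S.part i ≤ T.part i)
    (χ : T.part 0 →ₗ[K] K) (x : S.carrier) : RedEnv.map S T hST χ (RedEnv.gen S _ x) =
      RedEnv.gen T χ (Submodule.inclusion (sup_le_sup (hST 0) (hST 1)) x) :=
  RedEnv.lift_gen S _ _ _ _ x

end Map

section Linear

variable {K : Type*} [Field K] {n p : ℕ} [Fact p.Prime] [CharP K p]
  {χ : (osp K n p).part 0 →ₗ[K] K}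

theorem IsParaHom.comp {B C : Type*} [Ring B] [Algebra K B] [Ring C] [Algebra K C]
    {a : (Fin n ⊕ Fin n → K) →ₗ[K] B} (h : IsParaHom χ a) (φ : B →ₐ[K] C) :
    IsParaHom χ (φ.toLinearMap ∘ₗ a) where
  rel w w' z := by simpa using congrArg φ (h.rel w w' z)
  pow w := by simpa using congrArg φ (h.pow w)

/-- On a family of vectors whose Gram matrix is antidiagonal, the paraboson relations take the
form of `IsParabose`. -/
theorem IsParaHom.isParabose {M : Type*} [AddCommGroup M] [Module K M]
    {a : (Fin n ⊕ Fin n → K) →ₗ[K] Module.End K M} (h : IsParaHom χ a) {N : ℕ} {c : ℕ → K}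
    {b : ℕ → Fin n ⊕ Fin n → K}
    (hb : ∀ k j, k < N → j < N → symp K n (b k) (b j) = antiForm N c k j) :
    IsParabose N c (fun k => a (b k)) := by
  intro i j k hi hj hk
  simp only [anti]
  rw [h.rel, hb k j hk hj, hb k i hk hi]

theorem IsParaHom.neg {B : Type*} [Ring B] [Algebra K B]
    {a : (Fin n ⊕ Fin n → K) →ₗ[K] B} (h : IsParaHom χ a) : IsParaHom χ (-a) where
  rel w w' z := by
    have := h.rel w w' z
    simp only [LinearMap.neg_apply, mul_neg, neg_mul, neg_neg, smul_neg]
    rw [← neg_add, ← this]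
    abel
  pow w := by simpa using h.pow w

/-- An algebra homomorphism which agrees with given paraboson operators on odd elements agrees
with their anticommutators on even elements. -/
theorem algHom_evenGen {B : Type*} [Ring B] [Algebra K B] (φ : RedEnv (osp K n p) χ →ₐ[K] B)
    (w w' : Fin n ⊕ Fin n → K) : φ (evenGen χ ⟨evenElt w w', evenElt_mem w w'⟩) =
      φ (oddGen χ w) * φ (oddGen χ w') + φ (oddGen χ w') * φ (oddGen χ w) := by
  rw [← oddGen_anti, map_add, map_mul, map_mul]

theorem exists_evenElt_mem_span (h2 : (2 : K) ≠ 0) (x : (osp K n p).part 0) :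
    x ∈ Submodule.span K {y : (osp K n p).part 0 | ∃ w, y = ⟨evenElt w w, evenElt_mem w w⟩} := by
  have h1 := even_mem_span h2 x.2
  have h3 : ((osp K n p).part 0).subtype '' {y : (osp K n p).part 0 |
      ∃ w, y = ⟨evenElt w w, evenElt_mem w w⟩} = {y | ∃ w, y = evenElt w w} := by
    ext y
    constructor
    · rintro ⟨_, ⟨w, rfl⟩, rfl⟩; exact ⟨w, rfl⟩
    · rintro ⟨w, rfl⟩; exact ⟨⟨evenElt w w, evenElt_mem w w⟩, ⟨w, rfl⟩, rfl⟩
  have h4 : x.1 ∈ (Submodule.span K {y : (osp K n p).part 0 |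
      ∃ w, y = ⟨evenElt w w, evenElt_mem w w⟩}).map ((osp K n p).part 0).subtype := by
    rw [Submodule.map_span, h3]
    rw [show {y : Matrix (Idx n) (Idx n) K | ∃ w, y = evenElt w w} =
      Set.range fun w => evenElt w w from Set.ext fun y => by simp [eq_comm]]
    exact h1
  obtain ⟨y, hy, hyx⟩ := h4
  rwa [← show y = x from Subtype.ext hyx]

end Linear

section HighestWeight

variable {K : Type*} [Field K] {n p : ℕ} [Fact p.Prime] [CharP K p]
  {χ : (osp K n p).part 0 →ₗ[K] K} (P : Matrix.symplecticGroup (Fin n) K)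
  {M : Type*} [AddCommGroup M] [Module K M]

/-- A vector of weight `l` annihilated by `n⁺` in a representation `ρ` of `U_χ(osp(1|2n))`; it is
enough to require annihilation by the elements of `n⁺` attached to the basis. The vector may be
zero. -/
structure IsHW (ρ : RedEnv (osp K n p) χ →ₐ[K] Module.End K M) (v : M)
    (l : (cartan p P).part 0 →ₗ[K] K) : Prop where
  odd : ∀ k, n ≤ k → k < 2 * n → ρ (oddGen χ (bvec P k)) v = 0
  even : ∀ k j, k < 2 * n → j < 2 * n → 2 * n ≤ k + j →
    ρ (evenGen χ ⟨evenElt (bvec P k) (bvec P j), evenElt_mem _ _⟩) v = 0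
  cartan : ∀ h : (cartan p P).part 0,
    ρ (evenGen χ (Submodule.inclusion (cartan_le_osp p P 0) h)) v = l h • v

variable {P} {ρ : RedEnv (osp K n p) χ →ₐ[K] Module.End K M} {v : M}
    {l : (SuperLie.cartan p P).part 0 →ₗ[K] K}

/-- A linear condition on even elements of `n⁺` can be tested on the basis. -/
theorem nil_even_induction (h2 : (2 : K) ≠ 0) {T : Submodule K ((osp K n p).part 0)}
    (hT : ∀ k j, k < 2 * n → j < 2 * n → 2 * n ≤ k + j →
      ⟨evenElt (bvec P k) (bvec P j), evenElt_mem _ _⟩ ∈ T)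
    (x : (osp K n p).part 0) (hx : x.1 ∈ nilPart P 0) : x ∈ T := by
  have h1 := mem_span_evenElt_bvec P h2 x.2 (R := fun k l => l < k)
    (fun a b hab => (wt_lt_iff b a).1 (hx.2 _ _ hab))
  have h3 : x.1 ∈ T.map ((osp K n p).part 0).subtype := by
    refine Submodule.span_le.2 ?_ h1
    rintro _ ⟨k, l, hk, hl, hlk, rfl⟩
    exact ⟨_, hT k (2 * n - 1 - l) hk (by omega) (by omega), rfl⟩
  obtain ⟨y, hy, hyx⟩ := h3
  rwa [← show y = x from Subtype.ext hyx]

/-- A linear condition on the Cartan subalgebra can be tested on the basis. -/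
theorem cartan_induction (h2 : (2 : K) ≠ 0) {T : Submodule K ((osp K n p).part 0)}
    (hT : ∀ k, k < 2 * n → ⟨evenElt (bvec P k) (bvec P (2 * n - 1 - k)), evenElt_mem _ _⟩ ∈ T)
    (x : (osp K n p).part 0) (hx : x.1 ∈ (SuperLie.cartan p P).part 0) : x ∈ T := by
  have h1 := mem_span_evenElt_bvec P h2 x.2 (R := fun k l => k = l)
    (fun a b hab => by
      have h3 : conj P x.1 ∈ diagonals K n := hx.2
      rw [← mem_diagonals.1 h3] at hab
      by_contra hne
      exact hab (Matrix.diagonal_apply_ne _ fun h => hne (congrArg pos (Sum.inr_injective h))))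
  have h3 : x.1 ∈ T.map ((osp K n p).part 0).subtype := by
    refine Submodule.span_le.2 ?_ h1
    rintro _ ⟨k, l, hk, hl, rfl, rfl⟩
    exact ⟨_, hT k hk, rfl⟩
  obtain ⟨y, hy, hyx⟩ := h3
  rwa [← show y = x from Subtype.ext hyx]

theorem IsHW.nil_even (h : IsHW P ρ v l) (h2 : (2 : K) ≠ 0) (x : (osp K n p).part 0)
    (hx : x.1 ∈ nilPart P 0) : ρ (evenGen χ x) v = 0 := by
  let f : (osp K n p).part 0 →ₗ[K] M := LinearMap.applyₗ v ∘ₗ ρ.toLinearMap ∘ₗ evenGen χ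
  exact nil_even_induction h2 (T := LinearMap.ker f) h.even x hx

/-- An odd element of `n⁺` comes from a combination of the second half of the basis. -/
theorem nil_odd_induction {T : Submodule K (Fin n ⊕ Fin n → K)}
    (hT : ∀ k, n ≤ k → k < 2 * n → bvec P k ∈ T) {x : Matrix (Idx n) (Idx n) K}
    (hx : x ∈ nilPart P 1) : col K n x ∈ T := by
  obtain ⟨u, hu⟩ := exists_eq_sum_bvec P (col K n x)
  have h1 : conj P x = oddElt K n u := by
    have h3 : col K n x = (P : Matrix (Fin n ⊕ Fin n) (Fin n ⊕ Fin n) K).mulVec u := by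
      conv_rhs => rw [sum_smul_stdVec u, Matrix.mulVec_sum]
      simp only [Matrix.mulVec_smul]
      exact hu
    conv_lhs => rw [eq_oddElt hx.1, h3]
    exact conj_oddElt P u
  rw [hu]
  refine sum_mem fun a _ => ?_
  by_cases h0 : u a = 0
  · rw [h0, zero_smul]; exact zero_mem _
  · refine T.smul_mem _ (hT _ ((wt_pos_iff a).1 ?_) (pos_lt a))
    have h3 : conj P x ∈ strictUpper K n := hx.2
    rw [h1] at h3
    exact h3 (.inr a) (.inl ()) h0

theorem IsHW.nil_odd (h : IsHW P ρ v l) (x : (osp K n p).part 1)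
    (hx : x.1 ∈ nilPart P 1) : ρ (RedEnv.gen (osp K n p) χ ((osp K n p).incl 1 x)) v = 0 := by
  let f : (Fin n ⊕ Fin n → K) →ₗ[K] M := LinearMap.applyₗ v ∘ₗ ρ.toLinearMap ∘ₗ oddGen χ
  have h1 : f (col K n x.1) = 0 := nil_odd_induction (T := LinearMap.ker f) h.odd hx
  rw [incl_eq x (⟨oddElt K n (col K n x.1), oddElt_mem _⟩ : (osp K n p).part 1) (eq_oddElt x.2)]
  exact h1

/-- On a highest weight vector, `U_χ(b)` acts through the character defining `K_λ`. -/
theorem IsHW.map_apply (h : IsHW P ρ v l) (h2 : (2 : K) ≠ 0)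
    (hχ : ∀ x : (osp K n p).part 0, x.1 ∈ nilPart P 0 → χ x = 0) (hl : l ∈ weights p P χ)
    (b : RedEnv (borel p P) (χ ∘ₗ Submodule.inclusion (borel_le_osp p P 0))) :
    ρ (RedEnv.map (borel p P) (osp K n p) (borel_le_osp p P) χ b) v =
      charHom p P χ hχ l hl b • v := by
  let T : Subalgebra K (RedEnv (borel p P) (χ ∘ₗ Submodule.inclusion (borel_le_osp p P 0))) :=
    { carrier := {b | ρ (RedEnv.map (borel p P) (osp K n p) (borel_le_osp p P) χ b) v =
        charHom p P χ hχ l hl b • v}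
      mul_mem' := by
        intro a b ha hb
        simp only [Set.mem_ofPred_eq] at ha hb ⊢
        rw [map_mul, map_mul, Module.End.mul_apply, hb, map_smul, ha, map_mul, smul_smul, mul_comm]
      add_mem' := by
        intro a b ha hb
        simp only [Set.mem_ofPred_eq] at ha hb ⊢
        rw [map_add, map_add, LinearMap.add_apply, ha, hb, map_add, add_smul]
      algebraMap_mem' := by
        intro c
        simp only [Set.mem_ofPred_eq, AlgHom.commutes, Module.algebraMap_end_apply]
        rfl }
  refine RedEnv.mem_of_gen_mem T (fun x => ?_) b
  change ρ (RedEnv.map (borel p P) (osp K n p) (borel_le_osp p P) χ (RedEnv.gen _ _ x)) v =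
    charHom p P χ hχ l hl (RedEnv.gen _ _ x) • v
  have e0 : charHom p P χ hχ l hl (RedEnv.gen _ _ x) = l (toCartan p P x) :=
    RedEnv.lift_gen (borel p P) _ _ _ _ x
  rw [RedEnv.map_gen, e0]
  obtain ⟨x, hx⟩ := x
  obtain ⟨y, hy, z, hz, rfl⟩ := Submodule.mem_sup.1 hx
  have e1 : (⟨y + z, hx⟩ : (borel p P).carrier) = (borel p P).incl 0 ⟨y, hy⟩ +
    (borel p P).incl 1 ⟨z, hz⟩ := rfl
  have hyz : toCartan p P ⟨y + z, hx⟩ = toCartan p P ((borel p P).incl 0 ⟨y, hy⟩) := by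
    rw [e1, map_add, toCartan_odd, add_zero]
  have e5 : RedEnv.gen (osp K n p) χ (Submodule.inclusion
      (sup_le_sup (borel_le_osp p P 0) (borel_le_osp p P 1)) ⟨y + z, hx⟩) =
      evenGen χ (Submodule.inclusion (borel_le_osp p P 0) ⟨y, hy⟩) +
      RedEnv.gen (osp K n p) χ ((osp K n p).incl 1 ⟨z, borel_le_osp p P 1 hz⟩) :=
    (map_add (RedEnv.gen (osp K n p) χ)
      ((osp K n p).incl 0 (Submodule.inclusion (borel_le_osp p P 0) ⟨y, hy⟩))
      ((osp K n p).incl 1 ⟨z, borel_le_osp p P 1 hz⟩) :)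
  have hz' : z ∈ nilPart P 1 := by
    obtain ⟨d, hd, z', hz', rfl⟩ := Submodule.mem_sup.1 ((borel_part_eq p P 1).le hz)
    have hd0 : d = 0 := by
      have h3 : conj P d ∈ diagonals K n := hd.2
      have h4 := diagProj_odd P hd.1
      rw [diagProj_apply, mem_diagonals.1 h3, conj_inv_conj] at h4
      exact h4
    rw [hd0, zero_add]
    exact hz'
  have e2 := h.nil_odd ⟨z, borel_le_osp p P 1 hz⟩ hz'
  have e3 : evenGen χ (Submodule.inclusion (borel_le_osp p P 0) ⟨y, hy⟩) =
      evenGen χ (Submodule.inclusion (cartan_le_osp p P 0)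
        (toCartan p P ((borel p P).incl 0 ⟨y, hy⟩))) +
      evenGen χ (Submodule.inclusion (borel_le_osp p P 0) ⟨y, hy⟩ -
        Submodule.inclusion (cartan_le_osp p P 0)
          (toCartan p P ((borel p P).incl 0 ⟨y, hy⟩))) := by
    rw [map_sub]; abel
  have e4 : ρ (evenGen χ (Submodule.inclusion (borel_le_osp p P 0) ⟨y, hy⟩)) v =
      l (toCartan p P ((borel p P).incl 0 ⟨y, hy⟩)) • v := by
    rw [e3, map_add, LinearMap.add_apply, h.cartan,
      h.nil_even h2 _ (sub_diagProj_mem_nilPart p P ⟨y, hy⟩), add_zero]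
  refine (congrArg (fun u => ρ u v) e5).trans ?_
  rw [map_add, LinearMap.add_apply, e4, e2, add_zero, hyz]

/-- A highest weight vector generates a submodule whose dimension is at most that of a baby Verma
module. -/
theorem IsHW.exists_stable (h : IsHW P ρ v l) (h2 : (2 : K) ≠ 0) :
    ∃ T : Submodule K M, v ∈ T ∧ (∀ a, ∀ t ∈ T, ρ a t ∈ T) ∧ FiniteDimensional K T ∧
      Module.finrank K T ≤ bvDim p n := by
  have hpara := (isParaHom_oddGen χ h2).comp ρ
  have hbose : IsParabose (2 * n) (stdSign K n) (fun k => ρ (oddGen χ (bvec P k))) :=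
    hpara.isParabose fun k j hk hj => symp_bvec P hk hj
  have hanti : ∀ i j, anti (fun k => ρ (oddGen χ (bvec P k))) i j =
      ρ (evenGen χ ⟨evenElt (bvec P i) (bvec P j), evenElt_mem _ _⟩) := by
    intro i j
    rw [algHom_evenGen, anti]
  obtain ⟨T, hv, hT, hf, hd⟩ := hbose.exists_stable (v := v) (Fact.out : p.Prime).pos h2
    (by
      intro i j hij
      refine ⟨χ ⟨evenElt (bvec P i) (bvec P j), evenElt_mem _ _⟩ ^ p, ?_⟩
      rw [hanti, ← map_pow]
      have h1 := evenGen_pow χ ⟨evenElt (bvec P i) (bvec P j), evenElt_mem _ _⟩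
      rw [pmap_evenElt h2, map_zero, sub_zero] at h1
      · rw [h1, AlgHom.commutes, Algebra.algebraMap_eq_smul_one]
      · rw [symp_bvec P (by omega) (by omega), antiForm, if_neg (by omega)])
    (fun k hk hk2 => h.odd k hk hk2)
    (by
      intro k j hk hj hkj
      rw [hanti]
      by_cases h3 : 2 * n ≤ k + j
      · exact ⟨0, by rw [h.even k j hk hj h3, zero_smul]⟩
      · exact ⟨_, h.cartan ⟨_, evenElt_bvec_mem_cartan P p (by omega)⟩⟩)
  refine ⟨T, hv, fun a => ?_, hf, hd⟩
  let S : Subalgebra K (RedEnv (osp K n p) χ) :=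
    { carrier := {a | ∀ t ∈ T, ρ a t ∈ T}
      mul_mem' := by
        intro a b ha hb t ht
        rw [map_mul]
        exact ha _ (hb _ ht)
      add_mem' := by
        intro a b ha hb t ht
        rw [map_add]
        exact add_mem (ha _ ht) (hb _ ht)
      algebraMap_mem' := by
        intro c t ht
        rw [AlgHom.commutes, Module.algebraMap_end_apply]
        exact T.smul_mem c ht }
  refine mem_of_oddGen_mem h2 S (fun w t ht => ?_) a
  obtain ⟨u, rfl⟩ := exists_eq_sum_bvec P w
  rw [map_sum, map_sum, LinearMap.sum_apply]
  refine sum_mem fun a _ => ?_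
  rw [map_smul, map_smul]
  exact T.smul_mem _ (hT _ (pos_lt a) t ht)

end HighestWeight

section BabyVerma

variable {K : Type*} [Field K] {n p : ℕ} [Fact p.Prime] [CharP K p]
  {P : Matrix.symplecticGroup (Fin n) K} {χ : (osp K n p).part 0 →ₗ[K] K}
  (hχ : ∀ x : (osp K n p).part 0, x.1 ∈ nilPart P 0 → χ x = 0)
  {l : (SuperLie.cartan p P).part 0 →ₗ[K] K} (hl : l ∈ weights p P χ)

/-- The action of `U_χ(osp(1|2n))` on the baby Verma module. -/
noncomputable def vermaRep :
    RedEnv (osp K n p) χ →ₐ[K] Module.End K (BabyVerma p P χ hχ l hl) :=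
  Algebra.lsmul K K (BabyVerma p P χ hχ l hl)

/-- The canonical generator `1 ⊗ 1` of the baby Verma module. -/
noncomputable def vermaVec : BabyVerma p P χ hχ l hl :=
  (balanced (RedEnv.map (borel p P) (osp K n p) (borel_le_osp p P) χ)
    (charRep p P χ hχ l hl)).mkQ (1 ⊗ₜ[K] 1)

theorem mkQ_tmul (a : RedEnv (osp K n p) χ) (c : K) :
    (balanced (RedEnv.map (borel p P) (osp K n p) (borel_le_osp p P) χ)
      (charRep p P χ hχ l hl)).mkQ (a ⊗ₜ[K] c) = (c • a) • vermaVec hχ hl := by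
  rw [vermaVec, ← map_smul, TensorProduct.smul_tmul', smul_eq_mul, mul_one,
    TensorProduct.smul_tmul, smul_eq_mul, mul_one]

theorem exists_smul_vermaVec (z : BabyVerma p P χ hχ l hl) : ∃ a : RedEnv (osp K n p) χ,
    z = a • vermaVec hχ hl := by
  obtain ⟨t, rfl⟩ := Submodule.mkQ_surjective _ z
  induction t using TensorProduct.induction_on with
  | zero => exact ⟨0, by rw [map_zero, zero_smul]⟩
  | tmul a c => exact ⟨c • a, mkQ_tmul hχ hl a c⟩
  | add t u h1 h2 =>
    obtain ⟨a, ha⟩ := h1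
    obtain ⟨b, hb⟩ := h2
    exact ⟨a + b, by rw [map_add, ha, hb, add_smul]⟩

theorem map_smul_vermaVec
    (b : RedEnv (borel p P) (χ ∘ₗ Submodule.inclusion (borel_le_osp p P 0))) :
    RedEnv.map (borel p P) (osp K n p) (borel_le_osp p P) χ b • vermaVec hχ hl =
      charHom p P χ hχ l hl b • vermaVec hχ hl := by
  have h1 : ((RedEnv.map (borel p P) (osp K n p) (borel_le_osp p P) χ b) ⊗ₜ[K] (1 : K)) -
      (1 : RedEnv (osp K n p) χ) ⊗ₜ[K] (charRep p P χ hχ l hl b 1) ∈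
      balanced (RedEnv.map (borel p P) (osp K n p) (borel_le_osp p P) χ)
        (charRep p P χ hχ l hl) :=
    Submodule.subset_span ⟨1, b, 1, by rw [one_mul]⟩
  have h2 := (Submodule.Quotient.mk_eq_zero _).2 h1
  rw [Submodule.Quotient.mk_sub, sub_eq_zero] at h2
  have h3 : charRep p P χ hχ l hl b 1 = charHom p P χ hχ l hl b • (1 : K) := rfl
  have h4 : RedEnv.map (borel p P) (osp K n p) (borel_le_osp p P) χ b • vermaVec hχ hl =
      (balanced (RedEnv.map (borel p P) (osp K n p) (borel_le_osp p P) χ)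
        (charRep p P χ hχ l hl)).mkQ
        ((RedEnv.map (borel p P) (osp K n p) (borel_le_osp p P) χ b) ⊗ₜ[K] (1 : K)) := by
    rw [vermaVec, ← map_smul, TensorProduct.smul_tmul', smul_eq_mul, mul_one]
  rw [h4]
  refine h2.trans ?_
  rw [h3, TensorProduct.tmul_smul]
  rfl

theorem isHW_vermaVec : IsHW P (vermaRep hχ hl) (vermaVec hχ hl) l := by
  have key : ∀ (i : ZMod 2) (x : (osp K n p).part i) (hx : x.1 ∈ (borel p P).part i),
      RedEnv.gen (osp K n p) χ ((osp K n p).incl i x) • vermaVec hχ hl =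
        l (toCartan p P ((borel p P).incl i ⟨x.1, hx⟩)) • vermaVec hχ hl := by
    intro i x hx
    have h1 := map_smul_vermaVec hχ hl (RedEnv.gen (borel p P) _ ((borel p P).incl i ⟨x.1, hx⟩))
    rw [RedEnv.map_gen] at h1
    refine Eq.trans ?_ (h1.trans ?_)
    · rfl
    · congr 1
      exact RedEnv.lift_gen (borel p P) _ _ _ _ _
  have hnil : ∀ (i : ZMod 2) (x : (osp K n p).part i), x.1 ∈ nilPart P i →
      RedEnv.gen (osp K n p) χ ((osp K n p).incl i x) • vermaVec hχ hl = 0 := by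
    intro i x hx
    rw [key i x ((borel_part_eq p P i).ge (Submodule.mem_sup_right hx))]
    have h1 : (conj P x.1).diag = 0 := by
      ext a
      by_contra h
      exact lt_irrefl _ (hx.2 a a h)
    have h2 : toCartan p P ((borel p P).incl i
        ⟨x.1, (borel_part_eq p P i).ge (Submodule.mem_sup_right hx)⟩) = 0 := by
      apply Subtype.ext
      change diagProj P x.1 = 0
      rw [diagProj_apply, h1]
      simp
    rw [h2, map_zero, zero_smul]
  refine ⟨fun k hk hk2 => ?_, fun k j hk hj hkj => ?_, fun h => ?_⟩
  · exact hnil 1 ⟨_, oddElt_mem _⟩ (oddElt_bvec_mem P hk hk2)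
  · exact hnil 0 ⟨_, evenElt_mem _ _⟩ (evenElt_bvec_mem_nilPart P hk hj hkj)
  · have hb : h.1 ∈ (borel p P).part 0 := (borel_part_eq p P 0).ge (Submodule.mem_sup_left h.2)
    refine (key 0 (Submodule.inclusion (cartan_le_osp p P 0) h) hb).trans ?_
    congr 2
    apply Subtype.ext
    change diagProj P h.1 = h.1
    have h3 : conj P h.1 ∈ diagonals K n := h.2.2
    rw [diagProj_apply, mem_diagonals.1 h3, conj_inv_conj]

/-- Universal property of the baby Verma module. -/
theorem IsHW.exists_linearMap {M : Type*} [AddCommGroup M] [Module K M]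
    {ρ : RedEnv (osp K n p) χ →ₐ[K] Module.End K M} {v : M} (h : IsHW P ρ v l)
    (h2 : (2 : K) ≠ 0) : ∃ φ : BabyVerma p P χ hχ l hl →ₗ[K] M, φ (vermaVec hχ hl) = v ∧
      ∀ (a : RedEnv (osp K n p) χ) (z : BabyVerma p P χ hχ l hl), φ (a • z) = ρ a (φ z) := by
  let f : RedEnv (osp K n p) χ ⊗[K] K →ₗ[K] M :=
    TensorProduct.lift (LinearMap.toSpanSingleton K _ (LinearMap.applyₗ v ∘ₗ ρ.toLinearMap)).flip
  have hf : ∀ a c, f (a ⊗ₜ c) = c • ρ a v := fun a c => rfl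
  let : Module (RedEnv (osp K n p) χ) M := Module.compHom M (ρ : _ →+* Module.End K M)
  have hsm : ∀ (a : RedEnv (osp K n p) χ) (m : M), a • m = ρ a m := fun a m => rfl
  let g : RedEnv (osp K n p) χ ⊗[K] K →ₗ[RedEnv (osp K n p) χ] M :=
    { toFun := f
      map_add' := map_add f
      map_smul' := by
        intro a t
        rw [RingHom.id_apply, hsm]
        induction t using TensorProduct.induction_on with
        | zero => simp
        | tmul b c =>
          rw [TensorProduct.smul_tmul', hf, hf, smul_eq_mul, map_mul, map_smul,
            Module.End.mul_apply]
        | add t u h1 h3 => rw [smul_add, map_add, h1, h3, map_add, map_add] }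
  have hg : ∀ a c, g (a ⊗ₜ c) = c • ρ a v := fun a c => rfl
  have hker : balanced (RedEnv.map (borel p P) (osp K n p) (borel_le_osp p P) χ)
      (charRep p P χ hχ l hl) ≤ LinearMap.ker g := by
    refine Submodule.span_le.2 ?_
    rintro _ ⟨a, b, c, rfl⟩
    have h3 : charRep p P χ hχ l hl b c = charHom p P χ hχ l hl b * c := rfl
    rw [SetLike.mem_coe, LinearMap.mem_ker, map_sub, hg, hg, map_mul, Module.End.mul_apply,
      h.map_apply h2 hχ hl, h3, map_smul, smul_smul, mul_comm, sub_self]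
  let ψ := Submodule.liftQ _ g hker
  refine ⟨{ toFun := ψ, map_add' := map_add ψ, map_smul' := ?_ }, ?_, ?_⟩
  · intro c z
    have h3 := map_smul ψ (algebraMap K (RedEnv (osp K n p) χ) c) z
    rw [algebraMap_smul, hsm, AlgHom.commutes, Module.algebraMap_end_apply] at h3
    exact h3
  · change ψ (Submodule.mkQ _ _) = v
    rw [Submodule.mkQ_apply, Submodule.liftQ_apply, hg]
    simp
  · intro a z
    exact map_smul ψ a z

theorem vermaVec_ne_zero {M : Type*} [AddCommGroup M] [Module K M]
    {ρ : RedEnv (osp K n p) χ →ₐ[K] Module.End K M} {v : M} (h : IsHW P ρ v l)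
    (h2 : (2 : K) ≠ 0) (hv : v ≠ 0) : vermaVec hχ hl ≠ 0 := by
  intro h0
  obtain ⟨φ, h1, -⟩ := h.exists_linearMap hχ hl h2
  rw [h0, map_zero] at h1
  exact hv h1.symm

/-- The dimension of a baby Verma module is at most that of `U_χ(n⁻)`. -/
theorem finrank_babyVerma_le (h2 : (2 : K) ≠ 0) : FiniteDimensional K (BabyVerma p P χ hχ l hl) ∧
    Module.finrank K (BabyVerma p P χ hχ l hl) ≤ bvDim p n := by
  obtain ⟨T, hv, hT, hf, hd⟩ := (isHW_vermaVec hχ hl).exists_stable h2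
  have h1 : T = ⊤ := by
    rw [eq_top_iff]
    rintro z -
    obtain ⟨a, rfl⟩ := exists_smul_vermaVec hχ hl z
    exact hT a _ hv
  subst h1
  refine ⟨Module.Finite.of_surjective _ (Submodule.topEquiv (R := K)
    (M := BabyVerma p P χ hχ l hl)).surjective, ?_⟩
  rwa [finrank_top] at hd

/-- The parity automorphism of `U_χ(osp(1|2n))`. -/
theorem exists_parityHom (h2 : (2 : K) ≠ 0) : ∃ σ : RedEnv (osp K n p) χ →ₐ[K] RedEnv (osp K n p) χ,
    (∀ w, σ (oddGen χ w) = -oddGen χ w) ∧ (∀ x, σ (evenGen χ x) = evenGen χ x) ∧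
    (∀ a, σ (σ a) = a) ∧
    (∀ a ∈ RedEnv.part (osp K n p) χ 0, σ a = a) ∧
    (∀ a ∈ RedEnv.part (osp K n p) χ 1, σ a = -a) := by
  obtain ⟨σ, hσ⟩ := (isParaHom_oddGen χ h2).neg.exists_algHom h2
  have hodd : ∀ w, σ (oddGen χ w) = -oddGen χ w := fun w => by rw [hσ]; rfl
  have heven : ∀ x, σ (evenGen χ x) = evenGen χ x := by
    intro x
    have h1 := exists_evenElt_mem_span h2 x
    induction h1 using Submodule.span_induction with
    | mem y hy =>
      obtain ⟨w, rfl⟩ := hy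
      rw [algHom_evenGen, hodd, neg_mul_neg, oddGen_anti]
    | zero => rw [map_zero, map_zero]
    | add y z _ _ h3 h4 => rw [map_add, map_add, h3, h4]
    | smul c y _ h3 => rw [map_smul, map_smul, h3]
  have hinv : ∀ a, σ (σ a) = a := by
    intro a
    have := mem_of_oddGen_mem h2 (AlgHom.equalizer (σ.comp σ) (AlgHom.id K _)) (by
      intro w
      rw [AlgHom.mem_equalizer]
      simp [hodd]) a
    exact this
  have h01 : ∀ j : ZMod 2, j = 0 ∨ j = 1 := by decide
  have hgen : ∀ (x : Σ j : ZMod 2, (osp K n p).part j),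
      σ (RedEnv.gen (osp K n p) χ ((osp K n p).incl x.1 x.2)) =
      (if x.1 = 0 then 1 else -1 : K) • RedEnv.gen (osp K n p) χ ((osp K n p).incl x.1 x.2) := by
    rintro ⟨j, x⟩
    rcases h01 j with rfl | rfl
    · simp only [if_true, one_smul]
      exact heven x
    · have h1 := hodd (col K n x.1)
      have h3 : RedEnv.gen (osp K n p) χ ((osp K n p).incl 1 x) = oddGen χ (col K n x.1) :=
        congrArg _ (incl_eq x (⟨oddElt K n (col K n x.1), oddElt_mem _⟩ : (osp K n p).part 1)
          (eq_oddElt x.2))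
      simp [h3, h1]
  have hprod : ∀ L : List (Σ j : ZMod 2, (osp K n p).part j),
      σ (L.map fun x => RedEnv.gen (osp K n p) χ ((osp K n p).incl x.1 x.2)).prod =
      (if (L.map fun x => x.1).sum = 0 then 1 else -1 : K) •
        (L.map fun x => RedEnv.gen (osp K n p) χ ((osp K n p).incl x.1 x.2)).prod := by
    intro L
    induction L with
    | nil => simp
    | cons x L ih =>
      rw [List.map_cons, List.prod_cons, map_mul, ih, hgen, smul_mul_smul_comm, List.map_cons,
        List.sum_cons]
      congr 1
      have h11 : (1 + 1 : ZMod 2) = 0 := by decide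
      rcases h01 x.1 with h | h <;> rcases h01 (L.map fun x => x.1).sum with h' | h' <;>
        simp [h, h', h11]
  refine ⟨σ, hodd, heven, hinv, fun a ha => ?_, fun a ha => ?_⟩
  · induction ha using Submodule.span_induction with
    | mem y hy =>
      obtain ⟨L, hL, rfl⟩ := hy
      rw [hprod, hL, if_pos rfl, one_smul]
    | zero => exact map_zero σ
    | add y z _ _ h3 h4 => rw [map_add, h3, h4]
    | smul c y _ h3 => rw [map_smul, h3]
  · induction ha using Submodule.span_induction with
    | mem y hy =>
      obtain ⟨L, hL, rfl⟩ := hy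
      rw [hprod, hL, if_neg (by decide), neg_one_smul]
    | zero => rw [map_zero, neg_zero]
    | add y z _ _ h3 h4 => rw [map_add, h3, h4, neg_add]
    | smul c y _ h3 => rw [map_smul, h3, smul_neg]

/-- The parity operator of the baby Verma module. -/
theorem exists_vermaParity (h2 : (2 : K) ≠ 0) : ∃ s : Module.End K (BabyVerma p P χ hχ l hl),
    s * s = 1 ∧
    (∀ w, s * vermaRep hχ hl (oddGen χ w) = -(vermaRep hχ hl (oddGen χ w) * s)) ∧
    (∀ z ∈ babyVermaPart p P χ hχ l hl 0, s z = z) ∧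
    (∀ z ∈ babyVermaPart p P χ hχ l hl 1, s z = -z) := by
  obtain ⟨σ, hodd, heven, hinv, h0, h1⟩ := exists_parityHom (χ := χ) h2
  have hw := isHW_vermaVec hχ hl
  have hw' : IsHW P ((vermaRep hχ hl).comp σ) (vermaVec hχ hl) l := by
    refine ⟨fun k hk hk2 => ?_, fun k j hk hj hkj => ?_, fun h => ?_⟩
    · rw [AlgHom.comp_apply, hodd, map_neg, LinearMap.neg_apply, hw.odd k hk hk2, neg_zero]
    · rw [AlgHom.comp_apply, heven, hw.even k j hk hj hkj]
    · rw [AlgHom.comp_apply, heven, hw.cartan]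
  obtain ⟨s, hs, hsa⟩ := hw'.exists_linearMap hχ hl h2
  have hsa' : ∀ a z, s (a • z) = σ a • s z := hsa
  refine ⟨s, ?_, ?_, ?_, ?_⟩
  · refine LinearMap.ext fun z => ?_
    obtain ⟨a, rfl⟩ := exists_smul_vermaVec hχ hl z
    rw [Module.End.mul_apply, hsa', hs, hsa', hs, hinv, Module.End.one_apply]
  · intro w
    refine LinearMap.ext fun z => ?_
    change s (oddGen χ w • z) = -(oddGen χ w • s z)
    rw [hsa', hodd, neg_smul]
  · intro z hz
    induction hz using Submodule.span_induction with
    | mem z hz =>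
      obtain ⟨a, ha, c, rfl⟩ := hz
      rw [mkQ_tmul, hsa', hs, map_smul, h0 a ha]
    | zero => exact map_zero s
    | add y z _ _ h3 h4 => rw [map_add, h3, h4]
    | smul c y _ h3 => rw [map_smul, h3]
  · intro z hz
    induction hz using Submodule.span_induction with
    | mem z hz =>
      obtain ⟨a, ha, c, rfl⟩ := hz
      rw [mkQ_tmul, hsa', hs, map_smul, h1 a ha, smul_neg, neg_smul]
    | zero => rw [map_zero, neg_zero]
    | add y z _ _ h3 h4 => rw [map_add, h3, h4, neg_add]
    | smul c y _ h3 => rw [map_smul, h3, smul_neg]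

end BabyVerma

/-! ### Regular nilpotent characters -/

section Skew

variable {K W : Type*} [Field K] [AddCommGroup W] [Module K W] {ω : W →ₗ[K] W →ₗ[K] K}
  {B : Module.End K W}

theorem skew_pow (hB : ∀ x y, ω (B x) y = -ω x (B y)) (m : ℕ) (x y : W) :
    ω ((B ^ m) x) y = (-1) ^ m * ω x ((B ^ m) y) := by
  induction m generalizing y with
  | zero => simp
  | succ m ih =>
    rw [pow_succ' B m, Module.End.mul_apply, hB, ih, ← Module.End.mul_apply, ← pow_succ, pow_succ',
      pow_succ']
    ring

/-- A cyclic vector `t` of a skew nilpotent operator `B` on a symplectic space of dimension `N` can be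
chosen so that the form is antidiagonal on `t, B t, B² t, …`. -/
theorem exists_antidiagonal_cyclic (h2 : (2 : K) ≠ 0) (hω : ∀ x y, ω x y = -ω y x)
    (hB : ∀ x y, ω (B x) y = -ω x (B y)) {n : ℕ} {t₀ : W} (h0 : (B ^ (2 * n)) t₀ = 0)
    (hc : ω t₀ ((B ^ (2 * n - 1)) t₀) ≠ 0) : ∃ t : W, ω t ((B ^ (2 * n - 1)) t) ≠ 0 ∧
      ∀ k, k ≠ 2 * n - 1 → ω t ((B ^ k) t) = 0 := by
  have hlarge : ∀ t, (B ^ (2 * n)) t = 0 → ∀ k, 2 * n ≤ k → (B ^ k) t = 0 := by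
    intro t ht k hk
    obtain ⟨j, rfl⟩ := Nat.exists_eq_add_of_le' hk
    rw [pow_add, Module.End.mul_apply, ht, map_zero]
  have heven : ∀ t k, Even k → ω t ((B ^ k) t) = 0 := by
    intro t k hk
    have h1 := skew_pow hB k t t
    rw [hk.neg_one_pow, one_mul, hω] at h1
    have h3 : (2 : K) * ω t ((B ^ k) t) = 0 := by linear_combination -h1
    exact (mul_eq_zero.1 h3).resolve_left h2
  -- the values `ω t (B ^ k) t` for odd `k` are removed from the top downwards
  have key : ∀ j, ∃ t : W, (B ^ (2 * n)) t = 0 ∧ ω t ((B ^ (2 * n - 1)) t) ≠ 0 ∧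
      ∀ k, k < 2 * n - 1 → 2 * n - 1 ≤ k + 2 * j → ω t ((B ^ k) t) = 0 := by
    intro j
    induction j with
    | zero => exact ⟨t₀, h0, hc, fun k h1 h3 => by omega⟩
    | succ j ih =>
      obtain ⟨t, ht0, htc, ht⟩ := ih
      by_cases hj : 2 * n - 1 < 2 * (j + 1)
      · exact ⟨t, ht0, htc, fun k h1 h3 => by
          rcases Nat.even_or_odd k with hk | hk
          · exact heven t k hk
          · obtain ⟨r, rfl⟩ := hk
            exact ht _ h1 (by omega)⟩
      set m := 2 * (j + 1) with hm
      set s := -(ω t ((B ^ (2 * n - 1 - m)) t)) / (2 * ω t ((B ^ (2 * n - 1)) t)) with hs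
      have hms : (-1 : K) ^ m = 1 := (even_two_mul (j + 1)).neg_one_pow
      have hval : ∀ k, ω (t + s • (B ^ m) t) ((B ^ k) (t + s • (B ^ m) t)) = ω t ((B ^ k) t) +
          2 * s * ω t ((B ^ (k + m)) t) + s ^ 2 * ω t ((B ^ (k + m + m)) t) := by
        intro k
        have e1 : (B ^ k) ((B ^ m) t) = (B ^ (k + m)) t := by
          rw [pow_add, Module.End.mul_apply]
        have e2 : ∀ i, (B ^ m) ((B ^ i) t) = (B ^ (i + m)) t := fun i => by
          rw [add_comm, pow_add, Module.End.mul_apply]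
        simp only [map_add, map_smul, LinearMap.add_apply, LinearMap.smul_apply, smul_eq_mul, e1,
          skew_pow hB m, hms, one_mul, e2]
        ring
      refine ⟨t + s • (B ^ m) t, ?_, ?_, fun k h1 h3 => ?_⟩
      · rw [map_add, map_smul, ht0, ← Module.End.mul_apply, ← pow_add, hlarge t ht0 _ (by omega),
          smul_zero, add_zero]
      · rw [hval, hlarge t ht0 (2 * n - 1 + m) (by omega),
          hlarge t ht0 (2 * n - 1 + m + m) (by omega)]
        simpa using htc
      · rw [hval, hlarge t ht0 (k + m + m) (by omega)]
        by_cases hk : k = 2 * n - 1 - m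
        · rw [show k + m = 2 * n - 1 by omega, hk, hs]
          field_simp
          simp
        · have hk0 : ω t ((B ^ k) t) = 0 := by
            rcases Nat.even_or_odd k with hk' | ⟨r, hr⟩
            · exact heven t k hk'
            · exact ht k h1 (by omega)
          rw [hk0, hlarge t ht0 (k + m) (by omega)]
          simp
  obtain ⟨t, ht0, htc, ht⟩ := key n
  refine ⟨t, htc, fun k hk => ?_⟩
  rcases lt_or_gt_of_ne hk with h | h
  · exact ht k h (by omega)
  · rw [hlarge t ht0 k (by omega), map_zero]

end Skew

section Regular

variable {K : Type*} [Field K] {n : ℕ}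

theorem supertrace_mul_evenElt {X : Matrix (Idx n) (Idx n) K} (hX : X ∈ ospPart K n 0)
    (h2 : (2 : K) ≠ 0) (w w' : Fin n ⊕ Fin n → K) :
    supertrace (X * evenElt w w') = -2 * symp K n ((blk K n X).mulVec w) w' := by
  have e1 : ∀ u u' : Fin n ⊕ Fin n → K, ∑ a, (blk K n X * Matrix.vecMulVec u
      ((Matrix.J (Fin n) K).mulVec u')) a a = symp K n ((blk K n X).mulVec u) u' := by
    intro u u'
    rw [Matrix.mul_vecMulVec, symp_apply, dotProduct]
    rfl
  have e2 : supertrace (X * evenElt w w') = -∑ a, (blk K n X * (Matrix.vecMulVec w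
      ((Matrix.J (Fin n) K).mulVec w') + Matrix.vecMulVec w' ((Matrix.J (Fin n) K).mulVec w))) a a := by
    rw [evenElt_eq]
    conv_lhs => rw [even_eq_fromBlocks hX h2, Matrix.fromBlocks_multiply]
    simp only [supertrace, Fintype.sum_sum_type, parity]
    simp
    ring
  rw [e2]
  simp only [mul_add, Matrix.add_apply, Finset.sum_add_distrib, e1]
  rw [symp_blk hX w' w, symp_swap w']
  ring

variable (P : Matrix.symplecticGroup (Fin n) K)

theorem blk_mulVec_bvec (h2 : (2 : K) ≠ 0) {X : Matrix (Idx n) (Idx n) K} (hX : X ∈ ospPart K n 0)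
    (u : Fin n ⊕ Fin n → K) :
    (blk K n X).mulVec ((P : Matrix (Fin n ⊕ Fin n) (Fin n ⊕ Fin n) K).mulVec u) =
      (P : Matrix (Fin n ⊕ Fin n) (Fin n ⊕ Fin n) K).mulVec ((blk K n (conj P X)).mulVec u) := by
  have h1 : block P * conj P X = X * block P := by
    have h : block P * block P⁻¹ = 1 := by rw [block_mul, mul_inv_cancel, block_one]
    rw [conj_apply, mul_assoc, ← mul_assoc (block P), h, one_mul]
  rw [even_eq_fromBlocks (conj_mem_ospPart P hX) h2, block, Matrix.fromBlocks_multiply] at h1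
  conv_rhs at h1 => rw [even_eq_fromBlocks hX h2, Matrix.fromBlocks_multiply]
  have h3 := congrArg Matrix.toBlocks₂₂ h1
  simp only [Matrix.toBlocks_fromBlocks₂₂, Matrix.mul_zero, zero_add] at h3
  rw [Matrix.mulVec_mulVec, Matrix.mulVec_mulVec, h3]

theorem symp_blk_mulVec_bvec (h2 : (2 : K) ≠ 0) {X : Matrix (Idx n) (Idx n) K}
    (hX : X ∈ ospPart K n 0) (a b : Fin n ⊕ Fin n) :
    symp K n ((blk K n X).mulVec (bvec P (pos b))) (bvec P (2 * n - 1 - pos a)) =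
      conj P X (.inr a) (.inr b) * stdSign K n (pos a) := by
  have ha := pos_lt a
  rw [bvec, blk_mulVec_bvec P h2 hX, bvec, symp_mulVec,
    sum_smul_stdVec ((blk K n (conj P X)).mulVec (stdVec K n (pos b))), map_sum,
    LinearMap.sum_apply, Finset.sum_eq_single a]
  · rw [map_smul, LinearMap.smul_apply, symp_stdVec ha (by omega), antiForm, if_pos (by omega),
      stdVec_pos, Matrix.mulVec_single_one]
    rfl
  · intro c _ hc
    have hc' : pos c ≠ pos a := fun h => hc (pos_injective h)
    rw [map_smul, LinearMap.smul_apply, symp_stdVec (pos_lt c) (by omega), antiForm,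
      if_neg (by omega), smul_zero]
  · simp

/-- A nilpotent even element, orthogonal to `n⁺` for the supertrace form, belongs to `n⁺`. -/
theorem mem_nilPart_of_orthogonal (h2 : (2 : K) ≠ 0) {X : Matrix (Idx n) (Idx n) K}
    (hX : X ∈ ospPart K n 0) (hnil : IsNilpotent X)
    (horth : ∀ y ∈ nilPart P 0, supertrace (X * y) = 0) : X ∈ nilPart P 0 := by
  obtain ⟨-, h01, h10⟩ := even_apply_eq_zero (conj_mem_ospPart P hX) h2
  have hup : conj P X ∈ upper K n := by
    rintro (a | a) (b | b) h
    · exact le_rfl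
    · exact absurd (h01 b) h
    · exact absurd (h10 a) h
    · by_contra hlt
      rw [not_le, wt_lt_iff] at hlt
      have ha := pos_lt a
      have h3 := horth _ (evenElt_bvec_mem_nilPart P (k := pos b) (l := 2 * n - 1 - pos a)
        (pos_lt b) (by omega) (by omega))
      rw [supertrace_mul_evenElt hX h2, symp_blk_mulVec_bvec P h2 hX] at h3
      exact mul_ne_zero (neg_ne_zero.2 h2) (mul_ne_zero h (stdSign_ne_zero _)) h3
  refine ⟨hX, fun a b h => lt_of_le_of_ne (hup a b h) fun hab => ?_⟩
  have hab' : a = b := (wt_injective n hab).symm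
  subst hab'
  obtain ⟨m, hm⟩ := hnil
  have h3 := diag_pow_of_upper hup m a
  rw [← map_pow, hm, map_zero] at h3
  exact h (IsReduced.eq_zero _ ⟨m, h3.symm⟩)

theorem commutator_mem_nilPart {X y : Matrix (Idx n) (Idx n) K} (hX : X ∈ nilPart P 0)
    (hy : y ∈ ospPart K n 0) (hyu : conj P y ∈ upper K n) : X * y - y * X ∈ nilPart P 0 := by
  have hXu : conj P X ∈ strictUpper K n := hX.2
  refine ⟨even_lie_mem hX.1 hy, ?_⟩
  change conj P (X * y - y * X) ∈ strictUpper K n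
  rw [map_sub, map_mul, map_mul]
  refine sub_mem ?_ ?_
  · intro a b h
    rw [Matrix.mul_apply] at h
    obtain ⟨c, -, hc⟩ := Finset.exists_ne_zero_of_sum_ne_zero h
    exact (hyu c b (right_ne_zero_of_mul hc)).trans_lt (hXu a c (left_ne_zero_of_mul hc))
  · intro a b h
    rw [Matrix.mul_apply] at h
    obtain ⟨c, -, hc⟩ := Finset.exists_ne_zero_of_sum_ne_zero h
    exact (hXu c b (right_ne_zero_of_mul hc)).trans_le (hyu a c (left_ne_zero_of_mul hc))

theorem commutator_apply_eq_zero (h2 : (2 : K) ≠ 0) {X y : Matrix (Idx n) (Idx n) K}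
    (hX : X ∈ nilPart P 0) (hyu : conj P y ∈ upper K n) {a b : Fin n ⊕ Fin n}
    (hab : pos a = pos b + 1) (h0 : conj P X (.inr a) (.inr b) = 0) :
    conj P (X * y - y * X) (.inr a) (.inr b) = 0 := by
  have hXu : conj P X ∈ strictUpper K n := hX.2
  obtain ⟨-, h01, h10⟩ := even_apply_eq_zero (conj_mem_ospPart P hX.1) h2
  rw [map_sub, map_mul, map_mul, Matrix.sub_apply, Matrix.mul_apply, Matrix.mul_apply,
    Finset.sum_eq_zero, Finset.sum_eq_zero, sub_zero]
  · rintro (c | c) -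
    · rw [h01, mul_zero]
    · by_contra h
      have h1 := (wt_lt_iff _ _).1 (hXu _ _ (right_ne_zero_of_mul h))
      have h3 : c = a := by
        have h4 := hyu _ _ (left_ne_zero_of_mul h)
        rw [← not_lt, wt_lt_iff] at h4
        exact pos_injective (by omega)
      rw [h3] at h
      exact right_ne_zero_of_mul h h0
  · rintro (c | c) -
    · rw [h10, zero_mul]
    · by_contra h
      have h1 := (wt_lt_iff _ _).1 (hXu _ _ (left_ne_zero_of_mul h))
      have h3 : c = b := by
        have h4 := hyu _ _ (right_ne_zero_of_mul h)
        rw [← not_lt, wt_lt_iff] at h4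
        exact pos_injective (by omega)
      rw [h3] at h
      exact left_ne_zero_of_mul h h0

/-- The entries of a regular nilpotent element of `n⁺` next to the diagonal do not vanish: otherwise
`ad X` maps the Borel subalgebra of `sp(2n)` to a proper subspace of its nilradical, and the
centralizer of `X` has dimension greater than `n`. -/
theorem regular_apply_ne_zero (h2 : (2 : K) ≠ 0) {X : Matrix (Idx n) (Idx n) K}
    (hX : X ∈ nilPart P 0)
    (hreg : Module.finrank K
      ↥(ospPart K n 0 ⊓ Subalgebra.toSubmodule (Subalgebra.centralizer K {X})) = n)
    {a b : Fin n ⊕ Fin n} (hab : pos a = pos b + 1) : conj P X (.inr a) (.inr b) ≠ 0 := by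
  intro h0
  -- `L` parametrizes the Borel subalgebra
  let hc : Fin n → Matrix (Idx n) (Idx n) K := fun k => evenElt (bvec P k) (bvec P (2 * n - 1 - k))
  let L : nilPart P 0 × (Fin n → K) →ₗ[K] Matrix (Idx n) (Idx n) K :=
    (nilPart P 0).subtype.coprod (Fintype.linearCombination K hc)
  have hL : ∀ x, L x = x.1.1 + ∑ k, x.2 k • hc k := fun x => rfl
  have hLmem : ∀ x, L x ∈ ospPart K n 0 := by
    intro x
    rw [hL]
    exact add_mem x.1.2.1 (sum_mem fun k _ => Submodule.smul_mem _ _ (evenElt_mem _ _))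
  have hLup : ∀ x, conj P (L x) ∈ upper K n := by
    intro x
    rw [hL, map_add, map_sum]
    refine add_mem (fun i j hij => (x.1.2.2 i j hij).le) (sum_mem fun k _ => ?_)
    rw [map_smul]
    refine Submodule.smul_mem _ _ ?_
    have hk := k.2
    intro i j hij
    change conj P (evenElt _ _) i j ≠ 0 at hij
    rw [bvec, bvec, conj_evenElt] at hij
    obtain ⟨i', j', rfl, rfl, h3⟩ := evenElt_stdVec_ne (by omega) (by omega) hij
    rw [pos_injective (show pos i' = pos j' by omega)]
  have hLinj : Function.Injective L := by
    rw [← LinearMap.ker_eq_bot, LinearMap.ker_eq_bot']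
    rintro ⟨y, c⟩ hyc
    rw [hL] at hyc
    have hc0 : c = 0 := by
      ext k
      have hk := k.2
      have h3 := congrArg (fun x => symp K n ((blk K n x).mulVec (bvec P k))
        (bvec P (2 * n - 1 - k))) hyc
      simp only [map_add, map_sum, map_smul, Matrix.add_mulVec, Matrix.sum_mulVec,
        Matrix.smul_mulVec, LinearMap.add_apply, LinearMap.sum_apply, LinearMap.smul_apply,
        map_zero, Matrix.zero_mulVec, LinearMap.zero_apply] at h3
      obtain ⟨a', ha'⟩ := exists_pos (n := n) (k := k) (by omega)
      have h4 : symp K n ((blk K n y.1).mulVec (bvec P k)) (bvec P (2 * n - 1 - k)) = 0 := by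
        rw [← ha', symp_blk_mulVec_bvec P h2 y.2.1]
        have : conj P y.1 (.inr a') (.inr a') = 0 := by
          by_contra h
          exact lt_irrefl _ (y.2.2 _ _ h)
        rw [this, zero_mul]
      rw [h4, zero_add, Finset.sum_eq_single k] at h3
      · rw [blk_evenElt_mulVec, map_add, map_smul, map_smul, LinearMap.add_apply,
          LinearMap.smul_apply, LinearMap.smul_apply, symp_bvec P (by omega) (by omega),
          symp_bvec P (by omega) (by omega), antiForm, antiForm, if_pos (by omega),
          if_neg (by omega), zero_smul, add_zero] at h3
        simpa [stdSign_ne_zero] using h3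
      · intro j _ hj
        have hj' : (j : ℕ) ≠ k := fun h => hj (Fin.ext h)
        have hj2 := j.2
        rw [blk_evenElt_mulVec, symp_bvec P (by omega) (by omega),
          symp_bvec P (by omega) (by omega), antiForm, antiForm, if_neg (by omega),
          if_neg (by omega), zero_smul, zero_smul, add_zero, map_zero, LinearMap.zero_apply,
          smul_zero]
      · simp
    refine Prod.ext (Subtype.ext ?_) hc0
    rw [hc0] at hyc
    simpa using hyc
  -- the entry in question is a nonzero functional on the nilradical
  let f : nilPart P 0 →ₗ[K] K :=
    { toFun := fun y => conj P y.1 (.inr a) (.inr b)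
      map_add' := fun x y => by simp
      map_smul' := fun c x => by simp }
  have hb := pos_lt b
  have ha := pos_lt a
  have hfne : f ≠ 0 := by
    intro h
    have h3 := LinearMap.congr_fun h ⟨_, evenElt_bvec_mem_nilPart P (k := pos a)
      (l := 2 * n - 1 - pos b) ha (by omega) (by omega)⟩
    change conj P (evenElt _ _) (.inr a) (.inr b) = 0 at h3
    have h4 := symp_blk_mulVec_bvec P h2 (evenElt_mem (bvec P (pos a)) (bvec P (2 * n - 1 - pos b)))
      a b
    rw [h3, zero_mul, blk_evenElt_mulVec, map_add, map_smul, map_smul, LinearMap.add_apply,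
      LinearMap.smul_apply, LinearMap.smul_apply, symp_bvec P (by omega) (by omega),
      symp_bvec P (by omega) (by omega), symp_bvec P (by omega) (by omega),
      symp_bvec P (by omega) (by omega), antiForm, antiForm, antiForm, antiForm,
      if_pos (by omega), if_pos (by omega)] at h4
    by_cases hn : pos b + pos a + 1 = 2 * n
    · rw [if_pos hn, if_pos (by omega)] at h4
      have e1 : pos b < n := by omega
      have e2 : ¬ pos a < n := by omega
      have e3 : ¬ 2 * n - 1 - pos b < n := by omega
      simp only [stdSign, if_pos e1, if_neg e2, if_neg e3, smul_eq_mul] at h4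
      exact h2 (by linear_combination -h4)
    · rw [if_neg hn, zero_smul, add_zero, smul_eq_mul] at h4
      exact mul_ne_zero (stdSign_ne_zero _) (stdSign_ne_zero _) h4
  let G : nilPart P 0 × (Fin n → K) →ₗ[K] LinearMap.ker f :=
    LinearMap.codRestrict (LinearMap.ker f) (LinearMap.codRestrict (nilPart P 0)
      ((LinearMap.mulLeft K X - LinearMap.mulRight K X) ∘ₗ L)
      (fun x => commutator_mem_nilPart P hX (hLmem x) (hLup x)))
      (fun x => commutator_apply_eq_zero P h2 hX (hLup x) hab h0)
  have hG : ∀ x, (G x).1.1 = X * L x - L x * X := fun x => rfl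
  have h3 : Module.finrank K (LinearMap.ker f) + 1 = Module.finrank K (nilPart P 0) := by
    have h4 := LinearMap.finrank_range_add_finrank_ker f
    have h5 : Module.finrank K (LinearMap.range f) = 1 := by
      rw [LinearMap.range_eq_top.2 (LinearMap.surjective hfne), finrank_top, Module.finrank_self]
    omega
  have h4 := LinearMap.finrank_range_add_finrank_ker (K := K)
    (V := nilPart P 0 × (Fin n → K)) (V₂ := LinearMap.ker f) G
  have h5 : Module.finrank K (LinearMap.range G) ≤ Module.finrank K (LinearMap.ker f) :=
    Submodule.finrank_le _
  rw [Module.finrank_prod, Module.finrank_fin_fun] at h4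
  let L' : LinearMap.ker G →ₗ[K]
      ↥(ospPart K n 0 ⊓ Subalgebra.toSubmodule (Subalgebra.centralizer K {X})) :=
    LinearMap.codRestrict _ (L ∘ₗ (LinearMap.ker G).subtype) (by
      rintro ⟨x, hx⟩
      refine ⟨hLmem x, ?_⟩
      change L x ∈ Subalgebra.centralizer K {X}
      rw [Subalgebra.mem_centralizer_iff]
      intro g hg
      rw [Set.mem_singleton_iff.1 hg]
      have h6 := hG x
      rw [LinearMap.mem_ker.1 hx] at h6
      exact sub_eq_zero.1 h6.symm)
  have h6 : Module.finrank K (LinearMap.ker G) ≤ n := by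
    refine le_of_le_of_eq ?_ hreg
    refine LinearMap.finrank_le_finrank_of_injective (f := L') fun x y hxy => ?_
    exact Subtype.ext (hLinj (congrArg Subtype.val hxy))
  omega

/-- The first column of the powers of a strictly upper triangular matrix. -/
theorem pow_apply_first {X : Matrix (Idx n) (Idx n) K} (h10 : ∀ a, X (.inr a) (.inl ()) = 0)
    (hX : X ∈ strictUpper K n)
    (hne : ∀ a b : Fin n ⊕ Fin n, pos a = pos b + 1 → X (.inr a) (.inr b) ≠ 0)
    {b : Fin n ⊕ Fin n} (hb : pos b = 0) (m : ℕ) :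
    ∀ a, ((X ^ m) (.inr a) (.inr b) ≠ 0 → m ≤ pos a) ∧
      (pos a = m → (X ^ m) (.inr a) (.inr b) ≠ 0) := by
  induction m with
  | zero =>
    intro a
    refine ⟨fun _ => Nat.zero_le _, fun h => ?_⟩
    rw [pos_injective (h.trans hb.symm)]
    simp
  | succ m ih =>
    intro a
    have hsum : (X ^ (m + 1)) (.inr a) (.inr b) =
        ∑ c, X (.inr a) (.inr c) * (X ^ m) (.inr c) (.inr b) := by
      rw [pow_succ', Matrix.mul_apply, Fintype.sum_sum_type]
      simp [h10]
    refine ⟨fun h => ?_, fun h => ?_⟩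
    · rw [hsum] at h
      obtain ⟨c, -, hc⟩ := Finset.exists_ne_zero_of_sum_ne_zero h
      have h1 := (wt_lt_iff _ _).1 (hX _ _ (left_ne_zero_of_mul hc))
      have h3 := (ih c).1 (right_ne_zero_of_mul hc)
      omega
    · have ha := pos_lt a
      obtain ⟨c, hc⟩ := exists_pos (n := n) (k := m) (by omega)
      rw [hsum, Finset.sum_eq_single c]
      · exact mul_ne_zero (hne a c (by omega)) ((ih c).2 hc)
      · intro d _ hd
        by_contra h0
        have h1 := (wt_lt_iff _ _).1 (hX _ _ (left_ne_zero_of_mul h0))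
        have h3 := (ih d).1 (right_ne_zero_of_mul h0)
        exact hd (pos_injective (by omega))
      · simp

theorem conj_mem_of_regular (h2 : (2 : K) ≠ 0) {X : Matrix (Idx n) (Idx n) K}
    (hX : X ∈ nilPart P 0) (hn : 1 ≤ n)
    (hreg : Module.finrank K
      ↥(ospPart K n 0 ⊓ Subalgebra.toSubmodule (Subalgebra.centralizer K {X})) = n) :
    ((blk K n X).mulVecLin ^ (2 * n)) (bvec P 0) = 0 ∧
      symp K n (bvec P 0) (((blk K n X).mulVecLin ^ (2 * n - 1)) (bvec P 0)) ≠ 0 := by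
  obtain ⟨-, -, h10⟩ := even_apply_eq_zero (conj_mem_ospPart P hX.1) h2
  obtain ⟨b, hb⟩ := exists_pos (n := n) (k := 0) (by omega)
  have hcol := pow_apply_first h10 hX.2
    (fun a b hab => regular_apply_ne_zero P h2 hX hreg hab) hb
  -- in the basis given by `P`, the vector `X ^ m t` is the first column of a power of a matrix
  have hpow : ∀ m, ((blk K n X).mulVecLin ^ m) (bvec P 0) =
      ∑ a, (conj P X ^ m) (.inr a) (.inr b) • bvec P (pos a) := by
    intro m
    induction m with
    | zero =>
      rw [Finset.sum_eq_single b]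
      · simp [hb]
      · intro c _ hc
        simp [hc]
      · simp
    | succ m ih =>
      have e1 : ∀ a, (blk K n X).mulVecLin (bvec P (pos a)) =
          ∑ c, conj P X (.inr c) (.inr a) • bvec P (pos c) := by
        intro a
        rw [Matrix.mulVecLin_apply, bvec, blk_mulVec_bvec P h2 hX.1, stdVec_pos,
          Matrix.mulVec_single_one, sum_smul_stdVec ((blk K n (conj P X)).col a), Matrix.mulVec_sum]
        simp only [Matrix.mulVec_smul]
        rfl
      rw [pow_succ', Module.End.mul_apply, ih, map_sum]
      simp only [map_smul, e1, Finset.smul_sum, smul_smul]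
      rw [Finset.sum_comm]
      refine Finset.sum_congr rfl fun c _ => ?_
      rw [← Finset.sum_smul, pow_succ', Matrix.mul_apply, Fintype.sum_sum_type]
      simp [h10, mul_comm]
  refine ⟨?_, ?_⟩
  · rw [hpow]
    refine Finset.sum_eq_zero fun a _ => ?_
    by_cases h0 : (conj P X ^ (2 * n)) (.inr a) (.inr b) = 0
    · rw [h0, zero_smul]
    · exact absurd ((hcol (2 * n) a).1 h0) (not_le.2 (pos_lt a))
  · obtain ⟨a, ha⟩ := exists_pos (n := n) (k := 2 * n - 1) (by omega)
    rw [hpow, map_sum, Finset.sum_eq_single a]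
    · rw [map_smul, symp_bvec P (by omega) (pos_lt a), antiForm, if_pos (by omega)]
      exact mul_ne_zero ((hcol (2 * n - 1) a).2 ha) (stdSign_ne_zero _)
    · intro c _ hc
      have hc' : pos c ≠ pos a := fun h => hc (pos_injective h)
      rw [map_smul, symp_bvec P (by omega) (pos_lt c), antiForm, if_neg (by omega), smul_zero]
    · simp

/-- A regular nilpotent character that vanishes on `n⁺` is given by a basis of the symplectic space
for which the form is antidiagonal and the character lives on the next antidiagonal. -/
theorem exists_regular_basis (h2 : (2 : K) ≠ 0) (hn : 1 ≤ n) {χ : ospPart K n 0 →ₗ[K] K}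
    (hreg : IsRegularNilpotent χ) (hχ : ∀ x : ospPart K n 0, x.1 ∈ nilPart P 0 → χ x = 0) :
    ∃ (t : ℕ → Fin n ⊕ Fin n → K) (c : ℕ → K), (∀ k, c k ≠ 0) ∧
      (∀ i j, symp K n (t i) (t j) = antiForm (2 * n) c i j) ∧
      (∀ i j, i + j + 2 < 2 * n → χ ⟨evenElt (t i) (t j), evenElt_mem _ _⟩ = 0) ∧
      (∀ i j, i + j + 2 = 2 * n → χ ⟨evenElt (t i) (t j), evenElt_mem _ _⟩ ≠ 0) := by
  obtain ⟨X, hX, hnil, hdim, hstr⟩ := hreg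
  have hXn : X ∈ nilPart P 0 := mem_nilPart_of_orthogonal P h2 hX hnil fun y hy => by
    rw [← hstr ⟨y, hy.1⟩]
    exact hχ ⟨y, hy.1⟩ hy
  obtain ⟨h1, h3⟩ := conj_mem_of_regular P h2 hXn hn hdim
  set B := (blk K n X).mulVecLin with hB
  have hskew : ∀ x y, symp K n (B x) y = - symp K n x (B y) := fun x y => symp_blk hX x y
  obtain ⟨t, ht, ht0⟩ := exists_antidiagonal_cyclic h2 symp_swap hskew h1 h3
  have hform : ∀ i j, symp K n ((B ^ i) t) ((B ^ j) t) =
      (-1) ^ i * symp K n t ((B ^ (i + j)) t) := by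
    intro i j
    rw [skew_pow hskew, ← Module.End.mul_apply, ← pow_add]
  have hchar : ∀ i j, χ ⟨evenElt ((B ^ i) t) ((B ^ j) t), evenElt_mem _ _⟩ =
      -2 * ((-1) ^ (i + 1) * symp K n t ((B ^ (i + j + 1)) t)) := by
    intro i j
    rw [hstr, supertrace_mul_evenElt hX h2, ← Matrix.mulVecLin_apply, ← hB, ← Module.End.mul_apply,
      ← pow_succ', hform, add_right_comm]
  refine ⟨fun i => (B ^ i) t, fun i => (-1) ^ i * symp K n t ((B ^ (2 * n - 1)) t), fun k => ?_,
    fun i j => ?_, fun i j hij => ?_, fun i j hij => ?_⟩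
  · exact mul_ne_zero (pow_ne_zero _ (neg_ne_zero.2 one_ne_zero)) ht
  · rw [hform, antiForm]
    split_ifs with h
    · rw [show i + j = 2 * n - 1 by omega]
    · rw [ht0 _ (by omega), mul_zero]
  · rw [hchar, ht0 _ (by omega), mul_zero, mul_zero]
  · rw [hchar, show i + j + 1 = 2 * n - 1 by omega]
    exact mul_ne_zero (neg_ne_zero.2 h2)
      (mul_ne_zero (pow_ne_zero _ (neg_ne_zero.2 one_ne_zero)) ht)

end Regular

section Bound

variable {K : Type*} [Field K] [IsAlgClosed K] {n p : ℕ} [Fact p.Prime] [CharP K p]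

/-- For a regular nilpotent character, the dimension of a nonzero module with a parity operator is at
least that of `U_χ(n⁻)`. -/
theorem bvDim_le_finrank (h2 : (2 : K) ≠ 0) (hn : 1 ≤ n) (P : Matrix.symplecticGroup (Fin n) K)
    {χ : (osp K n p).part 0 →ₗ[K] K} (hreg : IsRegularNilpotent χ)
    (hχ : ∀ x : (osp K n p).part 0, x.1 ∈ nilPart P 0 → χ x = 0)
    {M : Type*} [AddCommGroup M] [Module K M] [FiniteDimensional K M] [Nontrivial M]
    {a : (Fin n ⊕ Fin n → K) →ₗ[K] Module.End K M} (ha : IsParaHom χ a)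
    (s : Module.End K M) (hs : s * s = 1) (hsa : ∀ w, s * a w = -(a w * s)) :
    bvDim p n ≤ Module.finrank K M := by
  obtain ⟨t, c, hc, hform, h0, hne⟩ := exists_regular_basis P h2 hn hreg hχ
  have : CharP (Module.End K M) p :=
    charP_of_injective_algebraMap (algebraMap K (Module.End K M)).injective p
  obtain ⟨φ, hφ⟩ := ha.exists_algHom h2
  refine IsWhittaker.bvDim_le (n := n) (p := p) (c := c) (a := fun k => a (t k))
    (χ := fun i j => χ ⟨evenElt (t i) (t j), evenElt_mem _ _⟩) ?_ hn s hs (fun k _ => hsa _)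
  refine ⟨ha.isParabose fun k j _ _ => hform k j, h2, fun k _ => hc k, fun i j => ?_, h0, hne,
    fun i j hij => ?_⟩
  · simp only [evenElt_comm]
  · have h1 : anti (fun k => a (t k)) i j =
        φ (evenGen χ ⟨evenElt (t i) (t j), evenElt_mem _ _⟩) := by
      rw [algHom_evenGen, hφ, hφ, anti]
    have h3 := evenGen_pow χ ⟨evenElt (t i) (t j), evenElt_mem _ _⟩
    rw [pmap_evenElt h2 (by rw [hform, antiForm, if_neg (by omega)]), map_zero, sub_zero] at h3
    rw [h1, ← Algebra.algebraMap_eq_smul_one,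
      sub_pow_char_of_commute (p := p) (Algebra.commutes _ _).symm, ← map_pow, h3, AlgHom.commutes,
      ← (algebraMap K (Module.End K M)).map_pow, sub_self]

end Bound

/-! ### Tensor products of representations -/

section Tensor

variable {K : Type*} [Field K] {n p : ℕ} [Fact p.Prime] [CharP K p]
  {χ₁ χ₂ : (osp K n p).part 0 →ₗ[K] K}

/-- Super tensor product of paraboson operators: `s` is a parity operator for the first factor, and
the operators of the second factor commute with those of the first. -/
theorem IsParaHom.superAdd {B : Type*} [Ring B] [Algebra K B] {a₁ a₂ : (Fin n ⊕ Fin n → K) →ₗ[K] B}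
    (h₁ : IsParaHom χ₁ a₁) (h₂ : IsParaHom χ₂ a₂) {s : B} (hs : s * s = 1)
    (hs₁ : ∀ w, s * a₁ w = -(a₁ w * s)) (hs₂ : ∀ w, Commute s (a₂ w))
    (h₁₂ : ∀ w w', Commute (a₁ w) (a₂ w')) :
    IsParaHom (χ₁ + χ₂) (a₁ + LinearMap.mulLeft K s ∘ₗ a₂) := by
  have hval : ∀ w, (a₁ + LinearMap.mulLeft K s ∘ₗ a₂) w = a₁ w + s * a₂ w := fun w => rfl
  have hprod : ∀ w w', (a₁ w + s * a₂ w) * (a₁ w' + s * a₂ w') =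
      a₁ w * a₁ w' + a₂ w * a₂ w' + (a₁ w * s * a₂ w' - a₁ w' * s * a₂ w) := by
    intro w w'
    have e1 : s * a₂ w * (s * a₂ w') = a₂ w * a₂ w' := by
      rw [((hs₂ w).symm).mul_mul_mul_comm, hs, one_mul]
    have e2 : s * a₂ w * a₁ w' = -(a₁ w' * s * a₂ w) := by
      rw [mul_assoc, ← (h₁₂ w' w).eq, ← mul_assoc, hs₁, neg_mul]
    rw [add_mul, mul_add, mul_add, e1, e2]
    noncomm_ring
  have hq : ∀ w w', (a₁ w + s * a₂ w) * (a₁ w' + s * a₂ w') +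
      (a₁ w' + s * a₂ w') * (a₁ w + s * a₂ w) =
      (a₁ w * a₁ w' + a₁ w' * a₁ w) + (a₂ w * a₂ w' + a₂ w' * a₂ w) := by
    intro w w'
    rw [hprod, hprod]
    abel
  refine ⟨fun w w' z => ?_, fun w => ?_⟩
  · rw [hval, hval, hval, hq]
    have e1 : Commute (a₁ w * a₁ w' + a₁ w' * a₁ w) s := by
      have : ∀ u u', a₁ u * a₁ u' * s = s * (a₁ u * a₁ u') := by
        intro u u'
        rw [← mul_assoc, hs₁, neg_mul, mul_assoc (a₁ u) s, hs₁, mul_neg, neg_neg, mul_assoc]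
      change _ * s = s * _
      rw [add_mul, mul_add, this, this]
    have e2 : Commute (a₁ w * a₁ w' + a₁ w' * a₁ w) (a₂ z) :=
      ((h₁₂ w z).mul_left (h₁₂ w' z)).add_left ((h₁₂ w' z).mul_left (h₁₂ w z))
    have e3 : Commute (a₂ w * a₂ w' + a₂ w' * a₂ w) (a₁ z) :=
      (((h₁₂ z w).mul_right (h₁₂ z w')).add_right ((h₁₂ z w').mul_right (h₁₂ z w))).symm
    have e4 : Commute (a₂ w * a₂ w' + a₂ w' * a₂ w) s :=
      (((hs₂ w).mul_right (hs₂ w')).add_right ((hs₂ w').mul_right (hs₂ w))).symm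
    have e5 : Commute (a₁ w * a₁ w' + a₁ w' * a₁ w) (s * a₂ z) := e1.mul_right e2
    have e6 : (a₂ w * a₂ w' + a₂ w' * a₂ w) * (s * a₂ z) -
        (s * a₂ z) * (a₂ w * a₂ w' + a₂ w' * a₂ w) =
        s * (symp K n z w' • a₂ w + symp K n z w • a₂ w') := by
      rw [← mul_assoc, e4.eq, mul_assoc, mul_assoc, ← mul_sub, h₂.rel]
    have e7 := h₁.rel w w' z
    rw [mul_add s (symp K n z w' • a₂ w), mul_smul_comm, mul_smul_comm] at e6
    rw [smul_add, smul_add, add_add_add_comm (symp K n z w' • a₁ w), ← e7, ← e6]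
    have e8 := e5.eq
    have e9 := e3.eq
    generalize a₁ w * a₁ w' + a₁ w' * a₁ w = Q₁ at e8 ⊢
    generalize a₂ w * a₂ w' + a₂ w' * a₂ w = Q₂ at e9 ⊢
    rw [add_mul, mul_add Q₁, mul_add Q₂, add_mul, mul_add (a₁ z), mul_add (s * a₂ z), e8, e9]
    abel
  · rcases subsingleton_or_nontrivial B with hB | hB
    · exact Subsingleton.elim _ _
    have : CharP B p := charP_of_injective_algebraMap (algebraMap K B).injective p
    rw [hval, hprod, sub_self, add_zero, smul_add, add_pow_char_of_commute (p := p), h₁.pow, h₂.pow,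
      ← map_add, LinearMap.add_apply, ← add_pow_char]
    have hc : Commute (a₁ w * a₁ w) (a₂ w * a₂ w) :=
      ((h₁₂ w w).mul_right (h₁₂ w w)).mul_left ((h₁₂ w w).mul_right (h₁₂ w w))
    exact (hc.smul_left _).smul_right _

variable {M N : Type*} [AddCommGroup M] [Module K M] [AddCommGroup N] [Module K N]

/-- Tensor products of representations that need not be graded: the first factor is replaced by two
copies of itself, of opposite parities. -/
theorem IsParaHom.exists_tensor {a₁ : (Fin n ⊕ Fin n → K) →ₗ[K] Module.End K M}
    {a₂ : (Fin n ⊕ Fin n → K) →ₗ[K] Module.End K N} (h₁ : IsParaHom χ₁ a₁) (h₂ : IsParaHom χ₂ a₂) :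
    ∃ a : (Fin n ⊕ Fin n → K) →ₗ[K] Module.End K ((M × M) ⊗[K] N), 
      IsParaHom (B := Module.End K ((M × M) ⊗[K] N)) (χ₁ + χ₂) a ∧
      (∀ w x z, a w ((x, 0) ⊗ₜ z) = (0, a₁ w x) ⊗ₜ z + (x, 0) ⊗ₜ a₂ w z) ∧
      (∀ w x z, a w ((0, x) ⊗ₜ z) = (a₁ w x, 0) ⊗ₜ z - (0, x) ⊗ₜ a₂ w z) := by
  let b : (Fin n ⊕ Fin n → K) →ₗ[K] Module.End K (M × M) :=
    { toFun := fun w => (a₁ w ∘ₗ LinearMap.snd K M M).prod (a₁ w ∘ₗ LinearMap.fst K M M)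
      map_add' := fun w w' => by ext <;> simp
      map_smul' := fun c w => by ext <;> simp }
  have hb : ∀ w x, b w x = (a₁ w x.2, a₁ w x.1) := fun w x => rfl
  let s : Module.End K (M × M) := LinearMap.prodMap 1 (-1)
  have hs : ∀ x, s x = (x.1, -x.2) := fun x => rfl
  have hbp : IsParaHom χ₁ b := by
    refine ⟨fun w w' z => LinearMap.ext fun x => ?_, fun w => LinearMap.ext fun x => ?_⟩
    · have e1 := LinearMap.congr_fun (h₁.rel w w' z) x.1
      have e2 := LinearMap.congr_fun (h₁.rel w w' z) x.2
      simp only [LinearMap.sub_apply, LinearMap.add_apply, Module.End.mul_apply,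
        LinearMap.smul_apply] at e1 e2
      simp only [LinearMap.sub_apply, LinearMap.add_apply, Module.End.mul_apply,
        LinearMap.smul_apply, hb]
      exact Prod.ext e2 e1
    · have e3 : ∀ m x, (((2 : K) • (b w * b w)) ^ m) x =
          ((((2 : K) • (a₁ w * a₁ w)) ^ m) x.1, (((2 : K) • (a₁ w * a₁ w)) ^ m) x.2) := by
        intro m
        induction m with
        | zero => intro x; rfl
        | succ m ih =>
          intro x
          rw [pow_succ, Module.End.mul_apply, ih, pow_succ, Module.End.mul_apply,
            Module.End.mul_apply]
          rfl
      rw [e3, h₁.pow, Module.algebraMap_end_apply, Module.algebraMap_end_apply,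
        Module.algebraMap_end_apply]
      rfl
  have hcomm : ∀ (f : Module.End K (M × M)) (g : Module.End K N),
      Commute (Module.End.rTensorAlgHom K (M × M) N f) (Module.End.lTensorAlgHom K N (M × M) g) := by
    intro f g
    change LinearMap.rTensor N f ∘ₗ LinearMap.lTensor (M × M) g =
      LinearMap.lTensor (M × M) g ∘ₗ LinearMap.rTensor N f
    rw [LinearMap.rTensor_comp_lTensor, LinearMap.lTensor_comp_rTensor]
  refine ⟨_, (hbp.comp (Module.End.rTensorAlgHom K (M × M) N)).superAdd
    (h₂.comp (Module.End.lTensorAlgHom K N (M × M))) (s := Module.End.rTensorAlgHom K (M × M) N s)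
    ?_ (fun w => ?_) (fun w => hcomm _ _) (fun w w' => hcomm _ _), fun w x z => ?_, fun w x z => ?_⟩
  · rw [← map_mul, ← map_one (Module.End.rTensorAlgHom K (M × M) N)]
    congr 1
    ext <;> simp [s]
  · rw [LinearMap.comp_apply, AlgHom.toLinearMap_apply, ← map_mul, ← map_mul, ← map_neg]
    congr 1
    refine LinearMap.ext fun x => ?_
    simp [hs, hb]
  · change b w (x, 0) ⊗ₜ[K] z + s (x, 0) ⊗ₜ[K] a₂ w z = _
    rw [hb, hs, map_zero, neg_zero]
  · change b w (0, x) ⊗ₜ[K] z + s (0, x) ⊗ₜ[K] a₂ w z = _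
    rw [hb, hs, map_zero, sub_eq_add_neg, ← TensorProduct.neg_tmul]
    simp

end Tensor

/-! ### Weights of highest weight vectors -/

section HW

variable {K : Type*} [Field K] {n : ℕ} (p : ℕ) [Fact p.Prime] [CharP K p]
  (P : Matrix.symplecticGroup (Fin n) K)

/-- A basis of the Cartan subalgebra. -/
def cartanElt (k : Fin n) : (cartan p P).part 0 :=
  ⟨evenElt (bvec P k) (bvec P (2 * n - 1 - k)), evenElt_bvec_mem_cartan P p (by omega)⟩

variable {p P}

theorem mem_of_cartanElt_mem (h2 : (2 : K) ≠ 0) {T : Submodule K ((cartan p P).part 0)}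
    (hT : ∀ k, cartanElt p P k ∈ T) (h : (cartan p P).part 0) : h ∈ T := by
  have h1 := cartan_induction (P := P) h2
    (T := T.map (Submodule.inclusion (cartan_le_osp p P 0))) (fun k hk => ?_)
    (Submodule.inclusion (cartan_le_osp p P 0) h) h.2
  · obtain ⟨y, hy, hyh⟩ := h1
    rwa [← Submodule.inclusion_injective _ hyh]
  · by_cases hkn : k < n
    · exact ⟨_, hT ⟨k, hkn⟩, rfl⟩
    · refine ⟨_, hT ⟨2 * n - 1 - k, by omega⟩, Subtype.ext ?_⟩
      change evenElt (bvec P (2 * n - 1 - k)) (bvec P (2 * n - 1 - (2 * n - 1 - k))) = _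
      rw [show 2 * n - 1 - (2 * n - 1 - k) = k by omega, evenElt_comm]

/-- Nonzero highest weight vectors of weight `l` in some representation, in terms of paraboson
operators. -/
structure IsHWVec {M : Type*} [AddCommGroup M] [Module K M] (P : Matrix.symplecticGroup (Fin n) K)
    (a : (Fin n ⊕ Fin n → K) →ₗ[K] Module.End K M) (v : M)
    (l : (SuperLie.cartan p P).part 0 →ₗ[K] K) : Prop where
  ne_zero : v ≠ 0
  odd : ∀ k, n ≤ k → k < 2 * n → a (bvec P k) v = 0
  even : ∀ k j, k < 2 * n → j < 2 * n → 2 * n ≤ k + j →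
    a (bvec P k) (a (bvec P j) v) + a (bvec P j) (a (bvec P k) v) = 0
  cartan : ∀ k : Fin n, a (bvec P k) (a (bvec P (2 * n - 1 - k)) v) +
    a (bvec P (2 * n - 1 - k)) (a (bvec P k) v) = l (cartanElt p P k) • v

theorem IsHWVec.isHW (h2 : (2 : K) ≠ 0) {M : Type*} [AddCommGroup M] [Module K M]
    {a : (Fin n ⊕ Fin n → K) →ₗ[K] Module.End K M} {v : M} {l : (SuperLie.cartan p P).part 0 →ₗ[K] K}
    (h : IsHWVec P a v l) {χ : (osp K n p).part 0 →ₗ[K] K}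
    {φ : RedEnv (osp K n p) χ →ₐ[K] Module.End K M} (hφ : ∀ w, φ (oddGen χ w) = a w) :
    IsHW P φ v l := by
  refine ⟨fun k hk hk2 => ?_, fun k j hk hj hkj => ?_, fun x => ?_⟩
  · rw [hφ, h.odd k hk hk2]
  · rw [algHom_evenGen, hφ, hφ]
    exact h.even k j hk hj hkj
  · let f : (SuperLie.cartan p P).part 0 →ₗ[K] M := LinearMap.applyₗ v ∘ₗ φ.toLinearMap ∘ₗ
      evenGen χ ∘ₗ Submodule.inclusion (cartan_le_osp p P 0) - LinearMap.toSpanSingleton K M v ∘ₗ l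
    have h1 : x ∈ LinearMap.ker f := by
      refine mem_of_cartanElt_mem h2 (fun k => ?_) x
      have h3 := algHom_evenGen φ (bvec P k) (bvec P (2 * n - 1 - k))
      rw [hφ, hφ] at h3
      have h4 := (LinearMap.congr_fun h3 v).trans (h.cartan k)
      exact sub_eq_zero.2 h4
    exact sub_eq_zero.1 h1

theorem IsHWVec.tensor {M N : Type*} [AddCommGroup M] [Module K M] [AddCommGroup N] [Module K N]
    {a₁ : (Fin n ⊕ Fin n → K) →ₗ[K] Module.End K M} {a₂ : (Fin n ⊕ Fin n → K) →ₗ[K] Module.End K N}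
    {a : (Fin n ⊕ Fin n → K) →ₗ[K] Module.End K ((M × M) ⊗[K] N)}
    (ha : ∀ w x z, a w ((x, 0) ⊗ₜ z) = (0, a₁ w x) ⊗ₜ z + (x, 0) ⊗ₜ a₂ w z)
    (ha' : ∀ w x z, a w ((0, x) ⊗ₜ z) = (a₁ w x, 0) ⊗ₜ z - (0, x) ⊗ₜ a₂ w z)
    {v₁ : M} {v₂ : N} {l₁ l₂ : (SuperLie.cartan p P).part 0 →ₗ[K] K}
    (h₁ : IsHWVec P a₁ v₁ l₁) (h₂ : IsHWVec P a₂ v₂ l₂) :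
    IsHWVec P a (((v₁, 0) : M × M) ⊗ₜ[K] v₂) (l₁ + l₂) := by
  have hq : ∀ w w', a w (a w' ((v₁, 0) ⊗ₜ v₂)) + a w' (a w ((v₁, 0) ⊗ₜ v₂)) =
      ((a₁ w (a₁ w' v₁) + a₁ w' (a₁ w v₁), 0) : M × M) ⊗ₜ v₂ +
      ((v₁, 0) : M × M) ⊗ₜ (a₂ w (a₂ w' v₂) + a₂ w' (a₂ w v₂)) := by
    intro w w'
    have e1 : ((a₁ w (a₁ w' v₁) + a₁ w' (a₁ w v₁), 0) : M × M) =
      (a₁ w (a₁ w' v₁), 0) + (a₁ w' (a₁ w v₁), 0) := by simp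
    rw [ha, ha, map_add, map_add, ha', ha', ha, ha, e1, TensorProduct.add_tmul,
      TensorProduct.tmul_add]
    abel
  have z0 : ((0, 0) : M × M) = 0 := rfl
  refine ⟨?_, fun k hk hk2 => ?_, fun k j hk hj hkj => ?_, fun k => ?_⟩
  · obtain ⟨f, hf⟩ := Module.Projective.exists_dual_ne_zero K h₁.ne_zero
    obtain ⟨g, hg⟩ := Module.Projective.exists_dual_ne_zero K h₂.ne_zero
    intro h0
    have := congrArg ((TensorProduct.lid K K).toLinearMap ∘ₗ
      TensorProduct.map (f ∘ₗ LinearMap.fst K M M) g) h0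
    simp [hf, hg] at this
  · rw [ha, h₁.odd k hk hk2, h₂.odd k hk hk2, z0, TensorProduct.zero_tmul, TensorProduct.tmul_zero, add_zero]
  · rw [hq, h₁.even k j hk hj hkj, h₂.even k j hk hj hkj, z0, TensorProduct.zero_tmul,
      TensorProduct.tmul_zero, add_zero]
  · have e1 : ((l₁ (cartanElt p P k) • v₁, 0) : M × M) = l₁ (cartanElt p P k) • (v₁, 0) := by simp
    rw [hq, h₁.cartan, h₂.cartan, LinearMap.add_apply, add_smul, e1, TensorProduct.tmul_smul,
      TensorProduct.smul_tmul', TensorProduct.smul_tmul']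

end HW

/-! ### Highest weights of modules with trivial character -/

section WeylClifford

variable {K : Type*} [Field K] {n p : ℕ} [Fact p.Prime] [CharP K p] {B : Type*} [Ring B]
  [Algebra K B]

theorem weylClifford_anti {D X : B} {e i : (Fin n ⊕ Fin n → K) →ₗ[K] B}
    (hDX : D * X = X * D + 1) (hDe : ∀ w, Commute D (e w)) (hDi : ∀ w, Commute D (i w))
    (hXe : ∀ w, Commute X (e w)) (hXi : ∀ w, Commute X (i w))
    (hee : ∀ w w', e w * e w' = -(e w' * e w)) (hii : ∀ w w', i w * i w' = -(i w' * i w))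
    (hie : ∀ w w', i w * e w' = symp K n w' w • 1 - e w' * i w) (w w' : Fin n ⊕ Fin n → K) :
    (D * e w + X * i w) * (D * e w' + X * i w') + (D * e w' + X * i w') * (D * e w + X * i w) =
      e w * i w' + e w' * i w := by
  have e1 : ∀ u u', (D * e u + X * i u) * (D * e u' + X * i u') = D * D * (e u * e u') +
      (X * D + 1) * (e u * i u') + X * D * (i u * e u') + X * X * (i u * i u') := by
    intro u u'
    rw [add_mul, mul_add, mul_add, (hDe u).symm.mul_mul_mul_comm, (hXe u).symm.mul_mul_mul_comm,
      (hDi u).symm.mul_mul_mul_comm, (hXi u).symm.mul_mul_mul_comm, hDX]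
    abel
  rw [e1, e1, hee w' w, hii w' w, hie, hie, symp_swap w w', neg_smul]
  noncomm_ring

/-- The action of `osp(1|2n)` by superderivations on the supersymmetric algebra of the natural
representation, in terms of a Weyl algebra for the even part of the natural representation and a
Clifford algebra for its odd part. -/
theorem isParaHom_weylClifford (h2 : (2 : K) ≠ 0) {D X : B} {e i : (Fin n ⊕ Fin n → K) →ₗ[K] B}
    (hDX : D * X = X * D + 1) (hDe : ∀ w, Commute D (e w)) (hDi : ∀ w, Commute D (i w))
    (hXe : ∀ w, Commute X (e w)) (hXi : ∀ w, Commute X (i w))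
    (hee : ∀ w w', e w * e w' = -(e w' * e w)) (hii : ∀ w w', i w * i w' = -(i w' * i w))
    (hie : ∀ w w', i w * e w' = symp K n w' w • 1 - e w' * i w) :
    IsParaHom (0 : (osp K n p).part 0 →ₗ[K] K)
      (LinearMap.mulLeft K D ∘ₗ e + LinearMap.mulLeft K X ∘ₗ i) := by
  have hval : ∀ w, (LinearMap.mulLeft K D ∘ₗ e + LinearMap.mulLeft K X ∘ₗ i) w =
    D * e w + X * i w := fun w => rfl
  have hanti := weylClifford_anti hDX hDe hDi hXe hXi hee hii hie
  refine ⟨fun w w' z => ?_, fun w => ?_⟩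
  · rw [hval, hval, hval, hanti]
    have e1 : ∀ u u', e u * i u' * e z = symp K n z u' • e u + e z * (e u * i u') := by
      intro u u'
      rw [mul_assoc, hie, mul_sub, mul_smul_comm, mul_one, ← mul_assoc, hee u z]
      noncomm_ring
    have e3 : ∀ u u', e u * i u' * i z = symp K n z u • i u' + i z * (e u * i u') := by
      intro u u'
      rw [mul_assoc, hii, ← mul_assoc (i z), hie, symp_swap u z, neg_smul, sub_mul, neg_mul,
        smul_mul_assoc, one_mul]
      noncomm_ring
    have e4 : ∀ u u', Commute D (e u * i u') := fun u u' => (hDe u).mul_right (hDi u')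
    have e5 : ∀ u u', Commute X (e u * i u') := fun u u' => (hXe u).mul_right (hXi u')
    have e6 : ∀ u u', e u * i u' * (D * e z + X * i z) - (D * e z + X * i z) * (e u * i u') =
        symp K n z u' • (D * e u) + symp K n z u • (X * i u') := by
      intro u u'
      have e7 : e u * i u' * (D * e z) = D * (e u * i u' * e z) := by
        rw [← mul_assoc, ← (e4 u u').eq, mul_assoc]
      have e8 : e u * i u' * (X * i z) = X * (e u * i u' * i z) := by
        rw [← mul_assoc, ← (e5 u u').eq, mul_assoc]
      rw [mul_add, e7, e8, e1, e3, mul_add, mul_add, mul_smul_comm, mul_smul_comm, add_mul,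
        mul_assoc D, mul_assoc X]
      abel
    rw [add_mul, mul_add (D * e z + X * i z), add_sub_add_comm, e6, e6, smul_add, smul_add]
    abel
  · rw [hval]
    have h1 : (2 : K) • ((D * e w + X * i w) * (D * e w + X * i w)) = (2 : K) • (e w * i w) := by
      rw [two_smul, hanti, two_smul]
    have h3 : (e w * i w) * (e w * i w) = 0 := by
      have hee0 : e w * e w = 0 := by
        have h4 := hee w w
        have h5 : (2 : K) • (e w * e w) = 0 := by
          rw [two_smul]; nth_rewrite 1 [h4]; exact neg_add_cancel _
        exact (smul_eq_zero_iff_right h2).1 h5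
      rw [mul_assoc, ← mul_assoc (i w), hie, symp_self h2, zero_smul, zero_sub, neg_mul, mul_neg,
        ← mul_assoc, ← mul_assoc, hee0, zero_mul, zero_mul, neg_zero]
    obtain ⟨q, hq⟩ := Nat.exists_eq_add_of_le (Fact.out : p.Prime).two_le
    have h4 : (e w * i w) ^ p = 0 := by rw [hq, pow_add, pow_two, h3, zero_mul]
    rw [h1, smul_pow, h4, smul_zero, LinearMap.zero_apply,
      zero_pow (Fact.out : p.Prime).ne_zero, map_zero]

end WeylClifford

section Fock

variable (K : Type*) [Field K] (n : ℕ)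

/-- The exterior algebra of the odd part of the natural representation. -/
abbrev Ext : Type _ := CliffordAlgebra (0 : QuadraticForm K (Fin n ⊕ Fin n → K))

variable {K n}

/-- Exterior multiplication, coefficientwise on sequences. -/
noncomputable def extMul : (Fin n ⊕ Fin n → K) →ₗ[K] Module.End K (ℕ → Ext K n) where
  toFun w := (LinearMap.mulLeft K (CliffordAlgebra.ι _ w)).compLeft ℕ
  map_add' w w' := by ext f m; simp [add_mul]
  map_smul' c w := by ext f m; simp

/-- Contraction with the functional defined by a vector, coefficientwise on sequences. -/
noncomputable def extContract : (Fin n ⊕ Fin n → K) →ₗ[K] Module.End K (ℕ → Ext K n) where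
  toFun w := (CliffordAlgebra.contractLeft ((symp K n).flip w)).compLeft ℕ
  map_add' w w' := by ext f m; simp
  map_smul' c w := by ext f m; simp

/-- Sequences as divided power series in the even variable: this is the derivative. -/
def seqD : Module.End K (ℕ → Ext K n) := LinearMap.funLeft K _ (· + 1)

/-- Sequences as divided power series in the even variable: this is multiplication by the variable. -/
def seqX : Module.End K (ℕ → Ext K n) where
  toFun f m := (m : K) • f (m - 1)
  map_add' f g := by ext m; simp
  map_smul' c f := by ext m; simp [smul_comm c]

theorem seqD_mul_seqX : (seqD * seqX : Module.End K (ℕ → Ext K n)) = seqX * seqD + 1 := by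
  refine LinearMap.ext fun f => funext fun m => ?_
  change ((m + 1 : ℕ) : K) • f (m + 1 - 1) = (m : K) • f (m - 1 + 1) + f m
  cases m with
  | zero => simp
  | succ m => simp [add_smul]

/-- The operators of the action of `osp(1|2n)` on the supersymmetric algebra. -/
noncomputable def fock : (Fin n ⊕ Fin n → K) →ₗ[K] Module.End K (ℕ → Ext K n) :=
  LinearMap.mulLeft K seqD ∘ₗ extMul + LinearMap.mulLeft K seqX ∘ₗ extContract

theorem ext_relations :
    (∀ w, Commute (seqD (K := K) (n := n)) (extMul w)) ∧
    (∀ w, Commute (seqD (K := K) (n := n)) (extContract w)) ∧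
    (∀ w, Commute (seqX (K := K) (n := n)) (extMul w)) ∧
    (∀ w, Commute (seqX (K := K) (n := n)) (extContract w)) ∧
    (∀ w w', extMul (K := K) (n := n) w * extMul w' = -(extMul w' * extMul w)) ∧
    (∀ w w', extContract (K := K) (n := n) w * extContract w' = -(extContract w' * extContract w)) ∧
    (∀ w w', extContract (K := K) (n := n) w * extMul w' =
      symp K n w' w • 1 - extMul w' * extContract w) := by
  refine ⟨fun w => rfl, fun w => rfl, fun w => ?_, fun w => ?_, fun w w' => ?_, fun w w' => ?_,
    fun w w' => ?_⟩ <;> refine LinearMap.ext fun f => funext fun m => ?_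
  · exact (mul_smul_comm (m : K) (CliffordAlgebra.ι _ w) (f (m - 1))).symm
  · exact (map_smul (CliffordAlgebra.contractLeft ((symp K n).flip w)) (m : K) (f (m - 1))).symm
  · change CliffordAlgebra.ι _ w * (CliffordAlgebra.ι _ w' * f m) =
      -(CliffordAlgebra.ι _ w' * (CliffordAlgebra.ι _ w * f m))
    have := CliffordAlgebra.ι_mul_ι_add_swap (Q := (0 : QuadraticForm K (Fin n ⊕ Fin n → K))) w w'
    rw [show QuadraticMap.polar (0 : QuadraticForm K (Fin n ⊕ Fin n → K)) w w' = 0 by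
      simp [QuadraticMap.polar], map_zero] at this
    rw [← mul_assoc, ← mul_assoc, eq_neg_of_add_eq_zero_left this, neg_mul]
  · exact CliffordAlgebra.contractLeft_comm _ _ (f m)
  · exact CliffordAlgebra.contractLeft_ι_mul _ _ (f m)

theorem isParaHom_fock (p : ℕ) [Fact p.Prime] [CharP K p] (h2 : (2 : K) ≠ 0) :
    IsParaHom (0 : (osp K n p).part 0 →ₗ[K] K) (fock (K := K) (n := n)) := by
  obtain ⟨h1, h3, h4, h5, h6, h7, h8⟩ := ext_relations (K := K) (n := n)
  exact isParaHom_weylClifford h2 seqD_mul_seqX h1 h3 h4 h5 h6 h7 h8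

theorem fock_anti (w w' : Fin n ⊕ Fin n → K) (x : Ext K n) :
    fock w (fock w' (Pi.single 0 x)) + fock w' (fock w (Pi.single 0 x)) =
      Pi.single 0 (CliffordAlgebra.ι _ w * CliffordAlgebra.contractLeft ((symp K n).flip w') x +
        CliffordAlgebra.ι _ w' * CliffordAlgebra.contractLeft ((symp K n).flip w) x) := by
  obtain ⟨h1, h3, h4, h5, h6, h7, h8⟩ := ext_relations (K := K) (n := n)
  have h := LinearMap.congr_fun (weylClifford_anti seqD_mul_seqX h1 h3 h4 h5 h6 h7 h8 w w')
    (Pi.single 0 x)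
  refine h.trans (funext fun m => ?_)
  change CliffordAlgebra.ι _ w * CliffordAlgebra.contractLeft ((symp K n).flip w')
    ((Pi.single 0 x : ℕ → Ext K n) m) + CliffordAlgebra.ι _ w' *
    CliffordAlgebra.contractLeft ((symp K n).flip w) ((Pi.single 0 x : ℕ → Ext K n) m) = _
  cases m with
  | zero => simp
  | succ m => simp

theorem fock_single (w : Fin n ⊕ Fin n → K) (x : Ext K n)
    (hx : CliffordAlgebra.contractLeft ((symp K n).flip w) x = 0) : fock w (Pi.single 0 x) = 0 := by
  refine funext fun m => ?_
  change CliffordAlgebra.ι _ w * ((Pi.single 0 x : ℕ → Ext K n) (m + 1)) +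
    (m : K) • CliffordAlgebra.contractLeft ((symp K n).flip w)
      ((Pi.single 0 x : ℕ → Ext K n) (m - 1)) = 0
  cases m with
  | zero => simp
  | succ m =>
    cases m with
    | zero => simp [hx]
    | succ m => simp

variable (P : Matrix.symplecticGroup (Fin n) K)

/-- The product of the last `r` vectors of the symplectic basis in the exterior algebra. -/
noncomputable def topWedge : ℕ → Ext K n
  | 0 => 1
  | r + 1 => CliffordAlgebra.ι _ (bvec P (2 * n - 1 - r)) * topWedge r

theorem ι_mul_topWedge {r k : ℕ} (hk : 2 * n ≤ k + r) (hk2 : k < 2 * n) :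
    CliffordAlgebra.ι _ (bvec P k) * topWedge P r = 0 := by
  induction r with
  | zero => omega
  | succ r ih =>
    rw [topWedge]
    by_cases h : k = 2 * n - 1 - r
    · rw [h, ← mul_assoc, CliffordAlgebra.ι_sq_scalar]
      simp
    · have := CliffordAlgebra.ι_mul_ι_add_swap (Q := (0 : QuadraticForm K (Fin n ⊕ Fin n → K)))
        (bvec P k) (bvec P (2 * n - 1 - r))
      rw [show QuadraticMap.polar (0 : QuadraticForm K (Fin n ⊕ Fin n → K)) (bvec P k)
        (bvec P (2 * n - 1 - r)) = 0 by simp [QuadraticMap.polar], map_zero] at this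
      rw [← mul_assoc, eq_neg_of_add_eq_zero_left this, neg_mul, mul_assoc, ih (by omega), mul_zero,
        neg_zero]

theorem contract_topWedge {r k : ℕ} (hr : r ≤ n) (hk : r ≤ k) (hk2 : k < 2 * n) :
    CliffordAlgebra.contractLeft ((symp K n).flip (bvec P k)) (topWedge P r) = 0 := by
  induction r with
  | zero => rw [topWedge, CliffordAlgebra.contractLeft_one]
  | succ r ih =>
    rw [topWedge, CliffordAlgebra.contractLeft_ι_mul, ih (by omega) (by omega), mul_zero, sub_zero,
      LinearMap.flip_apply, symp_bvec P (by omega) hk2, antiForm, if_neg (by omega), zero_smul]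

theorem topWedge_ne_zero {r : ℕ} (hr : r ≤ n) : topWedge P r ≠ 0 := by
  induction r with
  | zero =>
    rw [topWedge]
    have : Nontrivial (Ext K n) := inferInstanceAs (Nontrivial (ExteriorAlgebra K _))
    exact one_ne_zero
  | succ r ih =>
    intro h0
    have h := congrArg (CliffordAlgebra.contractLeft ((symp K n).flip (bvec P r))) h0
    rw [topWedge, CliffordAlgebra.contractLeft_ι_mul, contract_topWedge P (by omega) le_rfl (by omega),
      mul_zero, sub_zero, LinearMap.flip_apply, symp_bvec P (by omega) (by omega), antiForm,
      if_pos (by omega), map_zero] at h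
    exact (smul_ne_zero (stdSign_ne_zero _) (ih (by omega))) h

theorem ι_mul_contract {w w' : Fin n ⊕ Fin n → K} {x : Ext K n}
    (hx : CliffordAlgebra.ι _ w * x = 0) : CliffordAlgebra.ι _ w *
      CliffordAlgebra.contractLeft ((symp K n).flip w') x = symp K n w w' • x := by
  have h := CliffordAlgebra.contractLeft_ι_mul (d := (symp K n).flip w') (a := w) (b := x)
  rw [hx, map_zero] at h
  exact (sub_eq_zero.1 h.symm).symm

end Fock

section Weights

universe u

variable {K : Type u} [Field K] {n p : ℕ} [Fact p.Prime] [CharP K p]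
  {P : Matrix.symplecticGroup (Fin n) K}

/-- A nonzero vector annihilated by `n⁺` that is an eigenvector of a basis of the Cartan subalgebra
has a weight. -/
theorem exists_isHWVec (h2 : (2 : K) ≠ 0) {χ : (osp K n p).part 0 →ₗ[K] K}
    {M : Type*} [AddCommGroup M] [Module K M]
    {a : (Fin n ⊕ Fin n → K) →ₗ[K] Module.End K M} (ha : IsParaHom χ a) {v : M} (hv : v ≠ 0)
    (hodd : ∀ k, n ≤ k → k < 2 * n → a (bvec P k) v = 0)
    (heven : ∀ k j, k < 2 * n → j < 2 * n → 2 * n ≤ k + j →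
      a (bvec P k) (a (bvec P j) v) + a (bvec P j) (a (bvec P k) v) = 0)
    (hcartan : ∀ k : Fin n, ∃ c : K, a (bvec P k) (a (bvec P (2 * n - 1 - k)) v) +
      a (bvec P (2 * n - 1 - k)) (a (bvec P k) v) = c • v) :
    ∃ l : (cartan p P).part 0 →ₗ[K] K, IsHWVec P a v l := by
  obtain ⟨φ, hφ⟩ := ha.exists_algHom h2
  let f : (cartan p P).part 0 →ₗ[K] M := LinearMap.applyₗ v ∘ₗ φ.toLinearMap ∘ₗ
    evenGen χ ∘ₗ Submodule.inclusion (cartan_le_osp p P 0)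
  have hfk : ∀ k, f (cartanElt p P k) = a (bvec P k) (a (bvec P (2 * n - 1 - k)) v) +
      a (bvec P (2 * n - 1 - k)) (a (bvec P k) v) := by
    intro k
    have h1 := algHom_evenGen φ (bvec P k) (bvec P (2 * n - 1 - k))
    rw [hφ, hφ] at h1
    exact LinearMap.congr_fun h1 v
  have hf : ∀ x, f x ∈ Submodule.span K {v} := fun x =>
    mem_of_cartanElt_mem h2 (T := (Submodule.span K {v}).comap f) (fun k => by
      obtain ⟨c, hc⟩ := hcartan k
      rw [Submodule.mem_comap, hfk, hc]
      exact Submodule.smul_mem _ _ (Submodule.mem_span_singleton_self v)) x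
  let l : (cartan p P).part 0 →ₗ[K] K :=
    (LinearEquiv.toSpanNonzeroSingleton K M v hv).symm.toLinearMap ∘ₗ f.codRestrict _ hf
  refine ⟨l, hv, hodd, heven, fun k => ?_⟩
  rw [← hfk]
  exact (LinearEquiv.toSpanNonzeroSingleton_symm_apply_smul K M v hv
    (f.codRestrict _ hf (cartanElt p P k))).symm

theorem IsHWVec.mem_weights (h2 : (2 : K) ≠ 0) {χ : (osp K n p).part 0 →ₗ[K] K}
    {M : Type*} [AddCommGroup M] [Module K M]
    {a : (Fin n ⊕ Fin n → K) →ₗ[K] Module.End K M} (ha : IsParaHom χ a) {v : M}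
    {l : (SuperLie.cartan p P).part 0 →ₗ[K] K} (h : IsHWVec P a v l) : l ∈ weights p P χ := by
  obtain ⟨φ, hφ⟩ := ha.exists_algHom h2
  have hw := h.isHW h2 hφ
  intro x
  have h1 := evenGen_pow χ (Submodule.inclusion (cartan_le_osp p P 0) x)
  have h3 := LinearMap.congr_fun (congrArg φ h1) v
  have h4 : ∀ m : ℕ, (φ (evenGen χ (Submodule.inclusion (cartan_le_osp p P 0) x)) ^ m) v =
      l x ^ m • v := by
    intro m
    induction m with
    | zero => simp
    | succ m ih => rw [pow_succ, Module.End.mul_apply, hw.cartan, map_smul, ih, smul_smul, pow_succ']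
  rw [map_sub, map_pow, AlgHom.commutes, Module.algebraMap_end_apply, LinearMap.sub_apply, h4] at h3
  have h5 := hw.cartan ((SuperLie.cartan p P).pmap x)
  have h6 : (φ (evenGen χ ((osp K n p).pmap (Submodule.inclusion (cartan_le_osp p P 0) x)))) v =
      l ((SuperLie.cartan p P).pmap x) • v := h5
  rw [h6, ← sub_smul] at h3
  exact smul_left_injective K h.ne_zero h3

variable (P)

/-- Some representation with `p`-character `χ` has a nonzero highest weight vector of weight `l`. -/
def HasHW (χ : (osp K n p).part 0 →ₗ[K] K) (l : (cartan p P).part 0 →ₗ[K] K) : Prop :=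
  ∃ (M : Type u) (_ : AddCommGroup M) (_ : Module K M)
    (a : (Fin n ⊕ Fin n → K) →ₗ[K] Module.End K M) (v : M), IsParaHom χ a ∧ IsHWVec P a v l

variable {P}

theorem HasHW.add {χ₁ χ₂ : (osp K n p).part 0 →ₗ[K] K} {l₁ l₂ : (cartan p P).part 0 →ₗ[K] K}
    (h₁ : HasHW P χ₁ l₁) (h₂ : HasHW P χ₂ l₂) : HasHW P (χ₁ + χ₂) (l₁ + l₂) := by
  obtain ⟨M, _, _, a₁, v₁, ha₁, hv₁⟩ := h₁
  obtain ⟨N, _, _, a₂, v₂, ha₂, hv₂⟩ := h₂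
  obtain ⟨a, ha, h1, h2⟩ := ha₁.exists_tensor ha₂
  exact ⟨(M × M) ⊗[K] N, inferInstance, inferInstance, a, _, ha, hv₁.tensor h1 h2 hv₂⟩

variable (P) in
/-- The products of vectors of the symplectic basis in the exterior algebra are highest weight vectors
for the fundamental weights. -/
theorem exists_fundamental (p : ℕ) [Fact p.Prime] [CharP K p] (h2 : (2 : K) ≠ 0) {r : ℕ}
    (hr : r ≤ n) : ∃ l : (cartan p P).part 0 →ₗ[K] K, HasHW P 0 l ∧
      ∀ k : Fin n, l (cartanElt p P k) = if (k : ℕ) < r then -1 else 0 := by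
  have hne : (Pi.single 0 (topWedge P r) : ℕ → Ext K n) ≠ 0 :=
    fun h => topWedge_ne_zero P hr (by simpa using congrFun h 0)
  have hc : ∀ k : Fin n, fock (bvec P k) (fock (bvec P (2 * n - 1 - k)) (Pi.single 0 (topWedge P r))) +
      fock (bvec P (2 * n - 1 - k)) (fock (bvec P k) (Pi.single 0 (topWedge P r))) =
      (if (k : ℕ) < r then -1 else 0 : K) • (Pi.single 0 (topWedge P r) : ℕ → Ext K n) := by
    intro k
    have hk := k.2
    rw [fock_anti, contract_topWedge P hr (k := 2 * n - 1 - k) (by omega) (by omega), mul_zero,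
      zero_add, ← Pi.single_smul]
    congr 1
    split_ifs with h
    · rw [ι_mul_contract (ι_mul_topWedge P (by omega) (by omega)), symp_bvec P (by omega) (by omega),
        antiForm, if_pos (by omega), stdSign, if_neg (by omega)]
    · rw [contract_topWedge P hr (by omega) (by omega), mul_zero, zero_smul]
  obtain ⟨l, hl⟩ := exists_isHWVec (P := P) h2 (isParaHom_fock p h2) hne
    (fun k hk hk2 => fock_single _ _ (contract_topWedge P hr (by omega) hk2))
    (by
      have key : ∀ k j, k < 2 * n → j < 2 * n → 2 * n ≤ k + j → CliffordAlgebra.ι _ (bvec P k) *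
          CliffordAlgebra.contractLeft ((symp K n).flip (bvec P j)) (topWedge P r) = 0 := by
        intro k j hk hj hkj
        by_cases h : r ≤ j
        · rw [contract_topWedge P hr h hj, mul_zero]
        · rw [ι_mul_contract (ι_mul_topWedge P (by omega) hk), symp_bvec P hk hj, antiForm,
            if_neg (by omega), zero_smul]
      intro k j hk hj hkj
      rw [fock_anti, key k j hk hj hkj, key j k hj hk (by omega), add_zero, Pi.single_zero])
    (fun k => ⟨_, hc k⟩)
  refine ⟨l, ⟨_, inferInstance, inferInstance, fock, _, isParaHom_fock p h2, hl⟩, fun k => ?_⟩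
  exact smul_left_injective K hne ((hl.cartan k).symm.trans (hc k))

theorem exists_natCast_eq (p : ℕ) [Fact p.Prime] [CharP K p] {x : K} (hx : x ^ p = x) :
    ∃ m : ℕ, (m : K) = x := by
  rw [← Subfield.mem_bot_iff_pow_eq_self, ← ZMod.fieldRange_castHom_eq_bot p] at hx
  obtain ⟨y, rfl⟩ := hx
  exact ⟨y.val, by simp⟩

/-- Every functional on the Cartan subalgebra that takes values in the prime field on the basis is a
highest weight for the trivial character: it is a sum of fundamental weights. -/
theorem hasHW_zero_of_pow_eq (h2 : (2 : K) ≠ 0) (l : (cartan p P).part 0 →ₗ[K] K)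
    (hl : ∀ k, l (cartanElt p P k) ^ p = l (cartanElt p P k)) : HasHW P 0 l := by
  have hp2 : p ≠ 2 := by
    rintro rfl
    exact h2 (by exact_mod_cast CharP.cast_eq_zero K 2)
  have hodd : Odd p := (Fact.out : p.Prime).odd_of_ne_two hp2
  have hzero : HasHW P (0 : (osp K n p).part 0 →ₗ[K] K) 0 := by
    obtain ⟨l₀, h0, h1⟩ := exists_fundamental P p h2 (Nat.zero_le n)
    have h3 : l₀ = 0 := by
      ext x
      exact mem_of_cartanElt_mem h2 (T := LinearMap.ker l₀) (fun k => by
        rw [LinearMap.mem_ker, h1]; simp) x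
    rwa [h3] at h0
  have key : ∀ r, r ≤ n → ∀ l : (cartan p P).part 0 →ₗ[K] K,
      (∀ k : Fin n, r ≤ k → l (cartanElt p P k) = 0) →
      (∀ k, l (cartanElt p P k) ^ p = l (cartanElt p P k)) → HasHW P 0 l := by
    intro r
    induction r with
    | zero =>
      intro _ l h0 _
      have h3 : l = 0 := by
        ext x
        exact mem_of_cartanElt_mem h2 (T := LinearMap.ker l) (fun k => h0 k (Nat.zero_le _)) x
      rw [h3]
      exact hzero
    | succ r ih =>
      intro hr l h0 hl
      obtain ⟨μ, hμ, hμv⟩ := exists_fundamental P p h2 hr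
      obtain ⟨m, hm⟩ := exists_natCast_eq (K := K) p (x := -l (cartanElt p P ⟨r, hr⟩))
        (by rw [hodd.neg_pow, hl])
      have hmul : ∀ m : ℕ, HasHW P (0 : (osp K n p).part 0 →ₗ[K] K) (m • μ) := by
        intro m
        induction m with
        | zero => rw [zero_smul]; exact hzero
        | succ m ih' => rw [succ_nsmul, ← add_zero (0 : (osp K n p).part 0 →ₗ[K] K)]; exact ih'.add hμ
      have hval : ∀ k, (l - m • μ) (cartanElt p P k) =
          l (cartanElt p P k) + if (k : ℕ) < r + 1 then (m : K) else 0 := by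
        intro k
        rw [LinearMap.sub_apply, LinearMap.smul_apply, hμv, nsmul_eq_mul]
        split_ifs <;> ring
      have hsub : HasHW P (0 : (osp K n p).part 0 →ₗ[K] K) (l - m • μ) := by
        refine ih (by omega) _ (fun k hk => ?_) (fun k => ?_)
        · rw [hval]
          by_cases h : (k : ℕ) = r
          · have hk' : k = ⟨r, hr⟩ := Fin.ext h
            rw [if_pos (by omega), hm, hk', add_neg_cancel]
          · rw [if_neg (by omega), h0 k (by omega), add_zero]
        · rw [hval, add_pow_char, hl]
          congr 1
          split_ifs
          · rw [← map_natCast (ZMod.castHom (dvd_refl p) K), ← map_pow, ZMod.pow_card]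
          · exact zero_pow (Fact.out : p.Prime).ne_zero
      have := hsub.add (hmul m)
      rwa [sub_add_cancel, add_zero] at this
  exact key n le_rfl l (fun k hk => absurd k.2 (not_lt.2 hk)) hl

theorem evenElt_pow_of_symp_eq (h2 : (2 : K) ≠ 0) {w w' : Fin n ⊕ Fin n → K}
    (h : symp K n w w' ^ 2 = 1) {m : ℕ} (hm : Odd m) : evenElt w w' ^ m = evenElt w w' := by
  have h3 : blk K n (evenElt w w') * blk K n (evenElt w w') * blk K n (evenElt w w') =
      blk K n (evenElt w w') := by
    refine Matrix.toLin'.injective (LinearMap.ext fun y => ?_)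
    rw [Matrix.toLin'_apply, ← Matrix.mulVec_mulVec, ← Matrix.mulVec_mulVec, Matrix.toLin'_apply,
      blk_evenElt_mulVec, blk_evenElt_mulVec, blk_evenElt_mulVec]
    simp only [map_add, map_smul, LinearMap.add_apply, LinearMap.smul_apply, smul_eq_mul,
      symp_self h2, symp_swap w' w]
    have e1 : ∀ c : K, c * symp K n w w' * symp K n w w' = c := fun c => by
      rw [mul_assoc, ← pow_two, h, mul_one]
    simp [e1]
  have h4 : evenElt w w' * evenElt w w' * evenElt w w' = evenElt w w' := by
    conv_lhs => rw [even_eq_fromBlocks (evenElt_mem w w') h2, Matrix.fromBlocks_multiply,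
      Matrix.fromBlocks_multiply]
    conv_rhs => rw [even_eq_fromBlocks (evenElt_mem w w') h2]
    simp [h3]
  obtain ⟨r, rfl⟩ := hm
  induction r with
  | zero => simp
  | succ r ih =>
    rw [show 2 * (r + 1) + 1 = 2 * r + 1 + 1 + 1 by ring, pow_succ, pow_succ, ih, h4]

/-- Two weights for the same character differ by a highest weight for the trivial character. -/
theorem hasHW_of_mem_weights (h2 : (2 : K) ≠ 0) {χ : (osp K n p).part 0 →ₗ[K] K}
    {l₀ l : (cartan p P).part 0 →ₗ[K] K} (h₀ : HasHW P χ l₀) (hl₀ : l₀ ∈ weights p P χ)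
    (hl : l ∈ weights p P χ) : HasHW P χ l := by
  have hp2 : p ≠ 2 := by
    rintro rfl
    exact h2 (by exact_mod_cast CharP.cast_eq_zero K 2)
  have hodd : Odd p := (Fact.out : p.Prime).odd_of_ne_two hp2
  have h1 : HasHW P 0 (l - l₀) := by
    refine hasHW_zero_of_pow_eq h2 _ fun k => ?_
    have hk := k.2
    have h3 : (cartan p P).pmap (cartanElt p P k) = cartanElt p P k := by
      apply Subtype.ext
      refine evenElt_pow_of_symp_eq h2 ?_ hodd
      rw [symp_bvec P (by omega) (by omega), antiForm, if_pos (by omega), stdSign, if_pos hk, one_pow]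
    have h4 := hl (cartanElt p P k)
    have h5 := hl₀ (cartanElt p P k)
    rw [h3] at h4 h5
    rw [LinearMap.sub_apply, sub_pow_char]
    linear_combination h4 - h5
  have := h₀.add h1
  rwa [add_zero, add_sub_cancel] at this

end Weights

/-! ### Oscillator representations -/

section Oscillator

/-- In odd characteristic `p`, Jacobson's formula has no correction terms if the commutator is
central. -/
theorem add_pow_prime_of_commute {K R : Type*} [Field K] [Ring R] [Algebra K R] (p : ℕ)
    [hp : Fact p.Prime] [CharP K p] [CharP R p] (hp2 : 2 < p) {x y : R}
    (hx : Commute x (x * y - y * x)) (hy : Commute y (x * y - y * x)) :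
    (x + y) ^ p = x ^ p + y ^ p := by
  have h1 : ∀ i, jacobsonCoeff x y 1 i = if i = 0 then x * y - y * x else 0 := by
    intro i
    cases i with
    | zero => simp [jacobsonCoeff_succ_zero, jacobsonCoeff_zero]
    | succ i => simp [jacobsonCoeff_succ_succ, jacobsonCoeff_zero]
  have h2 : ∀ m i, jacobsonCoeff x y (m + 2) i = 0 := by
    intro m
    induction m with
    | zero =>
      intro i
      cases i with
      | zero => rw [jacobsonCoeff_succ_zero, h1, if_pos rfl, hx.eq, sub_self]
      | succ i =>
        rw [jacobsonCoeff_succ_succ, h1, h1, if_neg (Nat.succ_ne_zero i)]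
        split_ifs
        · rw [hy.eq]; simp
        · simp
    | succ m ih =>
      intro i
      cases i with
      | zero => rw [jacobsonCoeff_succ_zero, ih]; simp
      | succ i => rw [jacobsonCoeff_succ_succ, ih, ih]; simp
  rw [add_pow_prime_eq_jacobson (K := K) p]
  obtain ⟨m, rfl⟩ : ∃ m, p = m + 3 := ⟨p - 3, by omega⟩
  simp [h2]

variable {K : Type*} [Field K] {n p : ℕ}

/-- Generators of a Weyl algebra satisfy the paraboson relations. -/
theorem isParaHom_of_weyl [Fact p.Prime] [CharP K p] {B : Type*} [Ring B] [Algebra K B] (h2 : (2 : K) ≠ 0)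
    {A : (Fin n ⊕ Fin n → K) →ₗ[K] B} {θ : (Fin n ⊕ Fin n → K) → K}
    (hA : ∀ w w', A w * A w' - A w' * A w = (-(2 : K)⁻¹ * symp K n w w') • (1 : B))
    (hp : ∀ w, A w ^ p = algebraMap K B (θ w ^ p)) {χ : (osp K n p).part 0 →ₗ[K] K}
    (hχ : ∀ w, χ ⟨evenElt w w, evenElt_mem w w⟩ = 2 * θ w ^ 2) : IsParaHom χ A where
  rel w w' z := by
    have e1 : ∀ u u', A u * A u' * A z - A z * (A u * A u') =
        (2 : K)⁻¹ • (symp K n z u' • A u + symp K n z u • A u') := by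
      intro u u'
      have : A u * A u' * A z - A z * (A u * A u') =
          A u * (A u' * A z - A z * A u') + (A u * A z - A z * A u) * A u' := by noncomm_ring
      rw [this, hA, hA, symp_swap u', symp_swap u, mul_smul_comm, smul_mul_assoc, mul_one, one_mul,
        smul_add, smul_smul, smul_smul, neg_mul_neg, neg_mul_neg]
    rw [add_mul, mul_add, add_sub_add_comm, e1, e1, ← smul_add,
      add_comm (symp K n z w • A w'), ← two_smul K, inv_smul_smul₀ h2]
  pow w := by
    rw [smul_pow, ← pow_two, ← pow_mul, mul_comm 2 p, pow_mul, hp, hχ, mul_pow, ← map_pow,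
      Algebra.smul_def, ← map_mul, ← pow_mul, ← pow_mul, mul_comm p 2]

variable (K n p)

/-- Functions on the discrete torus. -/
abbrev Torus : Type _ := (Fin n → ZMod p) → K

variable {K n p}

/-- The discrete shift operators `(D_i g)(m) = g (m + e_i)`. -/
def shiftOp (p : ℕ) (i : Fin n) : Module.End K (Torus K n p) :=
  LinearMap.funLeft K K (· + Pi.single i 1)

theorem shiftOp_apply (i : Fin n) (g : Torus K n p) (m : Fin n → ZMod p) :
    shiftOp p i g m = g (m + Pi.single i 1) := rfl

theorem shiftOp_comm (i j : Fin n) : (shiftOp p i * shiftOp p j : Module.End K (Torus K n p)) =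
    shiftOp p j * shiftOp p i := by
  refine LinearMap.ext fun g => funext fun m => ?_
  simp only [Module.End.mul_apply, shiftOp_apply]
  rw [add_right_comm]

theorem shiftOp_pow (i : Fin n) : (shiftOp p i ^ p : Module.End K (Torus K n p)) = 1 := by
  have h : ∀ k : ℕ, ∀ (g : Torus K n p) m, (shiftOp p i ^ k) g m = g (m + Pi.single i (k : ZMod p)) := by
    intro k
    induction k with
    | zero => simp
    | succ k ih =>
      intro g m
      rw [pow_succ', Module.End.mul_apply, shiftOp_apply, ih, add_assoc, ← Pi.single_add]
      push_cast
      rw [add_comm (1 : ZMod p)]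
  refine LinearMap.ext fun g => funext fun m => ?_
  rw [h]
  simp

variable [Fact p.Prime] [CharP K p]

/-- The operators `(X_i g)(m) = m_i g (m - e_i)`, dual to the shift operators. -/
def raiseOp (p : ℕ) [CharP K p] (i : Fin n) : Module.End K (Torus K n p) where
  toFun g m := ZMod.castHom (dvd_refl p) K (m i) * g (m - Pi.single i 1)
  map_add' f g := by ext m; simp [mul_add]
  map_smul' c g := by ext m; simp [mul_left_comm]

theorem raiseOp_apply (i : Fin n) (g : Torus K n p) (m : Fin n → ZMod p) :
    raiseOp p i g m = ZMod.castHom (dvd_refl p) K (m i) * g (m - Pi.single i 1) := rfl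

theorem raiseOp_comm (i j : Fin n) : (raiseOp p i * raiseOp p j : Module.End K (Torus K n p)) =
    raiseOp p j * raiseOp p i := by
  refine LinearMap.ext fun g => funext fun m => ?_
  simp only [Module.End.mul_apply, raiseOp_apply]
  rw [sub_right_comm]
  by_cases h : i = j
  · rw [h]
  · simp only [Pi.sub_apply, Pi.single_apply, if_neg h, if_neg (Ne.symm h), sub_zero]
    ring

theorem shiftOp_raiseOp (i j : Fin n) :
    (shiftOp p i * raiseOp p j - raiseOp p j * shiftOp p i : Module.End K (Torus K n p)) =
      if i = j then 1 else 0 := by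
  refine LinearMap.ext fun g => funext fun m => ?_
  simp only [Module.End.mul_apply, shiftOp_apply, raiseOp_apply, LinearMap.sub_apply, Pi.sub_apply]
  rw [sub_add_eq_add_sub, ← sub_mul, ← map_sub, Pi.add_apply, add_sub_cancel_left]
  split_ifs with h
  · subst h
    simp
  · rw [Pi.single_eq_of_ne (Ne.symm h)]
    simp

theorem raiseOp_pow (i : Fin n) : (raiseOp p i ^ p : Module.End K (Torus K n p)) = 0 := by
  -- After `k` steps the operator vanishes at all points with `i`-th coordinate below `k`.
  have h : ∀ k : ℕ, ∀ (g : Torus K n p) (m : Fin n → ZMod p), (∃ r : ℕ, r < k ∧ m i = r) →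
      (raiseOp p i ^ k) g m = 0 := by
    intro k
    induction k with
    | zero => rintro g m ⟨r, hr, -⟩; omega
    | succ k ih =>
      rintro g m ⟨r, hr, hm⟩
      rw [pow_succ', Module.End.mul_apply, raiseOp_apply]
      cases r with
      | zero => rw [hm]; simp
      | succ r =>
        rw [ih, mul_zero]
        exact ⟨r, by omega, by simp [hm]⟩
  refine LinearMap.ext fun g => funext fun m => ?_
  exact h p g m ⟨(m i).val, ZMod.val_lt _, by simp⟩

/-- The generators of the Weyl algebra in the oscillator representation. -/
def osc (p : ℕ) [Fact p.Prime] [CharP K p] :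
    (Fin n ⊕ Fin n → K) →ₗ[K] Module.End K (Torus K n p) where
  toFun w := ∑ i, (w (.inr i) • shiftOp p i + (-(2 : K)⁻¹ * w (.inl i)) • raiseOp p i)
  map_add' w w' := by
    rw [← Finset.sum_add_distrib]
    refine Finset.sum_congr rfl fun i _ => ?_
    simp only [Pi.add_apply, mul_add, add_smul]
    abel
  map_smul' c w := by
    rw [Finset.smul_sum]
    refine Finset.sum_congr rfl fun i _ => ?_
    simp only [Pi.smul_apply, smul_eq_mul, smul_add, smul_smul, RingHom.id_apply, mul_left_comm]

theorem osc_apply (w : Fin n ⊕ Fin n → K) :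
    osc p w = ∑ i, (w (.inr i) • shiftOp p i + (-(2 : K)⁻¹ * w (.inl i)) • raiseOp p i) := rfl

theorem osc_comm (w w' : Fin n ⊕ Fin n → K) :
    osc p w * osc p w' - osc p w' * osc p w = (-(2 : K)⁻¹ * symp K n w w') • 1 := by
  have e1 : ∀ i j, (w (.inr i) • shiftOp p i + (-(2 : K)⁻¹ * w (.inl i)) • raiseOp p i :
        Module.End K (Torus K n p)) *
      (w' (.inr j) • shiftOp p j + (-(2 : K)⁻¹ * w' (.inl j)) • raiseOp p j) -
      (w' (.inr j) • shiftOp p j + (-(2 : K)⁻¹ * w' (.inl j)) • raiseOp p j) *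
      (w (.inr i) • shiftOp p i + (-(2 : K)⁻¹ * w (.inl i)) • raiseOp p i) =
      (if i = j then (2 : K)⁻¹ * (w (.inl i) * w' (.inr j) - w (.inr i) * w' (.inl j)) else 0) • 1 := by
    intro i j
    have e2 := shiftOp_raiseOp (K := K) (p := p) i j
    have e3 := shiftOp_raiseOp (K := K) (p := p) j i
    rw [sub_eq_iff_eq_add] at e2 e3
    simp only [add_mul, mul_add, smul_mul_smul_comm, shiftOp_comm i j, raiseOp_comm i j, e2, e3]
    by_cases h : i = j
    · subst h
      simp only [if_true]
      module
    · simp only [if_neg h, if_neg (Ne.symm h)]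
      module
  rw [osc_apply, osc_apply, Finset.sum_mul_sum, Finset.sum_mul_sum,
    Finset.sum_comm (f := fun i j => (w' (.inr i) • shiftOp p i + (-(2 : K)⁻¹ * w' (.inl i)) •
      raiseOp p i : Module.End K (Torus K n p)) *
      (w (.inr j) • shiftOp p j + (-(2 : K)⁻¹ * w (.inl j)) • raiseOp p j)),
    ← Finset.sum_sub_distrib]
  simp only [← Finset.sum_sub_distrib, e1]
  simp only [← Finset.sum_smul, Finset.sum_ite_eq, Finset.mem_univ, if_true]
  congr 1
  rw [symp_apply, Matrix.J, Matrix.fromBlocks_mulVec]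
  simp only [dotProduct, Fintype.sum_sum_type, Sum.elim_inl, Sum.elim_inr, Matrix.zero_mulVec,
    Matrix.one_mulVec, Matrix.neg_mulVec, zero_add, add_zero, Function.comp_apply, Pi.neg_apply,
    ← Finset.sum_add_distrib, Finset.mul_sum]
  refine Finset.sum_congr rfl fun i _ => ?_
  simp
  ring

theorem osc_pow (hp2 : 2 < p) (w : Fin n ⊕ Fin n → K) :
    osc p w ^ p = algebraMap K (Module.End K (Torus K n p)) ((∑ i, w (.inr i)) ^ p) := by
  have : CharP (Module.End K (Torus K n p)) p :=
    charP_of_injective_algebraMap (algebraMap K _).injective p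
  have hp0 : p ≠ 0 := by omega
  have hadd : ∀ w w', osc p (w + w') ^ p =
      (osc p w ^ p + osc p w' ^ p : Module.End K (Torus K n p)) := by
    intro w w'
    rw [map_add]
    have hc : ∀ x : Module.End K (Torus K n p), Commute x (osc p w * osc p w' - osc p w' * osc p w) := by
      intro x
      rw [osc_comm, ← Algebra.algebraMap_eq_smul_one]
      exact (Algebra.commutes _ x).symm
    exact add_pow_prime_of_commute (K := K) p hp2 (hc _) (hc _)
  have hw : w ∈ Submodule.span K (Set.range (Pi.basisFun K (Fin n ⊕ Fin n))) := by
    rw [Module.Basis.span_eq]; trivial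
  induction hw using Submodule.span_induction with
  | mem w hw =>
    obtain ⟨i | i, rfl⟩ := hw
    · rw [Pi.basisFun_apply, osc_apply, Finset.sum_eq_single i]
      · have h3 : ∀ j, (Pi.single (Sum.inl i) 1 : Fin n ⊕ Fin n → K) (.inr j) = 0 := fun j =>
          Pi.single_eq_of_ne (by simp) _
        simp only [h3, zero_smul, zero_add, smul_pow, raiseOp_pow, smul_zero,
          Finset.sum_const_zero, zero_pow hp0, map_zero]
      · intro j _ hj
        simp [hj]
      · simp
    · rw [Pi.basisFun_apply, osc_apply, Finset.sum_eq_single i]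
      · simp [shiftOp_pow, Pi.single_apply]
      · intro j _ hj
        simp [hj]
      · simp
  | zero => simp [hp0]
  | add w w' _ _ h1 h2 =>
    rw [hadd, h1, h2, ← map_add, ← add_pow_char, ← Finset.sum_add_distrib]
    rfl
  | smul c w _ h =>
    rw [map_smul, smul_pow, h, Algebra.smul_def, ← map_mul, ← mul_pow, Finset.mul_sum]
    rfl

variable (p) in
/-- The functional `x ↦ ω(u, x u)`. -/
def sqFun (u : Fin n ⊕ Fin n → K) : (osp K n p).part 0 →ₗ[K] K where
  toFun x := symp K n u ((blk K n x.1).mulVec u)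
  map_add' x y := by
    change symp K n u ((blk K n (x.1 + y.1)).mulVec u) = _
    rw [map_add, Matrix.add_mulVec, map_add]
  map_smul' c x := by
    change symp K n u ((blk K n (c • x.1)).mulVec u) = _
    rw [map_smul, Matrix.smul_mulVec, map_smul]
    rfl

theorem sqFun_apply (u : Fin n ⊕ Fin n → K) (x : (osp K n p).part 0) :
    sqFun p u x = symp K n u ((blk K n x.1).mulVec u) := rfl

theorem sqFun_evenElt (u w : Fin n ⊕ Fin n → K) :
    sqFun p u ⟨evenElt w w, evenElt_mem w w⟩ = 2 * symp K n u w ^ 2 := by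
  rw [sqFun_apply, blk_evenElt_mulVec, map_add, map_smul, smul_eq_mul]
  ring

/-- Twisting the oscillator representation by an automorphism of the Weyl algebra that adds scalars
to the generators realizes all functionals `x ↦ ω(u, x u)` as `p`-characters. -/
theorem exists_isParaHom_sqFun (hp2 : 2 < p) (h2 : (2 : K) ≠ 0) (u : Fin n ⊕ Fin n → K) :
    ∃ a : (Fin n ⊕ Fin n → K) →ₗ[K] Module.End K (Torus K n p), IsParaHom (sqFun p u) a := by
  let η : (Fin n ⊕ Fin n → K) →ₗ[K] K := ∑ i : Fin n, LinearMap.proj (.inr i)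
  have hη : ∀ w, η w = ∑ i, w (.inr i) := fun w => by simp [η]
  have : CharP (Module.End K (Torus K n p)) p :=
    charP_of_injective_algebraMap (algebraMap K _).injective p
  refine ⟨osc p + Algebra.linearMap K _ ∘ₗ (symp K n u - η), isParaHom_of_weyl h2 (θ := symp K n u)
    (fun w w' => ?_) (fun w => ?_) (sqFun_evenElt u)⟩
  · rw [← osc_comm]
    simp only [LinearMap.add_apply, LinearMap.comp_apply, Algebra.linearMap_apply, add_mul, mul_add,
      ← Algebra.commutes _ (osc p w), ← Algebra.commutes _ (osc p w'), ← map_mul,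
      mul_comm ((symp K n u - η) w)]
    abel
  · rw [LinearMap.add_apply, LinearMap.comp_apply, Algebra.linearMap_apply,
      add_pow_char_of_commute p (Algebra.commutes _ _).symm, osc_pow hp2, ← map_pow,
      ← map_add, ← add_pow_char, ← hη, LinearMap.sub_apply, add_sub_cancel]

/-- The functionals `x ↦ ω(u, x u)` span the dual of `osp(1|2n)_0`. -/
theorem span_sqFun (h2 : (2 : K) ≠ 0) :
    Submodule.span K (Set.range (sqFun (K := K) (n := n) p)) = ⊤ := by
  rw [← Subspace.dualCoannihilator_dualAnnihilator_eq
    (W := Submodule.span K (Set.range (sqFun (K := K) (n := n) p)))]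
  have h : (Submodule.span K (Set.range (sqFun (K := K) (n := n) p))).dualCoannihilator = ⊥ := by
    rw [eq_bot_iff]
    intro x hx
    rw [Submodule.mem_dualCoannihilator] at hx
    have h0 : ∀ u, symp K n u ((blk K n x.1).mulVec u) = 0 := fun u =>
      hx _ (Submodule.subset_span ⟨u, rfl⟩)
    have h1 : ∀ u v, symp K n u ((blk K n x.1).mulVec v) = 0 := by
      intro u v
      have e1 := h0 (u + v)
      rw [Matrix.mulVec_add, map_add, map_add, LinearMap.add_apply, LinearMap.add_apply, h0, h0,
        zero_add, add_zero, symp_swap v, symp_blk x.2, neg_neg, ← two_mul] at e1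
      exact (mul_eq_zero.1 e1).resolve_left h2
    have h3 : blk K n x.1 = 0 := by
      refine Matrix.toLin'.injective (LinearMap.ext fun v => ?_)
      have e1 := sum_symp_smul_dual ((blk K n x.1).mulVec v)
      simp only [symp_swap ((blk K n x.1).mulVec v), h1, neg_zero, zero_smul,
        Finset.sum_const_zero] at e1
      rw [Matrix.toLin'_apply, neg_eq_zero.1 e1.symm, map_zero, LinearMap.zero_apply]
    apply Subtype.ext
    rw [even_eq_fromBlocks x.2 h2, h3]
    simp
  rw [h, Submodule.dualAnnihilator_bot]

end Oscillator

section Existence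

universe u

variable {K : Type u} [Field K] {n p : ℕ} [Fact p.Prime] [CharP K p]

/-- `U_χ(osp(1|2n))` has a nonzero finite-dimensional representation, for every `χ`. -/
theorem exists_isParaHom [IsAlgClosed K] (hp2 : 2 < p) (h2 : (2 : K) ≠ 0)
    (χ : (osp K n p).part 0 →ₗ[K] K) : ∃ (M : Type u) (_ : AddCommGroup M) (_ : Module K M)
      (a : (Fin n ⊕ Fin n → K) →ₗ[K] Module.End K M),
      FiniteDimensional K M ∧ Nontrivial M ∧ IsParaHom χ a := by
  have hχ : χ ∈ Submodule.span K (Set.range (sqFun (K := K) (n := n) p)) := by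
    rw [span_sqFun h2]; trivial
  rw [← one_smul K χ]
  generalize (1 : K) = c
  have hsq : ∀ u : Fin n ⊕ Fin n → K, ∃ (M : Type u) (_ : AddCommGroup M) (_ : Module K M)
      (a : (Fin n ⊕ Fin n → K) →ₗ[K] Module.End K M),
      FiniteDimensional K M ∧ Nontrivial M ∧ IsParaHom (sqFun p u) a := by
    intro u
    obtain ⟨a, ha⟩ := exists_isParaHom_sqFun (p := p) hp2 h2 u
    exact ⟨Torus K n p, inferInstance, inferInstance, a, inferInstance, inferInstance, ha⟩
  induction hχ using Submodule.span_induction generalizing c with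
  | mem χ h =>
    obtain ⟨u, rfl⟩ := h
    obtain ⟨d, hd⟩ := IsAlgClosed.exists_pow_nat_eq c (n := 2) two_pos
    have h : c • sqFun p u = sqFun p (d • u) := by
      ext x
      rw [sqFun_apply, LinearMap.smul_apply, sqFun_apply, Matrix.mulVec_smul, map_smul, map_smul,
        LinearMap.smul_apply, smul_smul, ← pow_two, hd]
    rw [h]
    exact hsq _
  | zero =>
    have h : c • 0 = sqFun (K := K) (n := n) p 0 := by
      ext x
      rw [sqFun_apply]
      simp
    rw [h]
    exact hsq _
  | add χ₁ χ₂ _ _ h1 h2 =>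
    obtain ⟨M, _, _, a₁, _, _, ha₁⟩ := h1 c
    obtain ⟨N, _, _, a₂, _, _, ha₂⟩ := h2 c
    obtain ⟨a, ha, -⟩ := ha₁.exists_tensor ha₂
    rw [smul_add]
    exact ⟨(M × M) ⊗[K] N, inferInstance, inferInstance, a, inferInstance, inferInstance, ha⟩
  | smul d χ _ h =>
    rw [smul_smul]
    exact h _

end Existence

/-! ### Existence of highest weight vectors -/

section Engel

/-- Commuting operators have a common eigenvector in any nonzero stable subspace. -/
theorem exists_common_eigenvector {K V : Type*} [Field K] [IsAlgClosed K] [AddCommGroup V] [Module K V]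
    [FiniteDimensional K V] {E : Submodule K V} (hE : E ≠ ⊥) (T : ℕ → Module.End K V) (r : ℕ)
    (hT : ∀ k < r, ∀ v ∈ E, T k v ∈ E)
    (hcomm : ∀ k < r, ∀ j < r, ∀ v, T k (T j v) = T j (T k v)) :
    ∃ v ∈ E, v ≠ 0 ∧ ∀ k < r, ∃ μ : K, T k v = μ • v := by
  induction r generalizing E with
  | zero =>
    obtain ⟨v, hv, hv0⟩ := Submodule.exists_mem_ne_zero_of_ne_bot hE
    exact ⟨v, hv, hv0, fun k hk => absurd hk (Nat.not_lt_zero k)⟩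
  | succ r ih =>
    obtain ⟨μ, w, hw, hw0, hμ⟩ := exists_eigenvector_mem hE (T r) (hT r (Nat.lt_succ_self r))
    have hE' : E ⊓ LinearMap.ker (T r - μ • 1) ≠ ⊥ := fun h => hw0 <| (Submodule.mem_bot K).1 <| by
      rw [← h]
      exact ⟨hw, by simp [hμ]⟩
    obtain ⟨v, hv, hv0, h⟩ := ih hE' (fun k hk v hv => ⟨hT k (by omega) v hv.1, by
        have h1 : T r v - μ • v = 0 := hv.2
        change T r (T k v) - μ • T k v = 0
        rw [hcomm r (Nat.lt_succ_self r) k (by omega), ← map_smul, ← map_sub, h1, map_zero]⟩)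
      (fun k hk j hj => hcomm k (by omega) j (by omega))
    refine ⟨v, hv.1, hv0, fun k hk => ?_⟩
    rcases Nat.lt_succ_iff_lt_or_eq.1 hk with hk | rfl
    · exact h k hk
    · have h1 : T k v - μ • v = 0 := hv.2
      exact ⟨μ, sub_eq_zero.1 h1⟩

/-- If the even root vectors of `n⁻` have vanishing `p`-th powers on a nonzero finite-dimensional
module, then some nonzero vector is annihilated by `n⁻` and is an eigenvector of the Cartan
subalgebra. -/
theorem IsParabose.exists_extremal_vector {K V : Type*} [Field K] [IsAlgClosed K] [AddCommGroup V]
    [Module K V] [FiniteDimensional K V] [Nontrivial V] {n p : ℕ} {c : ℕ → K} {a : ℕ → Module.End K V}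
    (h : IsParabose (2 * n) c a) (h2 : (2 : K) ≠ 0)
    (hnil : ∀ i j, i + j + 2 ≤ 2 * n → anti a i j ^ p = 0) :
    ∃ v : V, v ≠ 0 ∧ (∀ i < n, a i v = 0) ∧ (∀ i j, i + j + 2 ≤ 2 * n → anti a i j v = 0) ∧
      ∀ k < n, ∃ μ : K, anti a k (2 * n - 1 - k) v = μ • v := by
  have hE := exists_whittaker_vectors (p := p) (χ := fun _ _ => 0) h h2 (le_refl n) (fun _ _ => rfl)
    (fun _ _ _ => rfl) (fun _ _ => rfl) (by simpa using hnil)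
  have hmem : ∀ v, v ∈ (⨅ i ∈ negIdx n n, LinearMap.ker (negOp a (fun _ _ => 0) i)) ↔
      (∀ i < n, a i v = 0) ∧ ∀ i j, i + j + 2 ≤ 2 * n → anti a i j v = 0 := by
    intro v
    simp only [Submodule.mem_iInf, forall_mem_negIdx, LinearMap.mem_ker]
    constructor
    · rintro ⟨h1, h3⟩
      refine ⟨h3, fun i j hij => ?_⟩
      rcases le_total i j with hle | hle
      · simpa [negOp] using h1 i j hle hij
      · rw [anti_comm]
        simpa [negOp] using h1 j i hle (by omega)
    · rintro ⟨h1, h3⟩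
      exact ⟨fun i j _ hij => by simpa [negOp] using h3 i j hij, h1⟩
  have hstable : ∀ k < n, ∀ v ∈ (⨅ i ∈ negIdx n n, LinearMap.ker (negOp a (fun _ _ => 0) i)),
      anti a k (2 * n - 1 - k) v ∈ (⨅ i ∈ negIdx n n, LinearMap.ker (negOp a (fun _ _ => 0) i)) := by
    intro k hk v hv
    rw [hmem] at hv ⊢
    obtain ⟨h1, h3⟩ := hv
    constructor
    · intro i hi
      have e1 := h.anti_apply (i := k) (j := 2 * n - 1 - k) (k := i) (by omega) (by omega) (by omega) v
      have e2 : antiForm (2 * n) c i (2 * n - 1 - k) • a k v +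
          antiForm (2 * n) c i k • a (2 * n - 1 - k) v ∈ (⊥ : Submodule K V) := by
        refine add_mem (antiForm_smul_mem fun e => ?_) (antiForm_smul_mem fun e => ?_)
        · rw [Submodule.mem_bot, h1 k hk]
        · omega
      rw [(Submodule.mem_bot K).1 e2, h1 i hi, map_zero, add_zero] at e1
      exact e1.symm
    · intro i j hij
      have e1 := h.anti_anti_apply (i := k) (j := 2 * n - 1 - k) (k := i) (l := j) (by omega)
        (by omega) (by omega) (by omega) v
      have e2 : antiForm (2 * n) c i (2 * n - 1 - k) • anti a k j v +
          antiForm (2 * n) c i k • anti a (2 * n - 1 - k) j v +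
          antiForm (2 * n) c j (2 * n - 1 - k) • anti a i k v +
          antiForm (2 * n) c j k • anti a i (2 * n - 1 - k) v ∈ (⊥ : Submodule K V) := by
        refine add_mem (add_mem (add_mem ?_ ?_) ?_) ?_ <;>
          exact antiForm_smul_mem fun e => (Submodule.mem_bot K).2 (h3 _ _ (by omega))
      rw [(Submodule.mem_bot K).1 e2, h3 i j hij, map_zero, add_zero] at e1
      exact e1.symm
  have hcomm : ∀ k < n, ∀ j < n, ∀ v, anti a k (2 * n - 1 - k) (anti a j (2 * n - 1 - j) v) =
      anti a j (2 * n - 1 - j) (anti a k (2 * n - 1 - k) v) := by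
    intro k hk j hj v
    by_cases hkj : k = j
    · rw [hkj]
    have h0 : antiForm (2 * n) c j k = 0 ∧ antiForm (2 * n) c j (2 * n - 1 - k) = 0 ∧
        antiForm (2 * n) c (2 * n - 1 - j) (2 * n - 1 - k) = 0 ∧
        antiForm (2 * n) c (2 * n - 1 - j) k = 0 :=
      ⟨if_neg (by omega), if_neg (by omega), if_neg (by omega), if_neg (by omega)⟩
    have e1 := h.anti_anti_apply (i := k) (j := 2 * n - 1 - k) (k := j) (l := 2 * n - 1 - j) (by omega)
      (by omega) (by omega) (by omega) v
    rw [h0.1, h0.2.1, h0.2.2.1, h0.2.2.2] at e1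
    simpa using e1
  obtain ⟨v, hv, hv0, hμ⟩ :=
    exists_common_eigenvector hE (fun k => anti a k (2 * n - 1 - k)) n hstable hcomm
  exact ⟨v, hv0, ((hmem v).1 hv).1, ((hmem v).1 hv).2, hμ⟩

universe u

variable {K : Type u} [Field K] [IsAlgClosed K] {n p : ℕ} [Fact p.Prime] [CharP K p]
  {P : Matrix.symplecticGroup (Fin n) K} {χ : (osp K n p).part 0 →ₗ[K] K}

theorem IsParaHom.exists_isHWVec (h2 : (2 : K) ≠ 0)
    (hχ : ∀ x : (osp K n p).part 0, x.1 ∈ nilPart P 0 → χ x = 0)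
    {M : Type*} [AddCommGroup M] [Module K M] [FiniteDimensional K M] [Nontrivial M]
    {a : (Fin n ⊕ Fin n → K) →ₗ[K] Module.End K M} (ha : IsParaHom χ a) :
    ∃ (v : M) (l : (cartan p P).part 0 →ₗ[K] K), IsHWVec P a v l := by
  obtain ⟨φ, hφ⟩ := ha.exists_algHom h2
  -- Reversing the symplectic basis exchanges `n⁺` and `n⁻`.
  have hb : IsParabose (2 * n) (fun k => stdSign K n (2 * n - 1 - k))
      (fun k => a (bvec P (2 * n - 1 - k))) :=
    ha.isParabose (b := fun k => bvec P (2 * n - 1 - k)) fun k j hk hj => by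
      rw [symp_bvec P (by omega) (by omega), antiForm, antiForm]
      congr 1
      exact propext (by omega)
  obtain ⟨v, hv0, h1, h3, h4⟩ := hb.exists_extremal_vector (p := p) h2 (fun i j hij => by
    have hs : symp K n (bvec P (2 * n - 1 - i)) (bvec P (2 * n - 1 - j)) = 0 := by
      rw [symp_bvec P (by omega) (by omega), antiForm, if_neg (by omega)]
    have e1 := congrArg φ (evenGen_pow χ ⟨evenElt (bvec P (2 * n - 1 - i)) (bvec P (2 * n - 1 - j)),
      evenElt_mem _ _⟩)
    rw [pmap_evenElt h2 hs, hχ _ (evenElt_bvec_mem_nilPart P (by omega) (by omega) (by omega)),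
      zero_pow (Fact.out : p.Prime).ne_zero, map_zero, map_zero, sub_zero, map_pow, map_zero,
      algHom_evenGen, hφ, hφ] at e1
    exact e1)
  refine ⟨v, SuperLie.exists_isHWVec h2 ha hv0 (fun k hk hk2 => ?_) (fun k j hk hj hkj => ?_) (fun k => ?_)⟩
  · have := h1 (2 * n - 1 - k) (by omega)
    rwa [show 2 * n - 1 - (2 * n - 1 - k) = k by omega] at this
  · have := h3 (2 * n - 1 - k) (2 * n - 1 - j) (by omega)
    rw [anti, show 2 * n - 1 - (2 * n - 1 - k) = k by omega,
      show 2 * n - 1 - (2 * n - 1 - j) = j by omega] at this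
    exact this
  · obtain ⟨μ, hμ⟩ := h4 k k.2
    have hk := k.2
    rw [anti_comm, anti, show 2 * n - 1 - (2 * n - 1 - (k : ℕ)) = k by omega] at hμ
    exact ⟨μ, hμ⟩

/-- Every weight is the weight of a nonzero highest weight vector in some representation. -/
theorem hasHW_of_isAlgClosed (hp2 : 2 < p) (h2 : (2 : K) ≠ 0)
    (hχ : ∀ x : (osp K n p).part 0, x.1 ∈ nilPart P 0 → χ x = 0)
    {l : (cartan p P).part 0 →ₗ[K] K} (hl : l ∈ weights p P χ) : HasHW P χ l := by
  obtain ⟨M, _, _, a, _, _, ha⟩ := exists_isParaHom hp2 h2 χ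
  obtain ⟨v, l₀, hv⟩ := ha.exists_isHWVec h2 hχ
  exact hasHW_of_mem_weights h2 ⟨M, inferInstance, inferInstance, a, v, ha, hv⟩ (hv.mem_weights h2 ha) hl

end Engel

/-- Restriction of a representation to a stable subspace. -/
theorem exists_restrict {K A M : Type*} [Field K] [Ring A] [Algebra K A] [AddCommGroup M] [Module K M]
    (φ : A →ₐ[K] Module.End K M) {N : Submodule K M} (hN : ∀ a, ∀ z ∈ N, φ a z ∈ N) :
    ∃ ρ : A →ₐ[K] Module.End K N, ∀ a (z : N), (ρ a z : M) = φ a z :=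
  ⟨AlgHom.ofLinearMap
    { toFun := fun a => (φ a).restrict (hN a)
      map_add' := fun a b => LinearMap.ext fun z => Subtype.ext (by simp)
      map_smul' := fun c a => LinearMap.ext fun z => Subtype.ext (by simp) }
    (LinearMap.ext fun z => Subtype.ext (by simp))
    (fun a b => LinearMap.ext fun z => Subtype.ext (by simp)), fun _ _ => rfl⟩

end SuperLie

theorem mainTheorem9 (K : Type*) [Field K] [IsAlgClosed K] (p : ℕ) [Fact p.Prime] [CharP K p]
    (hp : 2 < p) (n : ℕ) (hn : 1 ≤ n)
    (P : Matrix.symplecticGroup (Fin n) K)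
    (χ : (SuperLie.osp K n p).part 0 →ₗ[K] K)
    (hreg : SuperLie.IsRegularNilpotent χ)
    (hχ : ∀ x : (SuperLie.osp K n p).part 0, x.1 ∈ SuperLie.nilPart P 0 → χ x = 0)
    (l : (SuperLie.cartan p P).part 0 →ₗ[K] K) (hl : l ∈ SuperLie.weights p P χ) :
    SuperLie.IsSimpleSuper (SuperLie.RedEnv (SuperLie.osp K n p) χ)
      (SuperLie.babyVermaPart p P χ hχ l hl) := by
  have h2 : (2 : K) ≠ 0 := by
    have h := (CharP.cast_eq_zero_iff K p 2).not.2 (Nat.not_dvd_of_pos_of_lt two_pos hp)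
    exact_mod_cast h
  obtain ⟨M, _, _, a, v, ha, hv⟩ := SuperLie.hasHW_of_isAlgClosed hp h2 hχ hl
  obtain ⟨φ, hφ⟩ := ha.exists_algHom h2
  obtain ⟨s, hs, hsa, hs0, hs1⟩ := SuperLie.exists_vermaParity hχ hl h2
  obtain ⟨_, hdim⟩ := SuperLie.finrank_babyVerma_le hχ hl h2
  refine ⟨⟨_, 0, SuperLie.vermaVec_ne_zero hχ hl (hv.isHW h2 hφ) h2 hv.ne_zero⟩, fun N hN => ?_⟩
  refine or_iff_not_imp_left.2 fun hN0 => ?_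
  let N' : Submodule K (SuperLie.BabyVerma p P χ hχ l hl) := N.restrictScalars K
  -- A graded submodule is stable under the parity operator.
  have hsN : ∀ z ∈ N', s z ∈ N' := by
    intro z hz
    obtain ⟨z₀, h0, z₁, h1, hz0, hz1, rfl⟩ := hN z hz
    rw [map_add, hs0 _ h0, hs1 _ h1]
    exact N'.add_mem hz0 (N'.neg_mem hz1)
  have haN : ∀ u, ∀ z ∈ N', SuperLie.vermaRep hχ hl u z ∈ N' := fun u z hz => N.smul_mem u hz
  have hN' : Nontrivial N' := (Submodule.nontrivial_iff_ne_bot).2 fun h =>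
    hN0 ((Submodule.restrictScalars_eq_bot_iff _ _ _).1 h)
  obtain ⟨ρ, hρ⟩ := SuperLie.exists_restrict (SuperLie.vermaRep hχ hl) haN
  have hle := SuperLie.bvDim_le_finrank h2 hn P hreg hχ ((SuperLie.isParaHom_oddGen χ h2).comp ρ)
    (s.restrict hsN) (LinearMap.ext fun z => Subtype.ext (LinearMap.congr_fun hs z.1))
    (fun w => LinearMap.ext fun z => Subtype.ext (by
      have h := LinearMap.congr_fun (hsa w) z.1
      change s (ρ (SuperLie.oddGen χ w) z).1 = -(ρ (SuperLie.oddGen χ w) (s.restrict hsN z)).1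
      rw [hρ, hρ]
      exact h))
  have htop : N' = ⊤ := Submodule.eq_top_of_finrank_eq
    (le_antisymm (Submodule.finrank_le N') (hdim.trans hle))
  exact (Submodule.restrictScalars_eq_top_iff _ _ _).1 htop
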